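/- Let $e_1,e_2,e_3$ be the standard basis of $\mathbb{R}^3$, let $e_\xi=(e_1+e_2)/\sqrt2$ and $e_\eta=(e_1-e_2)/\sqrt2$, and for $v\in\mathbb{R}^3$ write $v_\xi=v\cdot e_\xi$, $v_\eta=v\cdot e_\eta$, $v_3=v\cdot e_3$; let $\partial_\xi,\partial_\eta,\partial_3$ be the distributional derivatives in the directions $e_\xi,e_\eta,e_3$. For $L>0$ let $\Omega=(0,L)^3$, and let $\mathcal{A}$ be the set of all pairs $(u,\beta)$ with $u\in L^1_{\mathrm{loc}}(\mathbb{R}^3)$ and $\beta\in L^1(\Omega;\mathbb{R}^3)$ such that, almost everywhere in $\Omega$, $\beta_3=0$, $\beta_\xi\beta_\eta=0$, $\beta_\xi\ge0$ and $\beta_\eta\ge0$. For $\theta\in(0,1/2]$ let $u_0(x)=(1-\theta)x_\xi+\theta x_\eta$, and for $\varepsilon,\mu>0$ and $(u,\beta)\in\mathcal{A}$ let $$E(u,\beta)=\int_\Omega|Du-\beta|^2\,dx+\varepsilon\Bigl(|\partial_\xi\beta_\eta|(\Omega)+|\partial_3\beta_\eta|(\Omega)+|\partial_\eta\beta_\xi|(\Omega)+|\partial_3\beta_\xi|(\Omega)\Bigr)+\mu\int_{\mathbb{R}^3\setminus\Omega}|D(u-u_0)|^2\,dx,$$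 where $Du$ is the distributional gradient of $u$ on $\mathbb{R}^3$, $|\partial_v f|(\Omega)\in[0,\infty]$ is the total variation on $\Omega$ of the distributional derivative $\partial_v f$, and $E(u,\beta)=\infty$ if $Du$ is not a locally integrable function on $\mathbb{R}^3$. Then there is a universal constant $c>0$ such that for all $\varepsilon,L,\mu>0$ and all $\theta\in(0,1/2]$, with $\hat\varepsilon=\varepsilon/(L\theta^2)$ and $$M=L^3\theta^2\min\Bigl\{\hat\varepsilon^{2/3},\ (\hat\varepsilon\mu)^{1/2}\ln^{1/2}\Bigl(3+\frac{\hat\varepsilon}{\mu^3}\Bigr),\ (\hat\varepsilon\mu)^{1/2}\ln^{1/2}\Bigl(\frac1\theta\Bigr),\ \mu,\ 1\Bigr\},$$ one has $$\frac1c\,M\ \le\ \inf_{(u,\beta)\in\mathcal{A}}E(u,\beta)\ \le\ c\,M.$$ -/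

import Mathlib

open MeasureTheory Set
open scoped ENNReal Gradient ContDiff

noncomputable section

namespace CrystalPlasticity

/-- Euclidean three-space; the coordinates are numbered `0, 1, 2`. -/
abbrev E3 : Type := EuclideanSpace ℝ (Fin 3)

/-- The slip plane normal `e_ξ = (e₁ + e₂) / √2`. -/
def eXi : E3 := !₂[1 / √2, 1 / √2, 0]

/-- The slip plane normal `e_η = (e₁ - e₂) / √2`. -/
def eEta : E3 := !₂[1 / √2, -(1 / √2), 0]

/-- The third Cartesian unit vector `e₃`. -/
def e3 : E3 := !₂[0, 0, 1]

/-- The component `v_ξ = v · e_ξ`. -/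
def xiComp (v : E3) : ℝ := inner ℝ v eXi

/-- The component `v_η = v · e_η`. -/
def etaComp (v : E3) : ℝ := inner ℝ v eEta

/-- The open cube `(0, L)³`. -/
def cube (L : ℝ) : Set E3 := {x | ∀ i, x i ∈ Ioo 0 L}

/-- `g` is the distributional gradient of `u` on all of `ℝ³`, and `u` and `g` are locally
integrable, that is, `u ∈ W^{1,1}_loc(ℝ³)` and `Du = g`. -/
def HasWeakGradient (u : E3 → ℝ) (g : E3 → E3) : Prop :=
  LocallyIntegrable u volume ∧ LocallyIntegrable g volume ∧
    ∀ φ : E3 → ℝ, ContDiff ℝ ∞ φ → HasCompactSupport φ →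
      ∀ v : E3, ∫ x, u x * fderiv ℝ φ x v = -∫ x, inner ℝ (g x) v * φ x

/-- The total variation `|∂_v f|(U)` on the open set `U` of the distributional derivative of `f`
in the direction `v`. It is `∞` if this derivative is not a finite measure on `U`. -/
def dirVariation (U : Set E3) (v : E3) (f : E3 → ℝ) : ℝ≥0∞ :=
  ⨆ φ ∈ {φ : E3 → ℝ | ContDiff ℝ ∞ φ ∧ HasCompactSupport φ ∧ tsupport φ ⊆ U ∧ ∀ x, |φ x| ≤ 1},
    ENNReal.ofReal (∫ x in U, f x * fderiv ℝ φ x v)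

/-- The admissible pairs `(u, β)` of deformations and plastic strains. The deformation is a locally
integrable function on `ℝ³`, since the energy involves it outside the cube as well; only the values
of `β` in the cube matter. -/
def admissible (L : ℝ) : Set ((E3 → ℝ) × (E3 → E3)) :=
  {p | LocallyIntegrable p.1 volume ∧ IntegrableOn p.2 (cube L) volume ∧
    ∀ᵐ x ∂(volume.restrict (cube L)),
      p.2 x 2 = 0 ∧ xiComp (p.2 x) * etaComp (p.2 x) = 0 ∧
        0 ≤ etaComp (p.2 x) ∧ 0 ≤ xiComp (p.2 x)}

/-- The far-field deformation `u₀(x) = (1 - θ) x_ξ + θ x_η`. -/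
def farField (θ : ℝ) (x : E3) : ℝ := (1 - θ) * xiComp x + θ * etaComp x

/-- The elastic energy `∫_Ω |Du - β|² + μ ∫_{ℝ³ ∖ Ω} |D(u - u₀)|²`, `Ω = (0, L)³`, with far field
`u₀` of volume fraction `θ`. The weak gradient is unique almost everywhere, so that the infimum
runs over one value if `Du` is a locally integrable function, and it is `∞` otherwise. -/
def elasticEnergy (μ θ L : ℝ) (u : E3 → ℝ) (β : E3 → E3) : ℝ≥0∞ :=
  ⨅ g ∈ {g : E3 → E3 | HasWeakGradient u g},
    (∫⁻ x in cube L, ‖g x - β x‖ₑ ^ 2) +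
      ENNReal.ofReal μ * ∫⁻ x in (cube L)ᶜ, ‖g x - ∇ (farField θ) x‖ₑ ^ 2

/-- The line-tension energy (without its prefactor)
`∫_Ω |∂_ξ β_η| + |∂_3 β_η| + |∂_η β_ξ| + |∂_3 β_ξ|`. -/
def lineEnergy (L : ℝ) (β : E3 → E3) : ℝ≥0∞ :=
  dirVariation (cube L) eXi (fun x => etaComp (β x)) +
    dirVariation (cube L) e3 (fun x => etaComp (β x)) +
    dirVariation (cube L) eEta (fun x => xiComp (β x)) +
    dirVariation (cube L) e3 (fun x => xiComp (β x))

/-- The crystal-plasticity functional `E(u, β)`. -/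
def energy (ε μ θ L : ℝ) (u : E3 → ℝ) (β : E3 → E3) : ℝ≥0∞ :=
  elasticEnergy μ θ L u β + ENNReal.ofReal ε * lineEnergy L β

/-- The infimum of `E(u, β)` over all admissible pairs. -/
def infEnergy (ε μ θ L : ℝ) : ℝ≥0∞ :=
  ⨅ p ∈ admissible L, energy ε μ θ L p.1 p.2

/-- The minimum in the scaling law, as a function of the rescaled line tension `e`. -/
def scalingMin (e μ θ : ℝ) : ℝ :=
  min (e ^ (2 / 3 : ℝ))
    (min ((e * μ) ^ (1 / 2 : ℝ) * Real.log (3 + e / μ ^ 3) ^ (1 / 2 : ℝ))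
      (min ((e * μ) ^ (1 / 2 : ℝ) * Real.log (1 / θ) ^ (1 / 2 : ℝ))
        (min μ 1)))

end CrystalPlasticity

end

/-!
Both bounds are reduced by scaling (`infEnergy_rescale_le`) to the unit cube, and energies are
measured in units of `θ²`; the line tension then becomes `e = ε / θ²`. The coordinates are numbered
`0, 1, 2`.

**Lower bound** (`lower_bound_unit`). Suppose that the energy is `θ² F` with `F` small compared to
the claimed minimum. The far field has slope at least `1/2` in direction `e_ξ`, so the first slip
system has to be active on most segments of a suitable length `r` in this direction
(`Competitor.measure_smallSlip_le`). The two systems exclude each other, so close to its activity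
the second system is controlled by its variation, which the line energy bounds; likewise the
activity of the first system hardly varies over a distance `s` in direction `e_η`, except on a set
of measure of the order `s F / e`. Hence, off a small exceptional set, `u` hardly changes over the
distance `s` in direction `e_η` (`Competitor.exists_exceptional_set`). But `u` has to change by
about `θ / 16` over the distance `1/16`, a multiple of `s`, so the deviation of `u` from the far
field is concentrated on the exceptional set, and its square integral over differences at distance
`s` is at least of the order `θ² s²` divided by the measure of this set (`Competitor.oneScale_le`).
After division by `s`, the contribution of `s = h / 4ⁿ` does not depend on `n`. On the other hand,
the sum over `n < N` of these quantities is controlled by the elastic energy: differences inside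
the cube are compared with those below the face `x₂ = 0`, on slabs that are disjoint for different
`n`, and a Hardy-type inequality takes care of the vertical parts of the paths that lie outside, so
that no factor `N` appears in front of the exterior energy (`sum_sq_enorm_sub_le`). This gives
`N h ≲ F 4ᴺ / h + F / μ` (`Competitor.multiscale_le`), and with `h` of the order `e / F` and `N` of the
order of the logarithm in the scaling law (`exists_number_of_scales`) a contradiction
(`Competitor.false_of_small`). Derivatives of measures are avoided throughout: weak
differentiability is used through the fundamental theorem of calculus on almost every segment
(`HasWeakGradient.ae_sub_eq`), and bounded variation through an integrable majorant of the
oscillation on segments (`exists_variation_majorant`).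

**Upper bound** (`upper_bound_unit`). Without slip on the second system the energy is of the order
`1` (`infEnergy_le_one`), or `μ` if the misfit is moved to the exterior (`infEnergy_le_mu`). The
other competitors have `N = 1 / h` cells across the coordinate `1`, in each of which the second
system is active on needles that occupy a region of width `w`, with `θ h ≤ w ≤ h`. The needles
refine towards the four lateral faces, with mesh `w s^(2/3)` at the distance `s`, called `depth`.
The refinement is described by an infimum of cones (`branch`), a Lipschitz function that has slope
`0` or `1` across the cells for `s > 0` and is linear for `s = 0`; so `∂₁` of the corrector is
compatible with the slip exactly, and the elastic energy inside comes from its small slope in `s`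
only. Outside the cube, the transition region of width `w` widens linearly until it fills the cell,
at the cost of `μ h log (h / w)`. In total the energy is of the order
`e / h + h w + μ h log (h / w)` (`infEnergy_le_branched`). If `w = θ h` the needles are laminae of volume fraction one and the
second term is absent (`infEnergy_le_laminate`). The choice `w = h = e^(1/3)` gives `e^(2/3)`, the
laminate gives `(e μ log (1/θ))^(1/2)`, and `w` of the order `μ` gives
`(e μ log (3 + e/μ³))^(1/2)`, where in the last two cases `h` balances the first and the last term.
-/


namespace CrystalPlasticity

open Filter Topology
open scoped Convolution NNReal

/-! ### Weak gradients and translations -/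

theorem integrableOn_translate {F : Type*} [NormedAddCommGroup F] {q : E3 → F}
    (hq : LocallyIntegrable q volume) {K : Set E3} (hK : IsCompact K) (v : E3) (s : ℝ) :
    IntegrableOn (fun p : ℝ × E3 => q (p.2 + p.1 • v)) (Icc 0 s ×ˢ K)
      ((volume : Measure ℝ).prod volume) := by
  set K' : Set E3 := (fun p : ℝ × E3 => p.2 + p.1 • v) '' (Icc 0 s ×ˢ K) with hK'
  have hK'c : IsCompact K' := (isCompact_Icc.prod hK).image (by fun_prop)
  have hmp : MeasurePreserving (fun p : ℝ × E3 => (p.1, p.2 + p.1 • v))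
      ((volume : Measure ℝ).prod volume) ((volume : Measure ℝ).prod volume) :=
    MeasurePreserving.skew_product (g := fun (t : ℝ) (x : E3) => x + t • v)
      (MeasurePreserving.id volume) (by fun_prop)
      (Eventually.of_forall fun t => map_add_right_eq_self volume (t • v))
  have h1 : IntegrableOn (fun p : ℝ × E3 => q p.2) (Icc 0 s ×ˢ K')
      ((volume : Measure ℝ).prod volume) := by
    rw [IntegrableOn, ← Measure.prod_restrict]
    exact (hq.integrableOn_isCompact hK'c).comp_snd _
  have hmp' := hmp.restrict_preimage
    (measurableSet_Icc.prod hK'c.measurableSet : MeasurableSet (Icc (0 : ℝ) s ×ˢ K'))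
  have h2 : IntegrableOn (fun p : ℝ × E3 => q (p.2 + p.1 • v))
      ((fun p : ℝ × E3 => (p.1, p.2 + p.1 • v)) ⁻¹' (Icc 0 s ×ˢ K'))
      ((volume : Measure ℝ).prod volume) :=
    hmp'.integrable_comp_of_integrable h1
  refine h2.mono_set ?_
  rintro ⟨t, x⟩ ⟨ht, hx⟩
  exact ⟨ht, mem_image_of_mem _ (show (t, x) ∈ Icc 0 s ×ˢ K from ⟨ht, hx⟩)⟩

theorem hasDerivAt_integral_mul_translate {q φ : E3 → ℝ} (hq : LocallyIntegrable q volume)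
    (hφ : ContDiff ℝ ∞ φ) (hc : HasCompactSupport φ) (v : E3) (t : ℝ) :
    HasDerivAt (fun t : ℝ => ∫ x, q x * φ (x - t • v))
      (-∫ x, q x * fderiv ℝ φ (x - t • v) v) t := by
  set ψ : E3 → ℝ := fun z => φ (-z) with hψ
  have hψs : ContDiff ℝ 1 ψ := (hφ.comp contDiff_neg).of_le (by exact_mod_cast le_top)
  have hψc : HasCompactSupport ψ := hc.comp_homeomorph (Homeomorph.neg E3)
  have hd := HasCompactSupport.hasFDerivAt_convolution_right (ContinuousLinearMap.mul ℝ ℝ)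
    hψc hq hψs (t • v)
  have hline : HasDerivAt (fun t : ℝ => t • v) v t := by
    simpa using (hasDerivAt_id t).smul_const v
  have h := hd.comp_hasDerivAt t hline
  rw [convolution_precompR_apply _ hq (hψc.fderiv ℝ) (hψs.continuous_fderiv one_ne_zero)] at h
  have hfd : ∀ z, fderiv ℝ ψ z v = -(fderiv ℝ φ (-z) v) := by
    intro z
    have h1 := ((hφ.differentiable (by simp)) (-z)).hasFDerivAt.comp z (hasFDerivAt_id z).neg
    have h2 : fderiv ℝ ψ z = _ := h1.fderiv
    simp [h2]
  have e1 : (q ⋆[ContinuousLinearMap.mul ℝ ℝ, volume] ψ) ∘ (fun t : ℝ => t • v)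
      = fun t : ℝ => ∫ x, q x * φ (x - t • v) := by
    ext t
    simp [convolution_def, hψ]
  have e2 : (q ⋆[ContinuousLinearMap.mul ℝ ℝ, volume] fun a => (fderiv ℝ ψ a) v) (t • v)
      = -∫ x, q x * fderiv ℝ φ (x - t • v) v := by
    simp [convolution_def, hfd, integral_neg]
  rwa [e1, e2] at h

theorem integral_fderiv_translate {q φ : E3 → ℝ} (a : E3) (v : E3) :
    ∫ x, q x * fderiv ℝ (fun y => φ (y - a)) x v = ∫ x, q x * fderiv ℝ φ (x - a) v := by
  simp only [fderiv_comp_sub]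

/-- The fundamental theorem of calculus for weakly differentiable functions, along almost every
segment in a fixed direction. -/
theorem HasWeakGradient.ae_sub_eq {u : E3 → ℝ} {g : E3 → E3} (h : HasWeakGradient u g) (v : E3)
    {s : ℝ} (hs : 0 ≤ s) :
    ∀ᵐ x, u (x + s • v) - u x = ∫ t in (0 : ℝ)..s, inner ℝ (g (x + t • v)) v := by
  obtain ⟨hu, hg, hw⟩ := h
  have hgv : LocallyIntegrable (fun x => inner ℝ (g x) v) volume := by
    intro x
    obtain ⟨U, hU, hi⟩ := hg x
    exact ⟨U, hU, hi.inner_const v⟩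
  have hus : LocallyIntegrable (fun x => u (x + s • v)) volume := by
    rw [locallyIntegrable_iff]
    intro K hK
    have hmp := (measurePreserving_add_right volume (s • v)).restrict_preimage
      ((hK.image (continuous_add_const (s • v))).measurableSet)
    refine IntegrableOn.mono_set (t := (· + s • v) ⁻¹' ((fun x => x + s • v) '' K)) ?_
      (subset_preimage_image _ _)
    exact hmp.integrable_comp_of_integrable
      (hu.integrableOn_isCompact (hK.image (continuous_add_const (s • v))))
  have hI : LocallyIntegrable (fun x => ∫ t in (0 : ℝ)..s, inner ℝ (g (x + t • v)) v) volume := by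
    rw [locallyIntegrable_iff]
    intro K hK
    have h1 := integrableOn_translate hgv hK v s
    rw [IntegrableOn, ← Measure.prod_restrict] at h1
    have := h1.integral_prod_right
    simp only [intervalIntegral.integral_of_le hs, ← integral_Icc_eq_integral_Ioc]
    exact this
  refine ae_eq_of_integral_contDiff_smul_eq (hus.sub hu) hI ?_
  intro φ hφ hc
  have hφi : ∀ {q : E3 → ℝ}, LocallyIntegrable q volume → Integrable (fun x => φ x * q x) := by
    intro q hq
    simpa using hq.integrable_smul_left_of_hasCompactSupport hφ.continuous hc
  have hts : ∀ t : ℝ, HasCompactSupport (fun x => φ (x - t • v)) := fun t =>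
    hc.comp_homeomorph (Homeomorph.subRight (t • v))
  have htd : ∀ t : ℝ, ContDiff ℝ ∞ (fun x => φ (x - t • v)) := fun t => by fun_prop
  set G : ℝ → ℝ := fun t => ∫ x, u x * φ (x - t • v) with hG
  have hGd : ∀ t, HasDerivAt G (∫ x, inner ℝ (g x) v * φ (x - t • v)) t := by
    intro t
    have h1 := hasDerivAt_integral_mul_translate hu hφ hc v t
    have h2 := hw _ (htd t) (hts t) v
    rw [integral_fderiv_translate] at h2
    rwa [h2, neg_neg] at h1
  have hprod : Integrable (Function.uncurry fun (t : ℝ) (x : E3) =>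
      inner ℝ (g (x + t • v)) v * φ x) ((volume.restrict (Icc 0 s)).prod volume) := by
    have h1 := integrableOn_translate hgv hc v s
    obtain ⟨C, hC⟩ := hc.exists_bound_of_continuous hφ.continuous
    have h2 : IntegrableOn (fun p : ℝ × E3 => inner ℝ (g (p.2 + p.1 • v)) v * φ p.2)
        (Icc 0 s ×ˢ tsupport φ) ((volume : Measure ℝ).prod volume) :=
      h1.mul_bdd (c := C) (by exact (hφ.continuous.comp continuous_snd).aestronglyMeasurable)
        (Eventually.of_forall fun p => hC p.2)
    have h3 : IntegrableOn (fun p : ℝ × E3 => inner ℝ (g (p.2 + p.1 • v)) v * φ p.2)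
        (Icc 0 s ×ˢ univ) ((volume : Measure ℝ).prod volume) := by
      refine h2.of_forall_sdiff_eq_zero (measurableSet_Icc.prod MeasurableSet.univ) ?_
      rintro ⟨t, x⟩ ⟨⟨ht, -⟩, hn⟩
      have : x ∉ tsupport φ := fun hx => hn ⟨ht, hx⟩
      simp [image_eq_zero_of_notMem_tsupport this]
    rw [IntegrableOn, ← Measure.prod_restrict, Measure.restrict_univ] at h3
    exact h3
  have hshift : ∀ t : ℝ, ∫ x, inner ℝ (g x) v * φ (x - t • v)
      = ∫ x, inner ℝ (g (x + t • v)) v * φ x := by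
    intro t
    rw [← integral_add_right_eq_self _ (t • v)]
    simp
  have hii : IntervalIntegrable (fun t => ∫ x, inner ℝ (g x) v * φ (x - t • v)) volume 0 s := by
    simp only [hshift]
    rw [intervalIntegrable_iff_integrableOn_Icc_of_le hs]
    exact hprod.integral_prod_left
  have hFTC := intervalIntegral.integral_eq_sub_of_hasDerivAt (fun t _ => hGd t) hii
  have hGs : G s = ∫ x, φ x * u (x + s • v) := by
    simp only [hG]
    rw [← integral_add_right_eq_self _ (s • v)]
    simp [mul_comm]
  have hG0 : G 0 = ∫ x, φ x * u x := by
    simp [hG, mul_comm]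
  simp only [smul_eq_mul, mul_sub]
  rw [integral_sub (hφi hus) (hφi hu), ← hGs, ← hG0, ← hFTC]
  simp only [hshift]
  rw [intervalIntegral.integral_of_le hs, ← integral_Icc_eq_integral_Ioc,
    integral_integral_swap hprod]
  refine integral_congr_ae (Eventually.of_forall fun x => ?_)
  simp only [intervalIntegral.integral_of_le hs, ← integral_Icc_eq_integral_Ioc]
  rw [integral_mul_const, mul_comm]

theorem HasWeakGradient.sub {u₁ u₂ : E3 → ℝ} {g₁ g₂ : E3 → E3} (h₁ : HasWeakGradient u₁ g₁)
    (h₂ : HasWeakGradient u₂ g₂) : HasWeakGradient (u₁ - u₂) (g₁ - g₂) := by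
  refine ⟨h₁.1.sub h₂.1, h₁.2.1.sub h₂.2.1, fun φ hφ hc v => ?_⟩
  have hder : ∀ {q : E3 → ℝ}, LocallyIntegrable q volume →
      Integrable (fun x => q x * fderiv ℝ φ x v) := fun hq =>
    hq.integrable_smul_right_of_hasCompactSupport (g := fun x => fderiv ℝ φ x v)
      ((hφ.continuous_fderiv (by simp)).clm_apply continuous_const)
      ((hc.fderiv_apply ℝ v))
  have hin : ∀ {q : E3 → E3}, LocallyIntegrable q volume →
      Integrable (fun x => inner ℝ (q x) v * φ x) := fun hq => by
    have := (hq.integrable_smul_left_of_hasCompactSupport hφ.continuous hc).inner_const (𝕜 := ℝ) v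
    simpa [real_inner_smul_left, mul_comm] using this
  simp only [Pi.sub_apply, sub_mul, inner_sub_left]
  rw [integral_sub (hder h₁.1) (hder h₂.1), integral_sub (hin h₁.2.1) (hin h₂.2.1),
    h₁.2.2 φ hφ hc v, h₂.2.2 φ hφ hc v]
  ring

/-- Lipschitz functions are weakly differentiable, by Rademacher's theorem. -/
theorem hasWeakGradient_of_lipschitz {u : E3 → ℝ} {K : ℝ≥0} (hu : LipschitzWith K u) :
    HasWeakGradient u (∇ u) := by
  have hm : Measurable (∇ u) :=
    (InnerProductSpace.toDual ℝ E3).symm.continuous.measurable.comp (measurable_fderiv ℝ u)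
  have hb : ∀ x, ‖(∇ u) x‖ ≤ K := fun x => by
    simp only [gradient, LinearIsometryEquiv.norm_map]
    exact norm_fderiv_le_of_lipschitz ℝ hu
  refine ⟨hu.continuous.locallyIntegrable, ?_, fun φ hφ hc v => ?_⟩
  · exact (locallyIntegrable_const (K : ℝ)).mono hm.aestronglyMeasurable
      (Eventually.of_forall fun x => by simpa using hb x)
  · obtain ⟨D, hD⟩ := hφ.lipschitzWith_of_hasCompactSupport hc (by simp)
    have h := hu.integral_lineDeriv_mul_eq (μ := volume) hD hc v
    have h1 : ∀ x, lineDeriv ℝ φ x (-v) = - fderiv ℝ φ x v := fun x => by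
      rw [((hφ.differentiable (by simp)) x).lineDeriv_eq_fderiv]; simp
    have h2 : ∫ x, lineDeriv ℝ u x v * φ x = ∫ x, inner ℝ ((∇ u) x) v * φ x := by
      refine integral_congr_ae ?_
      filter_upwards [hu.ae_differentiableAt] with x hx
      rw [hx.lineDeriv_eq_fderiv]
      simp [gradient]
    rw [← h2, h, ← integral_neg]
    refine integral_congr_ae (Eventually.of_forall fun x => ?_)
    simp only [h1]
    ring

/-! ### Functions of bounded variation in one direction -/

theorem lintegral_translate_le {R K : Set E3} {a : E3}
    (h : ∀ x ∈ R, x + a ∈ K) (F : E3 → ℝ≥0∞) :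
    ∫⁻ x in R, F (x + a) ≤ ∫⁻ x in K, F x := by
  have hemb : MeasurableEmbedding (fun x : E3 => x + a) := measurableEmbedding_addRight a
  have hmp := (measurePreserving_add_right volume a).setLIntegral_comp_preimage_emb hemb F K
  rw [← hmp]
  exact lintegral_mono_set h

theorem ae_ae_translate {P : E3 → Prop} (h : ∀ᵐ x, P x) (v : E3) :
    ∀ᵐ x, ∀ᵐ t : ℝ, P (x + t • v) := by
  obtain ⟨Z, hZ, hZm, hZ0⟩ := exists_measurable_superset_of_null h
  have hm : MeasurableSet {p : E3 × ℝ | p.1 + p.2 • v ∉ Z} :=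
    (hZm.compl).preimage (by fun_prop : Measurable fun p : E3 × ℝ => p.1 + p.2 • v)
  have h1 : ∀ᵐ x : E3, ∀ᵐ t : ℝ, x + t • v ∉ Z := by
    rw [Measure.ae_ae_comm hm]
    refine Eventually.of_forall fun t => ?_
    have := (measurePreserving_add_right volume (t • v)).quasiMeasurePreserving.ae
      (measure_eq_zero_iff_ae_notMem.1 hZ0)
    exact this
  filter_upwards [h1] with x hx
  filter_upwards [hx] with t ht
  by_contra hP
  exact ht (hZ hP)

/-- The `L¹` norm of the derivative of a mollified function is bounded by the variation of the
function itself. -/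
theorem lintegral_fderiv_convolution_le {U K : Set E3} {q : E3 → ℝ}
    (hq : Integrable q) (hqU : ∀ x ∉ U, q x = 0) (v : E3) (hK : IsCompact K) {δ : ℝ} (hδ : 0 < δ)
    (hKU : ∀ x ∈ K, Metric.closedBall x δ ⊆ U) (φ : ContDiffBump (0 : E3))
    (hφ : φ.rOut ≤ δ / 2) :
    ∫⁻ x in K, ‖fderiv ℝ (q ⋆[ContinuousLinearMap.mul ℝ ℝ, volume] φ.normed volume) x v‖ₑ
      ≤ dirVariation U v q := by
  set N : E3 → ℝ := φ.normed volume with hN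
  set L := ContinuousLinearMap.mul ℝ ℝ with hL
  have hNs : ContDiff ℝ ∞ N := φ.contDiff_normed
  have hNc : HasCompactSupport N := φ.hasCompactSupport_normed
  have hN1 : ContDiff ℝ 1 N := φ.contDiff_normed
  have hconvd : ∀ {p : E3 → ℝ}, LocallyIntegrable p volume → ∀ x,
      fderiv ℝ (p ⋆[L, volume] N) x v = ∫ y, p y * fderiv ℝ N (x - y) v := by
    intro p hp x
    have h1 := (hNc.hasFDerivAt_convolution_right L hp hN1 x).fderiv
    rw [h1, convolution_precompR_apply _ hp (hNc.fderiv ℝ) (hN1.continuous_fderiv one_ne_zero)]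
    simp [convolution_def, hL]
  have hodd : ∀ z, fderiv ℝ N (-z) v = -(fderiv ℝ N z v) := by
    intro z
    have h1 := ((hNs.differentiable (by simp)) (-z)).hasFDerivAt.comp z (hasFDerivAt_id z).neg
    have h2 : N ∘ Neg.neg = N := by ext y; simp [hN, ContDiffBump.normed_neg]
    rw [h2] at h1
    simp [h1.fderiv]
  set h : E3 → ℝ := fun x => fderiv ℝ (q ⋆[L, volume] N) x v with hh
  have hqs : ContDiff ℝ ∞ (q ⋆[L, volume] N) :=
    hNc.contDiff_convolution_right L hq.locallyIntegrable hNs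
  have hhs : ContDiff ℝ ∞ h := (hqs.fderiv_right (m := ∞) (by simp)).clm_apply contDiff_const
  -- the mollification is moved from the function to the test function
  have test : ∀ ψ : E3 → ℝ, ContDiff ℝ ∞ ψ → HasCompactSupport ψ →
      tsupport ψ ⊆ Metric.cthickening (δ / 2) K → (∀ x, |ψ x| ≤ 1) →
      ENNReal.ofReal (∫ x, ψ x * h x) ≤ dirVariation U v q := by
    intro ψ hψ hψc hψs hψ1
    set Ψ : E3 → ℝ := ψ ⋆[L, volume] N with hΨ
    have hψi : Integrable ψ := hψ.continuous.integrable_of_hasCompactSupport hψc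
    have hΨs : ContDiff ℝ ∞ Ψ := hNc.contDiff_convolution_right L hψi.locallyIntegrable hNs
    have hΨc : HasCompactSupport Ψ := hψc.convolution L hNc
    have hΨ1 : ∀ x, |Ψ x| ≤ 1 := by
      intro x
      have : Ψ x = ∫ y, ψ (x - y) * N y := by simp [hΨ, convolution_mul_swap, hL]
      rw [this]
      calc |∫ y, ψ (x - y) * N y| ≤ ∫ y, N y := by
            refine norm_integral_le_of_norm_le (f := fun y => ψ (x - y) * N y)
              φ.integrable_normed (Eventually.of_forall fun y => ?_)
            rw [norm_mul, Real.norm_eq_abs, Real.norm_eq_abs, abs_of_nonneg (φ.nonneg_normed y)]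
            exact mul_le_of_le_one_left (φ.nonneg_normed y) (hψ1 _)
        _ = 1 := φ.integral_normed
    have hΨU : tsupport Ψ ⊆ U := by
      have hsub : Function.support Ψ ⊆
          Metric.cthickening (δ / 2) (Metric.cthickening (δ / 2) K) := by
        refine (support_convolution_subset L).trans ?_
        rintro _ ⟨a, ha, b, hb, rfl⟩
        have hb' : ‖b‖ < φ.rOut := by
          have : b ∈ Metric.ball (0 : E3) φ.rOut := by
            rw [← φ.support_normed_eq (μ := volume)]; exact hb
          simpa using this
        refine Metric.mem_cthickening_of_dist_le _ a _ _ (hψs (subset_tsupport _ ha)) ?_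
        simp only [dist_self_add_left]
        linarith
      have hsub2 := closure_minimal hsub Metric.isClosed_cthickening
      refine hsub2.trans ?_
      refine (Metric.cthickening_cthickening_subset (by positivity) (by positivity) K).trans ?_
      rw [add_halves, hK.cthickening_eq_biUnion_closedBall hδ.le]
      exact iUnion₂_subset hKU
    have hswap : ∫ x, ψ x * h x = ∫ x in U, q x * fderiv ℝ (fun y => -Ψ y) x v := by
      have hcont : Continuous fun z => fderiv ℝ N z v :=
        (hN1.continuous_fderiv one_ne_zero).clm_apply continuous_const
      obtain ⟨C, hC⟩ := (hNc.fderiv_apply ℝ v).exists_bound_of_continuous hcont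
      have hint : Integrable (Function.uncurry fun x y : E3 =>
          ψ x * (q y * fderiv ℝ N (x - y) v)) (volume.prod volume) := by
        have h1 := (hψi.mul_prod hq).mul_bdd (c := C)
          (g := fun p : E3 × E3 => fderiv ℝ N (p.1 - p.2) v)
          (by exact (hcont.comp (continuous_fst.sub continuous_snd)).aestronglyMeasurable)
          (Eventually.of_forall fun p => hC (p.1 - p.2))
        refine h1.congr (Eventually.of_forall fun p => ?_)
        simp [Function.uncurry, mul_assoc]
      have h0 : ∫ x in U, q x * fderiv ℝ (fun y => -Ψ y) x v
          = ∫ x, q x * fderiv ℝ (fun y => -Ψ y) x v :=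
        setIntegral_eq_integral_of_forall_compl_eq_zero fun x hx => by simp [hqU x hx]
      rw [h0]
      simp only [hh, hconvd hq.locallyIntegrable, ← integral_const_mul]
      rw [integral_integral_swap hint]
      refine integral_congr_ae (Eventually.of_forall fun y => ?_)
      have h2 : fderiv ℝ (fun y => -Ψ y) y v = ∫ x, ψ x * fderiv ℝ N (x - y) v := by
        have : fderiv ℝ (fun y => -Ψ y) y = -fderiv ℝ Ψ y := fderiv_neg
        rw [this, neg_apply, hΨ, hconvd hψi.locallyIntegrable,
          ← integral_neg]
        refine integral_congr_ae (Eventually.of_forall fun x => ?_)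
        have := hodd (x - y)
        rw [neg_sub] at this
        simp [this]
      simp only [h2, ← integral_const_mul]
      refine integral_congr_ae (Eventually.of_forall fun x => ?_)
      simp only
      ring
    rw [hswap]
    refine le_iSup₂_of_le (fun y => -Ψ y) ⟨hΨs.neg, hΨc.neg, ?_, ?_⟩ le_rfl
    · have : tsupport (fun y => -Ψ y) = tsupport Ψ := by
        simp only [tsupport]; congr 1; ext; simp
      rw [this]; exact hΨU
    · intro x; simpa using hΨ1 x
  -- a smooth cut-off
  obtain ⟨χ, hχ1, hχ0, hχI⟩ := exists_contMDiffMap_one_nhds_of_subset_interior (n := ⊤)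
    (modelWithCornersSelf ℝ E3) hK.isClosed
    (s := K) (t := Metric.cthickening (δ / 2) K)
    ((Metric.self_subset_thickening (half_pos hδ) K).trans
      (interior_maximal (Metric.thickening_subset_cthickening _ _) Metric.isOpen_thickening))
  have hχs : ContDiff ℝ ∞ χ := χ.contMDiff.contDiff
  have hχt : tsupport χ ⊆ Metric.cthickening (δ / 2) K := by
    refine closure_minimal (fun x hx => ?_) Metric.isClosed_cthickening
    by_contra hn
    exact hx (hχ0 x hn)
  have hχc : HasCompactSupport χ :=
    (hK.cthickening).of_isClosed_subset (isClosed_tsupport _) hχt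
  have key : ∀ η : ℝ, 0 < η → ∫⁻ x in K, ‖h x‖ₑ ≤
      dirVariation U v q + ENNReal.ofReal η * volume K := by
    intro η hη
    have hpos : ∀ x, 0 < h x ^ 2 + η ^ 2 := fun x => by positivity
    set ψ : E3 → ℝ := fun x => χ x * (h x / √(h x ^ 2 + η ^ 2)) with hψ
    have hψs : ContDiff ℝ ∞ ψ :=
      hχs.mul (hhs.div (((hhs.pow 2).add contDiff_const).sqrt fun x => (hpos x).ne')
        fun x => (Real.sqrt_pos.2 (hpos x)).ne')
    have hψc : HasCompactSupport ψ := hχc.mul_right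
    have hψt : tsupport ψ ⊆ Metric.cthickening (δ / 2) K :=
      (tsupport_mul_subset_left).trans hχt
    have habs : ∀ x, |h x| ≤ √(h x ^ 2 + η ^ 2) := fun x =>
      Real.abs_le_sqrt (by nlinarith [sq_nonneg η])
    have hψ1 : ∀ x, |ψ x| ≤ 1 := by
      intro x
      rw [hψ, abs_mul, abs_div, abs_of_nonneg (Real.sqrt_nonneg _), abs_of_nonneg (hχI x).1]
      exact mul_le_one₀ (hχI x).2 (by positivity)
        (div_le_one_of_le₀ (habs x) (Real.sqrt_nonneg _))
    have ht := test ψ hψs hψc hψt hψ1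
    have hint : Integrable (fun x => ψ x * h x) :=
      (hψs.continuous.mul hhs.continuous).integrable_of_hasCompactSupport hψc.mul_right
    have hnn : ∀ x, 0 ≤ ψ x * h x := fun x => by
      have : ψ x * h x = χ x * (h x ^ 2 / √(h x ^ 2 + η ^ 2)) := by simp only [hψ]; ring
      rw [this]
      exact mul_nonneg (hχI x).1 (by positivity)
    rw [ofReal_integral_eq_lintegral_ofReal hint (Eventually.of_forall hnn)] at ht
    calc ∫⁻ x in K, ‖h x‖ₑ ≤ ∫⁻ x in K, (ENNReal.ofReal (ψ x * h x) + ENNReal.ofReal η) := by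
          refine setLIntegral_mono' hK.measurableSet fun x hx => ?_
          rw [← ENNReal.ofReal_add (hnn x) hη.le, Real.enorm_eq_ofReal_abs]
          refine ENNReal.ofReal_le_ofReal ?_
          have hx1 : χ x = 1 := hχ1.self_of_nhdsSet x hx
          have hs := Real.sqrt_pos.2 (hpos x)
          have e1 : ψ x * h x = h x ^ 2 / √(h x ^ 2 + η ^ 2) := by simp only [hψ, hx1]; ring
          have e2 : √(h x ^ 2 + η ^ 2) = h x ^ 2 / √(h x ^ 2 + η ^ 2)
              + η ^ 2 / √(h x ^ 2 + η ^ 2) := by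
            rw [← add_div, eq_div_iff hs.ne', Real.mul_self_sqrt (hpos x).le]
          have e3 : η ^ 2 / √(h x ^ 2 + η ^ 2) ≤ η := by
            rw [div_le_iff₀ hs, sq]
            exact mul_le_mul_of_nonneg_left (Real.le_sqrt_of_sq_le (by nlinarith [sq_nonneg (h x)]))
              hη.le
          rw [e1]
          linarith [habs x]
      _ = (∫⁻ x in K, ENNReal.ofReal (ψ x * h x)) + ENNReal.ofReal η * volume K := by
          rw [lintegral_add_right _ measurable_const, setLIntegral_const]
      _ ≤ _ := by
          gcongr
          exact (setLIntegral_le_lintegral _ _).trans ht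
  refine ENNReal.le_of_forall_pos_le_add fun η hη _ => ?_
  have hvol : volume K ≠ ⊤ := hK.measure_lt_top.ne
  have hc : 0 < (volume K).toReal + 1 := by positivity
  refine (key (η / ((volume K).toReal + 1)) (by positivity)).trans ?_
  gcongr
  rw [← ENNReal.ofReal_toReal hvol, ← ENNReal.ofReal_mul (by positivity),
    ← ENNReal.ofReal_coe_nnreal]
  refine ENNReal.ofReal_le_ofReal ?_
  simp only [ENNReal.toReal_ofReal ENNReal.toReal_nonneg]
  rw [div_mul_eq_mul_div, div_le_iff₀ hc]
  nlinarith [(η : ℝ≥0).2]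

/-- A function of bounded variation in direction `v` oscillates along almost every segment in this
direction by at most a quantity `W` whose integral is controlled by the variation. -/
theorem exists_variation_majorant {U K R : Set E3} {q : E3 → ℝ} (hU : IsOpen U)
    (hq : IntegrableOn q U) (v : E3) (hR : MeasurableSet R) (hK : IsCompact K) {ρ δ : ℝ}
    (hρ : 0 < ρ) (hδ : 0 < δ) (hRK : ∀ x ∈ R, ∀ t ∈ Icc 0 ρ, x + t • v ∈ K)
    (hKU : ∀ x ∈ K, Metric.closedBall x δ ⊆ U) :
    ∃ W : E3 → ℝ≥0∞, Measurable W ∧ ∫⁻ x in R, W x ≤ ENNReal.ofReal ρ * dirVariation U v q ∧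
      ∀ᵐ x ∂(volume.restrict R), ∀ᵐ t ∂(volume.restrict (Ioo 0 ρ)),
        ‖q (x + t • v) - q x‖ₑ ≤ W x := by
  set L := ContinuousLinearMap.mul ℝ ℝ with hL
  set q₀ : E3 → ℝ := U.indicator q with hq₀
  have hq₀i : Integrable q₀ := (integrable_indicator_iff hU.measurableSet).2 hq
  have hdv : dirVariation U v q₀ = dirVariation U v q := by
    unfold dirVariation
    refine iSup_congr fun φ => iSup_congr fun _ => ?_
    congr 1
    exact setIntegral_congr_fun hU.measurableSet fun x hx => by simp [hq₀, hx]
  let φ : ℕ → ContDiffBump (0 : E3) := fun i =>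
    ⟨δ / (4 * (i + 1)), δ / (2 * (i + 1)), by positivity, by
      apply div_lt_div_of_pos_left hδ (by positivity); nlinarith [(i.cast_nonneg : (0 : ℝ) ≤ i)]⟩
  have hrout : ∀ i, (φ i).rOut = δ / 2 * (1 / ((i : ℝ) + 1)) := fun i => by
    simp only [φ]; field_simp
  have hr1 : ∀ i, (φ i).rOut ≤ δ / 2 := fun i => by
    rw [hrout]
    refine mul_le_of_le_one_right (by positivity) ?_
    rw [div_le_one (by positivity)]
    linarith [(i.cast_nonneg : (0 : ℝ) ≤ i)]
  set Q : ℕ → E3 → ℝ := fun i => q₀ ⋆[L, volume] (φ i).normed volume with hQ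
  have hQs : ∀ i, ContDiff ℝ 1 (Q i) := fun i =>
    ((φ i).hasCompactSupport_normed).contDiff_convolution_right (n := 1) L hq₀i.locallyIntegrable
      (φ i).contDiff_normed
  have hconv : ∀ᵐ x, Tendsto (fun i => Q i x) atTop (𝓝 (q₀ x)) := by
    have h1 := ContDiffBump.ae_convolution_tendsto_right_of_locallyIntegrable (φ := φ)
      (l := atTop) (K := 2) (g := q₀) (μ := volume) (by
        simp only [hrout]
        simpa using (tendsto_one_div_add_atTop_nhds_zero_nat (𝕜 := ℝ)).const_mul (δ / 2))
      (Eventually.of_forall fun i => by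
        refine le_of_eq ?_; simp only [φ]; field_simp; norm_num) hq₀i.locallyIntegrable
    filter_upwards [h1] with x hx
    refine hx.congr fun i => ?_
    rw [convolution_lsmul_swap]
    simp [hQ, convolution_def, hL, mul_comm]
  set D : ℕ → E3 → ℝ≥0∞ := fun i x => ‖fderiv ℝ (Q i) x v‖ₑ with hD
  have hDc : ∀ i, Continuous fun x => fderiv ℝ (Q i) x v := fun i =>
    ((hQs i).continuous_fderiv one_ne_zero).clm_apply continuous_const
  have hDm : ∀ i, Measurable (D i) := fun i => (hDc i).measurable.enorm
  have hDm2 : ∀ i, Measurable fun p : E3 × ℝ => D i (p.1 + p.2 • v) := fun i =>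
    (hDm i).comp (by fun_prop)
  set S : ℕ → E3 → ℝ≥0∞ := fun i x => ∫⁻ t in Ioo 0 ρ, D i (x + t • v) with hS
  have hSm : ∀ i, Measurable (S i) := fun i => (hDm2 i).lintegral_prod_right'
  refine ⟨fun x => liminf (fun i => S i x) atTop, .liminf hSm, ?_, ?_⟩
  · refine (lintegral_liminf_le hSm).trans ?_
    refine liminf_le_of_le (by isBoundedDefault) fun b hb => ?_
    obtain ⟨i, hi⟩ := hb.exists
    refine hi.trans ?_
    simp only [hS]
    rw [lintegral_lintegral_swap (by exact (hDm2 i).aemeasurable)]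
    calc ∫⁻ t in Ioo 0 ρ, ∫⁻ x in R, D i (x + t • v)
        ≤ ∫⁻ t in Ioo 0 ρ, dirVariation U v q := by
          refine setLIntegral_mono' measurableSet_Ioo fun t ht => ?_
          refine (lintegral_translate_le (fun x hx => hRK x hx t ⟨ht.1.le, ht.2.le⟩)
            (D i)).trans ?_
          rw [← hdv]
          exact lintegral_fderiv_convolution_le hq₀i (fun x hx => by simp [hq₀, hx]) v hK hδ hKU
            (φ i) (hr1 i)
      _ = _ := by rw [setLIntegral_const]; simp [mul_comm]
  · have hKU' : K ⊆ U := fun x hx => hKU x hx (Metric.mem_closedBall_self hδ.le)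
    have h2 := ae_ae_translate hconv v
    filter_upwards [ae_restrict_of_ae hconv, ae_restrict_of_ae h2, ae_restrict_mem hR]
      with x hx hxt hxR
    filter_upwards [ae_restrict_of_ae hxt, ae_restrict_mem measurableSet_Ioo] with t ht htI
    have hq1 : q₀ (x + t • v) = q (x + t • v) :=
      indicator_of_mem (hKU' (hRK x hxR t ⟨htI.1.le, htI.2.le⟩)) q
    have hq2 : q₀ x = q x := by
      have := hRK x hxR 0 ⟨le_rfl, hρ.le⟩
      rw [zero_smul, add_zero] at this
      exact indicator_of_mem (hKU' this) q
    rw [← hq1, ← hq2]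
    have hlim : Tendsto (fun i => ‖Q i (x + t • v) - Q i x‖ₑ) atTop
        (𝓝 ‖q₀ (x + t • v) - q₀ x‖ₑ) := (ht.sub hx).enorm
    rw [← hlim.liminf_eq]
    refine liminf_le_liminf (Eventually.of_forall fun i => ?_)
    have hder : ∀ τ : ℝ, HasDerivAt (fun τ : ℝ => Q i (x + τ • v))
        (fderiv ℝ (Q i) (x + τ • v) v) τ := by
      intro τ
      have hl : HasDerivAt (fun τ : ℝ => x + τ • v) v τ := by
        simpa using ((hasDerivAt_id τ).smul_const v).const_add x
      exact (((hQs i).differentiable one_ne_zero) _).hasFDerivAt.comp_hasDerivAt τ hl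
    have hci : Continuous fun τ : ℝ => fderiv ℝ (Q i) (x + τ • v) v :=
      (hDc i).comp (by fun_prop)
    have hF := intervalIntegral.integral_eq_sub_of_hasDerivAt (a := 0) (b := t)
      (fun τ _ => hder τ) (hci.intervalIntegrable _ _)
    simp only [zero_smul, add_zero] at hF
    rw [← hF, intervalIntegral.integral_of_le htI.1.le]
    refine (enorm_integral_le_lintegral_enorm _).trans ?_
    rw [← restrict_Ioo_eq_restrict_Ioc]
    exact lintegral_mono_set (Ioo_subset_Ioo_right htI.2.le)

/-! ### A multiscale trace estimate -/

theorem sq_lintegral_mul_le {α : Type*} [MeasurableSpace α] {μ : Measure α} {f g : α → ℝ≥0∞}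
    (hf : AEMeasurable f μ) (hg : AEMeasurable g μ) :
    (∫⁻ a, f a * g a ∂μ) ^ 2 ≤ (∫⁻ a, f a ^ 2 ∂μ) * ∫⁻ a, g a ^ 2 ∂μ := by
  have h := ENNReal.lintegral_mul_le_Lp_mul_Lq μ Real.HolderConjugate.two_two hf hg
  simp only [Pi.mul_apply, ENNReal.rpow_two] at h
  calc (∫⁻ a, f a * g a ∂μ) ^ 2
      ≤ ((∫⁻ a, f a ^ 2 ∂μ) ^ (1 / 2 : ℝ) * (∫⁻ a, g a ^ 2 ∂μ) ^ (1 / 2 : ℝ)) ^ 2 := by gcongr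
    _ = _ := by
      rw [mul_pow, ← ENNReal.rpow_two, ← ENNReal.rpow_two, ← ENNReal.rpow_mul, ← ENNReal.rpow_mul]
      norm_num

theorem sq_setLIntegral_le {α : Type*} [MeasurableSpace α] {μ : Measure α} {s : Set α}
    {g : α → ℝ≥0∞} (hg : AEMeasurable g (μ.restrict s)) :
    (∫⁻ a in s, g a ∂μ) ^ 2 ≤ μ s * ∫⁻ a in s, g a ^ 2 ∂μ := by
  simpa using sq_lintegral_mul_le (μ := μ.restrict s) (f := fun _ => 1) aemeasurable_const hg

theorem lintegral_translate (F : E3 → ℝ≥0∞) (a : E3) : ∫⁻ x, F (x + a) = ∫⁻ x, F x :=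
  lintegral_add_right_eq_self F a

theorem lintegral_segment_le {F : E3 → ℝ≥0∞} (hF : Measurable F) (v : E3) (T : Set ℝ) :
    ∫⁻ x, ∫⁻ t in T, F (x + t • v) = volume T * ∫⁻ x, F x := by
  have hm : Measurable fun p : E3 × ℝ => F (p.1 + p.2 • v) := hF.comp (by fun_prop)
  rw [lintegral_lintegral_swap hm.aemeasurable]
  simp only [lintegral_translate]
  rw [setLIntegral_const, mul_comm]

theorem setLIntegral_segment_le {F : E3 → ℝ≥0∞} (hF : Measurable F) {R K : Set E3}
    {v : E3} {s : ℝ} (hRK : ∀ x ∈ R, ∀ t ∈ Ioo 0 s, x + t • v ∈ K) :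
    ∫⁻ x in R, ∫⁻ t in Ioo 0 s, F (x + t • v) ≤ ENNReal.ofReal s * ∫⁻ x in K, F x := by
  have hm : Measurable fun p : E3 × ℝ => F (p.1 + p.2 • v) := hF.comp (by fun_prop)
  rw [lintegral_lintegral_swap hm.aemeasurable]
  calc ∫⁻ t in Ioo 0 s, ∫⁻ x in R, F (x + t • v) ≤ ∫⁻ t in Ioo 0 s, ∫⁻ x in K, F x :=
        setLIntegral_mono' measurableSet_Ioo fun t ht =>
          lintegral_translate_le (fun x hx => hRK x hx t ht) F
    _ = _ := by rw [setLIntegral_const]; simp [mul_comm]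

theorem HasWeakGradient.ae_enorm_sub_le {u : E3 → ℝ} {g : E3 → E3} (h : HasWeakGradient u g)
    (v : E3) {s : ℝ} (hs : 0 ≤ s) :
    ∀ᵐ x, ‖u (x + s • v) - u x‖ₑ ≤ ∫⁻ t in Ioo 0 s, ‖(inner ℝ (g (x + t • v)) v : ℝ)‖ₑ := by
  filter_upwards [h.ae_sub_eq v hs] with x hx
  rw [hx, intervalIntegral.integral_of_le hs, restrict_Ioo_eq_restrict_Ioc]
  exact enorm_integral_le_lintegral_enorm _

theorem measurable_lintegral_Ioo {α : Type*} [MeasurableSpace α] {F : α × ℝ → ℝ≥0∞}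
    (hF : Measurable F) {a b : α → ℝ} (ha : Measurable a) (hb : Measurable b) :
    Measurable fun x => ∫⁻ t in Ioo (a x) (b x), F (x, t) := by
  have hS : MeasurableSet {p : α × ℝ | p.2 ∈ Ioo (a p.1) (b p.1)} :=
    (measurableSet_lt (ha.comp measurable_fst) measurable_snd).inter
      (measurableSet_lt measurable_snd (hb.comp measurable_fst))
  have h1 := (hF.indicator hS).lintegral_prod_right' (ν := (volume : Measure ℝ))
  convert h1 using 2 with x
  rw [← lintegral_indicator measurableSet_Ioo]
  rfl

theorem HasWeakGradient.ae_ae_enorm_sub_le {u : E3 → ℝ} {g : E3 → E3} (h : HasWeakGradient u g)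
    (hu : Measurable u) (hg : Measurable g) (v : E3) :
    ∀ᵐ x, ∀ᵐ s : ℝ, 0 ≤ s →
      ‖u (x + s • v) - u x‖ₑ ≤ ∫⁻ t in Ioo 0 s, ‖(inner ℝ (g (x + t • v)) v : ℝ)‖ₑ := by
  have hr : Measurable fun p : E3 × ℝ =>
      ∫⁻ t in Ioo 0 p.2, ‖(inner ℝ (g (p.1 + t • v)) v : ℝ)‖ₑ := by
    refine measurable_lintegral_Ioo (F := fun q : (E3 × ℝ) × ℝ =>
      ‖(inner ℝ (g (q.1.1 + q.2 • v)) v : ℝ)‖ₑ) ?_ measurable_const measurable_snd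
    have h1 : Measurable fun q : (E3 × ℝ) × ℝ => g (q.1.1 + q.2 • v) := hg.comp (by fun_prop)
    exact (h1.inner_const (𝕜 := ℝ)).enorm
  have hl : Measurable fun p : E3 × ℝ => ‖u (p.1 + p.2 • v) - u p.1‖ₑ :=
    ((hu.comp (by fun_prop)).sub (hu.comp measurable_fst)).enorm
  have hm : MeasurableSet {p : E3 × ℝ | 0 ≤ p.2 → ‖u (p.1 + p.2 • v) - u p.1‖ₑ ≤
      ∫⁻ t in Ioo 0 p.2, ‖(inner ℝ (g (p.1 + t • v)) v : ℝ)‖ₑ} := by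
    have : {p : E3 × ℝ | 0 ≤ p.2 → ‖u (p.1 + p.2 • v) - u p.1‖ₑ ≤
      ∫⁻ t in Ioo 0 p.2, ‖(inner ℝ (g (p.1 + t • v)) v : ℝ)‖ₑ} =
        {p | 0 ≤ p.2}ᶜ ∪ {p | ‖u (p.1 + p.2 • v) - u p.1‖ₑ ≤
      ∫⁻ t in Ioo 0 p.2, ‖(inner ℝ (g (p.1 + t • v)) v : ℝ)‖ₑ} := by
      ext p; simp only [mem_ofPred_eq, mem_union, mem_compl_iff]; tauto
    rw [this]
    exact (measurableSet_le measurable_const measurable_snd).compl.union (measurableSet_le hl hr)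
  rw [Measure.ae_ae_comm hm]
  refine Eventually.of_forall fun s => ?_
  by_cases hs : 0 ≤ s
  · filter_upwards [h.ae_enorm_sub_le v hs] with x hx _ using hx
  · exact Eventually.of_forall fun x h' => absurd h' hs

theorem sq_add_five_le (a b c d e : ℝ≥0∞) :
    (a + b + c + d + e) ^ 2 ≤ 5 * (a ^ 2 + b ^ 2 + c ^ 2 + d ^ 2 + e ^ 2) := by
  have := ENNReal.inner_le_Lp_mul_Lq (Finset.univ : Finset (Fin 5)) (fun _ => 1) ![a, b, c, d, e]
    Real.HolderConjugate.two_two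
  simp only [Fin.sum_univ_five, ENNReal.rpow_two] at this
  have h2 := pow_le_pow_left' this 2
  have key : ∀ x : ℝ≥0∞, (x ^ (1 / 2 : ℝ)) ^ 2 = x := fun x => by
    rw [← ENNReal.rpow_two, ← ENNReal.rpow_mul]; norm_num
  rw [mul_pow, key, key] at h2
  norm_num at h2
  simpa using h2

/-- Below depth `τ`, the scales `s = h / 4 ^ k` with `τ < 2 s` contribute a geometric series. -/
theorem sum_sqrt_div_scale_le {h τ : ℝ} (hh : 0 < h) (hτ : 0 < τ) (N : ℕ) :
    ∑ k ∈ Finset.range N with τ < 2 * (h / 4 ^ k), √τ / √(h / 4 ^ k) ≤ 2 * √2 := by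
  have hsq : ∀ k : ℕ, √(h / 4 ^ k) = √h / 2 ^ k := fun k => by
    rw [Real.sqrt_div hh.le,
      show (4 : ℝ) ^ k = (2 ^ k) ^ 2 by rw [← pow_mul, mul_comm, pow_mul]; norm_num,
      Real.sqrt_sq (by positivity)]
  have hs0 : 0 < √h := Real.sqrt_pos.2 hh
  simp only [hsq]
  set T := (Finset.range N).filter fun k => τ < 2 * (h / 4 ^ k) with hT
  rcases T.eq_empty_or_nonempty with he | hne
  · rw [he]; simp
  set m := T.max' hne with hm
  have hmT : m ∈ T := T.max'_mem hne
  have hgeo : ∑ k ∈ T, (2 : ℕ) ^ k < 2 ^ (m + 1) :=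
    Nat.geomSum_lt le_rfl fun k hk => Nat.lt_succ_of_le (T.le_max' k hk)
  have hgeo' : ∑ k ∈ T, (2 : ℝ) ^ k ≤ 2 * 2 ^ m := by
    have : ((∑ k ∈ T, (2 : ℕ) ^ k : ℕ) : ℝ) ≤ ((2 ^ (m + 1) : ℕ) : ℝ) := by exact_mod_cast hgeo.le
    push_cast at this
    rw [pow_succ] at this
    linarith
  have hτm : √τ ≤ √2 * (√h / 2 ^ m) := by
    have h1 : τ < 2 * (h / 4 ^ m) := (Finset.mem_filter.1 hmT).2
    rw [← hsq, ← Real.sqrt_mul zero_le_two]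
    exact Real.sqrt_le_sqrt h1.le
  have e : ∀ k : ℕ, √τ / (√h / 2 ^ k) = √τ / √h * 2 ^ k := fun k => by field_simp
  simp only [e, ← Finset.mul_sum]
  calc √τ / √h * ∑ k ∈ T, (2 : ℝ) ^ k ≤ (√2 * (√h / 2 ^ m)) / √h * (2 * 2 ^ m) := by gcongr
    _ = 2 * √2 := by field_simp

theorem lintegral_inv_sqrt_le (a : ℝ) {b : ℝ} (hb : 0 ≤ b) :
    ∫⁻ t in Ioo a (a + b), ENNReal.ofReal ((√(t - a))⁻¹) ≤ ENNReal.ofReal (2 * √b) := by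
  have h1 : IntervalIntegrable (fun t : ℝ => t ^ (-(1 / 2) : ℝ)) volume 0 b :=
    intervalIntegral.intervalIntegrable_rpow' (by norm_num)
  have h2 : IntervalIntegrable (fun t : ℝ => (t - a) ^ (-(1 / 2) : ℝ)) volume a (a + b) := by
    simpa [add_comm] using h1.comp_sub_right a
  have h3 : ∫ t in a..(a + b), (t - a) ^ (-(1 / 2) : ℝ) = 2 * √b := by
    rw [intervalIntegral.integral_comp_sub_right (fun t => t ^ (-(1 / 2) : ℝ)),
      integral_rpow (Or.inl (by norm_num))]
    norm_num
    rw [Real.sqrt_eq_rpow]; ring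
  rw [← h3, intervalIntegral.integral_of_le (by linarith), ofReal_integral_eq_lintegral_ofReal
    ((intervalIntegrable_iff_integrableOn_Ioc_of_le (by linarith)).1 h2)
    ((ae_restrict_mem measurableSet_Ioc).mono fun t ht => Real.rpow_nonneg (by linarith [ht.1]) _),
    ← restrict_Ioo_eq_restrict_Ioc]
  refine setLIntegral_mono' measurableSet_Ioo fun t ht => le_of_eq ?_
  rw [Real.rpow_neg (by linarith [ht.1]), Real.sqrt_eq_rpow]

@[simp] theorem e3_zero : e3 0 = 0 := by simp [e3]
@[simp] theorem e3_one : e3 1 = 0 := by simp [e3]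
@[simp] theorem e3_two : e3 2 = 1 := by simp [e3]

/-- The difference `f (x + s e) - f x` is estimated along the path which leaves the cube through
the face `x₂ = 0`, moves in direction `e` at a depth between `s` and `2 s`, and returns. -/
theorem ae_sq_enorm_sub_le_of_path {f : E3 → ℝ} {k : E3 → E3} {Gi Go : E3 → ℝ≥0∞}
    (hf : Measurable f) (hk : Measurable k) (hGi : Measurable Gi) (hGo : Measurable Go)
    (h : HasWeakGradient f k)
    (h3 : ∀ᵐ x, ‖(inner ℝ (k x) e3 : ℝ)‖ₑ ≤ Gi x + Go x)
    (hout : ∀ᵐ x, x 2 < 0 → ‖k x‖ₑ ≤ Go x) (hGo0 : ∀ x ∈ cube 1, Go x = 0)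
    {e : E3} (he : ‖e‖ ≤ 1) (he2 : e 2 = 0) {R : Set E3}
    (hR : ∀ x ∈ R, ∀ t ∈ Icc (0 : ℝ) (1 / 16), x 2 ∈ Ioo (1 / 8 : ℝ) (1 / 4) ∧
      (x + t • e) 0 ∈ Ioo (0 : ℝ) 1 ∧ (x + t • e) 1 ∈ Ioo (0 : ℝ) 1)
    {s : ℝ} (hs : 0 < s) (hs1 : s ≤ 1 / 16) :
    ∀ᵐ x, x ∈ R → ‖f (x + s • e) - f x‖ₑ ^ 2 ≤
      5 * ((∫⁻ t in Ioo (0 : ℝ) 1, Gi (x + t • (-e3))) ^ 2 +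
        (∫⁻ t in Ioo (0 : ℝ) 1, Gi (x + s • e + t • (-e3))) ^ 2 +
        (∫⁻ t in Ioo (x 2) (x 2 + 2 * s), Go (x + t • (-e3))) ^ 2 +
        (∫⁻ t in Ioo (x 2) (x 2 + 2 * s), Go (x + s • e + t • (-e3))) ^ 2 +
        ∫⁻ S in Ioo (x 2 + s) (x 2 + 2 * s), ∫⁻ t in Ioo 0 s,
          Go (x + S • (-e3) + t • e) ^ 2) := by
  have hm : Measurable fun p : E3 × ℝ => p.1 + p.2 • (-e3) := by fun_prop
  have tr : ∀ {P : E3 → Prop}, (∀ᵐ x, P x) → ∀ a : E3, ∀ᵐ x, P (x + a) := fun hP a =>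
    (measurePreserving_add_right volume a).quasiMeasurePreserving.ae hP
  have hv := h.ae_ae_enorm_sub_le hf hk (-e3)
  have hv3 := ae_ae_translate h3 (-e3)
  have hhz := ae_ae_translate (h.ae_enorm_sub_le e hs.le) (-e3)
  have hho := ae_ae_translate (ae_ae_translate hout e) (-e3)
  filter_upwards [hv, tr hv (s • e), hv3, tr hv3 (s • e), hhz, hho]
    with x hx1 hx2 hx3 hx4 hx5 hx6 hxR
  obtain ⟨⟨hz1, hz2⟩, h00⟩ := hR x hxR 0 ⟨le_rfl, by norm_num⟩
  obtain ⟨-, hs0⟩ := hR x hxR s ⟨hs.le, hs1⟩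
  -- vertical segments
  have vert : ∀ y : E3, y 2 = x 2 → y 0 ∈ Ioo (0 : ℝ) 1 → y 1 ∈ Ioo (0 : ℝ) 1 →
      (∀ᵐ t : ℝ, ‖(inner ℝ (k (y + t • (-e3))) e3 : ℝ)‖ₑ ≤
        Gi (y + t • (-e3)) + Go (y + t • (-e3))) →
      ∀ S ∈ Ioo (x 2 + s) (x 2 + 2 * s),
      ∫⁻ t in Ioo 0 S, ‖(inner ℝ (k (y + t • (-e3))) (-e3) : ℝ)‖ₑ ≤
        (∫⁻ t in Ioo (0 : ℝ) 1, Gi (y + t • (-e3))) +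
        ∫⁻ t in Ioo (x 2) (x 2 + 2 * s), Go (y + t • (-e3)) := by
    intro y hy2 hy0 hy1 hae S hS
    have m1 : Measurable fun t : ℝ => Gi (y + t • (-e3)) := hGi.comp (by fun_prop)
    calc ∫⁻ t in Ioo 0 S, ‖(inner ℝ (k (y + t • (-e3))) (-e3) : ℝ)‖ₑ
        ≤ ∫⁻ t in Ioo 0 S, (Gi (y + t • (-e3)) + Go (y + t • (-e3))) := by
          refine lintegral_mono_ae (ae_restrict_of_ae ?_)
          filter_upwards [hae] with t ht
          rwa [inner_neg_right, enorm_neg]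
      _ = (∫⁻ t in Ioo 0 S, Gi (y + t • (-e3))) + ∫⁻ t in Ioo 0 S, Go (y + t • (-e3)) :=
          lintegral_add_left m1 _
      _ ≤ _ := by
          gcongr ?_ + ?_
          · exact lintegral_mono_set (Ioo_subset_Ioo_right (by linarith [hS.2]))
          · rw [← lintegral_indicator measurableSet_Ioo, ← lintegral_indicator measurableSet_Ioo]
            refine lintegral_mono_ae ?_
            filter_upwards [(volume : Measure ℝ).ae_ne (x 2)] with t ht
            by_cases htS : t ∈ Ioo 0 S
            · rw [indicator_of_mem htS]
              rcases lt_or_gt_of_ne ht with hlt | hgt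
              · rw [hGo0]
                · exact zero_le
                · intro i
                  fin_cases i
                  · simpa using hy0
                  · simpa using hy1
                  · simp only [Fin.reduceFinMk, PiLp.add_apply, PiLp.smul_apply, PiLp.neg_apply,
                      e3_two, hy2, smul_eq_mul, mem_Ioo]
                    constructor <;> linarith [htS.1]
              · rw [indicator_of_mem (show t ∈ Ioo (x 2) (x 2 + 2 * s) from
                  ⟨hgt, htS.2.trans hS.2⟩)]
            · rw [indicator_of_notMem htS]; exact zero_le
  set P1 := ∫⁻ t in Ioo (0 : ℝ) 1, Gi (x + t • (-e3)) with hP1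
  set P2 := ∫⁻ t in Ioo (0 : ℝ) 1, Gi (x + s • e + t • (-e3)) with hP2
  set H1 := ∫⁻ t in Ioo (x 2) (x 2 + 2 * s), Go (x + t • (-e3)) with hH1
  set H2 := ∫⁻ t in Ioo (x 2) (x 2 + 2 * s), Go (x + s • e + t • (-e3)) with hH2
  set Q : ℝ → ℝ≥0∞ := fun S => ∫⁻ t in Ioo 0 s, Go (x + S • (-e3) + t • e) ^ 2 with hQ
  set I := Ioo (x 2 + s) (x 2 + 2 * s) with hI
  have hIv : volume I = ENNReal.ofReal s := by
    rw [hI, Real.volume_Ioo]; congr 1; ring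
  have hstep : ∀ᵐ S ∂(volume.restrict I), ‖f (x + s • e) - f x‖ₑ ^ 2 ≤
      5 * (P1 ^ 2 + P2 ^ 2 + H1 ^ 2 + H2 ^ 2 + ENNReal.ofReal s * Q S) := by
    filter_upwards [ae_restrict_of_ae hx1, ae_restrict_of_ae hx2, ae_restrict_of_ae hx5,
      ae_restrict_of_ae hx6, ae_restrict_mem measurableSet_Ioo] with S a1 a2 a5 a6 hS
    have hS0 : 0 ≤ S := by linarith [hS.1]
    have b1 := (a1 hS0).trans (vert x rfl (by simpa using h00.1) (by simpa using h00.2) hx3 S hS)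
    have b2 := (a2 hS0).trans (vert (x + s • e) (by simp [he2]) hs0.1 hs0.2 hx4 S hS)
    have b5 : ‖f (x + S • (-e3) + s • e) - f (x + S • (-e3))‖ₑ ≤
        ∫⁻ t in Ioo 0 s, Go (x + S • (-e3) + t • e) := by
      refine a5.trans ?_
      refine lintegral_mono_ae (ae_restrict_of_ae ?_)
      filter_upwards [a6] with t ht
      have hneg : (x + S • (-e3) + t • e) 2 < 0 := by
        simp only [PiLp.add_apply, PiLp.smul_apply, PiLp.neg_apply, e3_two, he2, smul_eq_mul]
        linarith [hS.1]
      refine le_trans ?_ (ht hneg)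
      rw [← ofReal_norm, ← ofReal_norm]
      refine ENNReal.ofReal_le_ofReal ((norm_inner_le_norm _ _).trans ?_)
      exact mul_le_of_le_one_right (norm_nonneg _) he
    have hrot : x + S • (-e3) + s • e = x + s • e + S • (-e3) := by abel
    have hsplit : f (x + s • e) - f x = (f (x + S • (-e3)) - f x) +
        (f (x + S • (-e3) + s • e) - f (x + S • (-e3))) -
        (f (x + s • e + S • (-e3)) - f (x + s • e)) := by rw [hrot]; ring
    have hle : ‖f (x + s • e) - f x‖ₑ ≤ P1 + P2 + H1 + H2 +
        ∫⁻ t in Ioo 0 s, Go (x + S • (-e3) + t • e) := by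
      rw [hsplit]
      refine (enorm_sub_le).trans ((add_le_add_left (enorm_add_le _ _) _).trans ?_)
      calc _ ≤ (P1 + H1) + (∫⁻ t in Ioo 0 s, Go (x + S • (-e3) + t • e)) + (P2 + H2) := by
            gcongr
        _ = _ := by ring
    refine (pow_le_pow_left' hle 2).trans ((sq_add_five_le _ _ _ _ _).trans ?_)
    gcongr
    have m2 : Measurable fun t : ℝ => Go (x + S • (-e3) + t • e) := hGo.comp (by fun_prop)
    refine (sq_setLIntegral_le m2.aemeasurable).trans (le_of_eq ?_)
    simp [hQ]
  have hs' : ENNReal.ofReal s ≠ 0 := by simpa using hs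
  have hint := lintegral_mono_ae hstep
  have mQ : Measurable Q := by
    have : Measurable fun p : ℝ × ℝ => Go (x + p.1 • (-e3) + p.2 • e) ^ 2 :=
      (hGo.comp (by fun_prop)).pow_const 2
    exact this.lintegral_prod_right'
  rw [setLIntegral_const, lintegral_const_mul _ (by fun_prop),
    lintegral_add_left measurable_const, setLIntegral_const, lintegral_const_mul _ mQ, hIv] at hint
  have hint' : ENNReal.ofReal s * ‖f (x + s • e) - f x‖ₑ ^ 2 ≤ ENNReal.ofReal s *
      (5 * (P1 ^ 2 + P2 ^ 2 + H1 ^ 2 + H2 ^ 2 + ∫⁻ S in I, Q S)) := by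
    calc _ = ‖f (x + s • e) - f x‖ₑ ^ 2 * ENNReal.ofReal s := mul_comm _ _
      _ ≤ _ := hint
      _ = _ := by ring
  exact (ENNReal.mul_le_mul_iff_right hs' ENNReal.ofReal_ne_top).1 hint'

/-- Weighted Hardy inequality for the sum over all scales. -/
theorem sum_hardy_le {F : ℝ → ℝ≥0∞} (hF : Measurable F) (a : ℝ) {h : ℝ} (hh : 0 < h)
    (hh1 : h ≤ 1 / 16) (N : ℕ) :
    ∑ k ∈ Finset.range N, (ENNReal.ofReal (h / 4 ^ k))⁻¹ *
      (∫⁻ t in Ioo a (a + 2 * (h / 4 ^ k)), F t) ^ 2 ≤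
      8 * ∫⁻ t in Ioo a (a + 1 / 8), F t ^ 2 := by
  have hs : ∀ k : ℕ, 0 < h / 4 ^ k := fun k => by positivity
  have hs1 : ∀ k : ℕ, h / 4 ^ k ≤ 1 / 16 := fun k =>
    (div_le_self hh.le (one_le_pow₀ (by norm_num))).trans hh1
  set w : ℝ → ℝ≥0∞ := fun t => ENNReal.ofReal (√(t - a)) with hw
  have hwm : Measurable w := by fun_prop
  set c : ℕ → ℝ≥0∞ := fun k => ENNReal.ofReal (2 * √2 / √(h / 4 ^ k)) with hc
  have hone : ∀ k, (ENNReal.ofReal (h / 4 ^ k))⁻¹ *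
      (∫⁻ t in Ioo a (a + 2 * (h / 4 ^ k)), F t) ^ 2 ≤
      ∫⁻ t in Ioo a (a + 1 / 8), (if t - a < 2 * (h / 4 ^ k) then c k * w t else 0) * F t ^ 2 := by
    intro k
    set s := h / 4 ^ k with hsk
    have hspos : 0 < s := hs k
    have e1 : ∫⁻ t in Ioo a (a + 2 * s), F t =
        ∫⁻ t in Ioo a (a + 2 * s), ENNReal.ofReal ((√(√(t - a)))⁻¹) *
          (ENNReal.ofReal (√(√(t - a))) * F t) := by
      refine setLIntegral_congr_fun measurableSet_Ioo fun t ht => ?_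
      have hp : 0 < √(√(t - a)) := Real.sqrt_pos.2 (Real.sqrt_pos.2 (by linarith [ht.1]))
      rw [← mul_assoc, ← ENNReal.ofReal_mul (by positivity), inv_mul_cancel₀ hp.ne']
      simp
    -- Cauchy–Schwarz with the weight `√(t - a)`, whose reciprocal is integrable
    have e2 : (∫⁻ t in Ioo a (a + 2 * s), F t) ^ 2 ≤ ENNReal.ofReal (2 * √(2 * s)) *
        ∫⁻ t in Ioo a (a + 2 * s), w t * F t ^ 2 := by
      rw [e1]
      refine (sq_lintegral_mul_le (by fun_prop) (by fun_prop)).trans ?_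
      gcongr ?_ * ?_
      · refine le_trans (le_of_eq ?_) (lintegral_inv_sqrt_le a (by positivity : 0 ≤ 2 * s))
        refine lintegral_congr fun t => ?_
        rw [← ENNReal.ofReal_pow (by positivity), inv_pow, Real.sq_sqrt (Real.sqrt_nonneg _)]
      · refine lintegral_mono fun t => ?_
        rw [mul_pow, ← ENNReal.ofReal_pow (by positivity), Real.sq_sqrt (Real.sqrt_nonneg _)]
    have e3 : (ENNReal.ofReal s)⁻¹ * ENNReal.ofReal (2 * √(2 * s)) = c k := by
      rw [← ENNReal.ofReal_inv_of_pos hspos, ← ENNReal.ofReal_mul (by positivity), hc]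
      congr 1
      rw [Real.sqrt_mul zero_le_two, ← hsk]
      have h1 : √s ≠ 0 := (Real.sqrt_pos.2 hspos).ne'
      have h2 : √s * √s = s := Real.mul_self_sqrt hspos.le
      field_simp
      nlinarith
    calc (ENNReal.ofReal s)⁻¹ * (∫⁻ t in Ioo a (a + 2 * s), F t) ^ 2
        ≤ (ENNReal.ofReal s)⁻¹ * (ENNReal.ofReal (2 * √(2 * s)) *
          ∫⁻ t in Ioo a (a + 2 * s), w t * F t ^ 2) := by gcongr
      _ = ∫⁻ t in Ioo a (a + 2 * s), c k * (w t * F t ^ 2) := by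
          rw [← mul_assoc, e3,
            lintegral_const_mul _ (by fun_prop : Measurable fun t => w t * F t ^ 2)]
      _ = ∫⁻ t in Ioo a (a + 2 * s),
          (if t - a < 2 * s then c k * w t else 0) * F t ^ 2 := by
          refine setLIntegral_congr_fun measurableSet_Ioo fun t ht => ?_
          rw [if_pos (by linarith [ht.2]), mul_assoc]
      _ ≤ _ := lintegral_mono_set (Ioo_subset_Ioo_right (by linarith [hs1 k]))
  refine (Finset.sum_le_sum fun k _ => hone k).trans ?_
  have hmk : ∀ k, Measurable fun t : ℝ =>
      (if t - a < 2 * (h / 4 ^ k) then c k * w t else 0) * F t ^ 2 := fun k =>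
    (Measurable.ite (measurableSet_lt (by fun_prop) measurable_const)
      (hwm.const_mul _) measurable_const).mul (hF.pow_const 2)
  rw [← lintegral_finsetSum _ fun k _ => hmk k, ← lintegral_const_mul _ (hF.pow_const 2)]
  refine setLIntegral_mono' measurableSet_Ioo fun t ht => ?_
  rw [← Finset.sum_mul]
  gcongr
  have hτ : 0 < t - a := by linarith [ht.1]
  have h1 := sum_sqrt_div_scale_le hh hτ N
  rw [← Finset.sum_filter]
  have h2 : ∀ k, c k * w t = ENNReal.ofReal (2 * √2 * (√(t - a) / √(h / 4 ^ k))) := fun k => by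
    rw [hc, hw, ← ENNReal.ofReal_mul (by positivity)]
    congr 1; ring
  simp only [h2]
  rw [← ENNReal.ofReal_sum_of_nonneg (fun k _ => by positivity), ← Finset.mul_sum]
  refine (ENNReal.ofReal_le_ofReal (mul_le_mul_of_nonneg_left h1 (by positivity))).trans ?_
  have h22 : √2 * √2 = (2 : ℝ) := Real.mul_self_sqrt zero_le_two
  rw [show 2 * √2 * (2 * √2) = (8 : ℝ) by nlinarith]
  simp

theorem disjoint_slabs {h : ℝ} (hh : 0 < h) {i j : ℕ} (hij : i ≠ j) :
    Disjoint {y : E3 | y 2 ∈ Ioo (-(2 * (h / 4 ^ i))) (-(h / 4 ^ i))}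
      {y : E3 | y 2 ∈ Ioo (-(2 * (h / 4 ^ j))) (-(h / 4 ^ j))} := by
  wlog hlt : i < j generalizing i j
  · exact (this hij.symm (lt_of_le_of_ne (not_lt.1 hlt) hij.symm)).symm
  rw [Set.disjoint_left]
  rintro y ⟨-, h1⟩ ⟨h2, -⟩
  have h4 : h / 4 ^ j ≤ h / 4 ^ i / 4 := by
    rw [div_div, ← pow_succ]
    exact div_le_div_of_nonneg_left hh.le (by positivity)
      (pow_le_pow_right₀ (by norm_num) hlt)
  have : 0 < h / 4 ^ i := by positivity
  linarith

/-- The multiscale trace estimate: the differences of `f` in the cube, at all scales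
`s = h / 4 ^ k`, are controlled by the vertical derivative in the cube and the gradient outside,
without a loss proportional to the number of scales in front of the exterior term. -/
theorem sum_sq_enorm_sub_le {f : E3 → ℝ} {k : E3 → E3} {Gi Go : E3 → ℝ≥0∞}
    (hf : Measurable f) (hk : Measurable k) (hGi : Measurable Gi) (hGo : Measurable Go)
    (h : HasWeakGradient f k)
    (h3 : ∀ᵐ x, ‖(inner ℝ (k x) e3 : ℝ)‖ₑ ≤ Gi x + Go x)
    (hout : ∀ᵐ x, x 2 < 0 → ‖k x‖ₑ ≤ Go x) (hGo0 : ∀ x ∈ cube 1, Go x = 0)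
    {e : E3} (he : ‖e‖ ≤ 1) (he2 : e 2 = 0) {R : Set E3} (hRm : MeasurableSet R)
    (hR : ∀ x ∈ R, ∀ t ∈ Icc (0 : ℝ) (1 / 16), x 2 ∈ Ioo (1 / 8 : ℝ) (1 / 4) ∧
      (x + t • e) 0 ∈ Ioo (0 : ℝ) 1 ∧ (x + t • e) 1 ∈ Ioo (0 : ℝ) 1)
    {s : ℝ} (hs : 0 < s) (hs1 : s ≤ 1 / 16) (N : ℕ) :
    ∑ n ∈ Finset.range N, (ENNReal.ofReal (s / 4 ^ n))⁻¹ *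
        ∫⁻ x in R, ‖f (x + (s / 4 ^ n) • e) - f x‖ₑ ^ 2 ≤
      10 * (∑ n ∈ Finset.range N, (ENNReal.ofReal (s / 4 ^ n))⁻¹) * (∫⁻ x, Gi x ^ 2) +
        85 * ∫⁻ x, Go x ^ 2 := by
  have hσ : ∀ n : ℕ, 0 < s / 4 ^ n := fun n => by positivity
  have hσ1 : ∀ n : ℕ, s / 4 ^ n ≤ 1 / 16 := fun n =>
    (div_le_self hs.le (one_le_pow₀ (by norm_num))).trans hs1
  set A := ∫⁻ x, Gi x ^ 2 with hA
  set X := ∫⁻ x, Go x ^ 2 with hX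
  set Z : Set E3 := {y | y 2 ∈ Ioo (1 / 8 : ℝ) (1 / 4)} with hZ
  have hZm : MeasurableSet Z := measurableSet_Ioo.preimage (by fun_prop)
  have hRZ : ∀ x ∈ R, x ∈ Z := fun x hx => (hR x hx 0 ⟨le_rfl, by norm_num⟩).1
  have mc : Measurable fun x : E3 => x 2 := by fun_prop
  set P : E3 → ℝ≥0∞ := fun y => (∫⁻ t in Ioo (0 : ℝ) 1, Gi (y + t • (-e3))) ^ 2 with hP
  have mP : Measurable P := by
    have : Measurable fun p : E3 × ℝ => Gi (p.1 + p.2 • (-e3)) := hGi.comp (by fun_prop)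
    exact (this.lintegral_prod_right').pow_const 2
  have hPA : ∫⁻ y, P y ≤ A := by
    calc ∫⁻ y, P y ≤ ∫⁻ y, ∫⁻ t in Ioo (0 : ℝ) 1, Gi (y + t • (-e3)) ^ 2 := by
          refine lintegral_mono fun y => ?_
          have : Measurable fun t : ℝ => Gi (y + t • (-e3)) := hGi.comp (by fun_prop)
          refine (sq_setLIntegral_le (μ := volume) this.aemeasurable).trans (le_of_eq ?_)
          simp
      _ = A := by
          rw [lintegral_segment_le (hGi.pow_const 2)]; simp [hA]
  set H : ℕ → E3 → ℝ≥0∞ := fun n y =>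
    (∫⁻ t in Ioo (y 2) (y 2 + 2 * (s / 4 ^ n)), Go (y + t • (-e3))) ^ 2 with hH
  have mG : Measurable fun p : E3 × ℝ => Go (p.1 + p.2 • (-e3)) := hGo.comp (by fun_prop)
  have mH : ∀ n, Measurable (H n) := fun n =>
    (measurable_lintegral_Ioo mG mc (by fun_prop)).pow_const 2
  have hHX : ∑ n ∈ Finset.range N, (ENNReal.ofReal (s / 4 ^ n))⁻¹ * ∫⁻ y in Z, H n y ≤ 8 * X := by
    simp only [← lintegral_const_mul _ (mH _)]
    rw [← lintegral_finsetSum _ fun n _ => (mH n).const_mul _]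
    calc _ ≤ ∫⁻ y in Z, 8 * ∫⁻ t in Ioo (0 : ℝ) 1, Go (y + t • (-e3)) ^ 2 := by
          refine setLIntegral_mono' hZm fun y hy => ?_
          have m1 : Measurable fun t : ℝ => Go (y + t • (-e3)) := hGo.comp (by fun_prop)
          refine (sum_hardy_le m1 (y 2) hs hs1 N).trans ?_
          gcongr
          · linarith [hy.1]
          · linarith [hy.2]
      _ ≤ ∫⁻ y, 8 * ∫⁻ t in Ioo (0 : ℝ) 1, Go (y + t • (-e3)) ^ 2 := setLIntegral_le_lintegral _ _
      _ = 8 * X := by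
          have m2 : Measurable fun p : E3 × ℝ => Go (p.1 + p.2 • (-e3)) ^ 2 := mG.pow_const 2
          rw [lintegral_const_mul _ m2.lintegral_prod_right',
            lintegral_segment_le (hGo.pow_const 2)]
          simp [hX]
  set Q : ℕ → E3 → ℝ≥0∞ := fun n x =>
    ∫⁻ S in Ioo (x 2 + s / 4 ^ n) (x 2 + 2 * (s / 4 ^ n)), ∫⁻ t in Ioo 0 (s / 4 ^ n),
          Go (x + S • (-e3) + t • e) ^ 2 with hQ
  have mQ : ∀ n, Measurable (Q n) := fun n => by
    have m3 : Measurable fun p : (E3 × ℝ) × ℝ => Go (p.1.1 + p.1.2 • (-e3) + p.2 • e) ^ 2 :=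
      (hGo.comp (by fun_prop)).pow_const 2
    exact measurable_lintegral_Ioo (m3.lintegral_prod_right' (ν := volume.restrict _))
      (by fun_prop) (by fun_prop)
  set slab : ℕ → Set E3 := fun n => {y | y 2 ∈ Ioo (-(2 * (s / 4 ^ n))) (-(s / 4 ^ n))} with hslab
  have hslabm : ∀ n, MeasurableSet (slab n) := fun n => measurableSet_Ioo.preimage mc
  have hQX : ∀ n, (ENNReal.ofReal (s / 4 ^ n))⁻¹ * ∫⁻ x in R, Q n x ≤
      ∫⁻ y in slab n, Go y ^ 2 := by
    intro n
    set F : E3 → ℝ≥0∞ := (slab n).indicator fun y => Go y ^ 2 with hF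
    have mF : Measurable F := (hGo.pow_const 2).indicator (hslabm n)
    have m4 : Measurable fun y : E3 => ∫⁻ t in Ioo 0 (s / 4 ^ n), F (y + t • e) := by
      have : Measurable fun p : E3 × ℝ => F (p.1 + p.2 • e) := mF.comp (by fun_prop)
      exact this.lintegral_prod_right'
    have h1 : ∫⁻ x in R, Q n x ≤ ∫⁻ x, ∫⁻ S in Ioo (0 : ℝ) 1, ∫⁻ t in Ioo 0 (s / 4 ^ n),
        F (x + S • (-e3) + t • e) := by
      refine le_trans (setLIntegral_mono' hRm fun x hx => ?_) (setLIntegral_le_lintegral R _)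
      have hx2 := hRZ x hx
      refine le_trans (setLIntegral_mono' measurableSet_Ioo fun S hS => ?_)
        (lintegral_mono_set (Ioo_subset_Ioo ?_ ?_))
      · refine lintegral_mono fun t => ?_
        rw [hF, indicator_of_mem]
        simp only [hslab, mem_ofPred_eq, PiLp.add_apply, PiLp.smul_apply, PiLp.neg_apply, e3_two,
          he2, smul_eq_mul, mem_Ioo]
        constructor <;> linarith [hS.1, hS.2]
      · linarith [hx2.1, hσ n]
      · linarith [hx2.2, hσ1 n]
    rw [lintegral_segment_le m4, lintegral_segment_le mF, hF,
      lintegral_indicator (hslabm n)] at h1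
    have h0 : ENNReal.ofReal (s / 4 ^ n) ≠ 0 := by simpa using hσ n
    calc _ ≤ (ENNReal.ofReal (s / 4 ^ n))⁻¹ * (ENNReal.ofReal (s / 4 ^ n) *
          ∫⁻ y in slab n, Go y ^ 2) := by
          gcongr; simpa using h1
      _ = _ := by rw [← mul_assoc, ENNReal.inv_mul_cancel h0 ENNReal.ofReal_ne_top, one_mul]
  have hQsum : ∑ n ∈ Finset.range N, (ENNReal.ofReal (s / 4 ^ n))⁻¹ * ∫⁻ x in R, Q n x ≤ X := by
    refine (Finset.sum_le_sum fun n _ => hQX n).trans ?_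
    rw [← lintegral_biUnion_finset (fun i _ j _ hij => disjoint_slabs hs hij)
      (fun n _ => hslabm n)]
    exact setLIntegral_le_lintegral _ _
  have hone : ∀ n, ∫⁻ x in R, ‖f (x + (s / 4 ^ n) • e) - f x‖ₑ ^ 2 ≤
      5 * (A + A + (∫⁻ y in Z, H n y) + (∫⁻ y in Z, H n y) + ∫⁻ x in R, Q n x) := by
    intro n
    have hae := ae_sq_enorm_sub_le_of_path hf hk hGi hGo h h3 hout hGo0 he he2 hR (hσ n) (hσ1 n)
    have e2 : ∀ x : E3, (x + (s / 4 ^ n) • e) 2 = x 2 := fun x => by simp [he2]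
    have hae' : ∀ᵐ x ∂(volume.restrict R), ‖f (x + (s / 4 ^ n) • e) - f x‖ₑ ^ 2 ≤
        5 * (P x + P (x + (s / 4 ^ n) • e) + H n x + H n (x + (s / 4 ^ n) • e) + Q n x) := by
      filter_upwards [ae_restrict_of_ae hae, ae_restrict_mem hRm] with x hx hxR
      refine (hx hxR).trans (le_of_eq ?_)
      simp only [hP, hH, hQ, e2]
    refine (lintegral_mono_ae hae').trans ?_
    have mt : Measurable fun x : E3 => x + (s / 4 ^ n) • e := by fun_prop
    have a1 : Measurable fun x => P (x + (s / 4 ^ n) • e) := mP.comp mt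
    have a2 : Measurable fun x => H n (x + (s / 4 ^ n) • e) := (mH n).comp mt
    have a3 := mH n
    rw [lintegral_const_mul _ (by fun_prop), lintegral_add_right _ (mQ n),
      lintegral_add_right _ a2, lintegral_add_right _ (mH n), lintegral_add_right _ a1]
    refine mul_le_mul_right (add_le_add (add_le_add (add_le_add (add_le_add ?_ ?_) ?_) ?_) ?_) _
    · exact (setLIntegral_le_lintegral _ _).trans hPA
    · exact (setLIntegral_le_lintegral _ _).trans ((lintegral_translate P _).le.trans hPA)
    · exact lintegral_mono_set hRZ
    · refine lintegral_translate_le (a := (s / 4 ^ n) • e) (fun x hx => ?_) (H n)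
      show (x + (s / 4 ^ n) • e) 2 ∈ Ioo (1 / 8 : ℝ) (1 / 4)
      rw [e2]; exact hRZ x hx
    · exact le_rfl
  calc _ ≤ ∑ n ∈ Finset.range N, (ENNReal.ofReal (s / 4 ^ n))⁻¹ *
        (5 * (A + A + (∫⁻ y in Z, H n y) + (∫⁻ y in Z, H n y) + ∫⁻ x in R, Q n x)) := by
        gcongr with n; exact hone n
    _ = 10 * (∑ n ∈ Finset.range N, (ENNReal.ofReal (s / 4 ^ n))⁻¹) * A +
        10 * (∑ n ∈ Finset.range N, (ENNReal.ofReal (s / 4 ^ n))⁻¹ * ∫⁻ y in Z, H n y) +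
        5 * ∑ n ∈ Finset.range N, (ENNReal.ofReal (s / 4 ^ n))⁻¹ * ∫⁻ x in R, Q n x := by
        simp only [Finset.mul_sum, Finset.sum_mul, ← Finset.sum_add_distrib]
        refine Finset.sum_congr rfl fun n _ => ?_
        ring
    _ ≤ 10 * (∑ n ∈ Finset.range N, (ENNReal.ofReal (s / 4 ^ n))⁻¹) * A + 10 * (8 * X) + 5 * X := by
        gcongr
    _ = _ := by ring

/-! ### Boxes and averages -/

/-- The open box with centre `(1/2, 1/2)` and half side `κ` in the first two coordinates, and third
coordinate in `(a, b)`. -/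
def box (κ a b : ℝ) : Set E3 :=
  {x | x 0 ∈ Ioo (1 / 2 - κ) (1 / 2 + κ) ∧ x 1 ∈ Ioo (1 / 2 - κ) (1 / 2 + κ) ∧ x 2 ∈ Ioo a b}

theorem isOpen_box (κ a b : ℝ) : IsOpen (box κ a b) :=
  (isOpen_Ioo.preimage (by fun_prop : Continuous fun x : E3 => x 0)).inter
    ((isOpen_Ioo.preimage (by fun_prop : Continuous fun x : E3 => x 1)).inter
      (isOpen_Ioo.preimage (by fun_prop : Continuous fun x : E3 => x 2)))

theorem measurableSet_box (κ a b : ℝ) : MeasurableSet (box κ a b) :=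
  (isOpen_box κ a b).measurableSet

theorem volume_coordinate_box (a b : Fin 3 → ℝ) :
    volume {x : E3 | ∀ i, x i ∈ Ioo (a i) (b i)} = ∏ i, ENNReal.ofReal (b i - a i) := by
  rw [← Real.volume_pi_Ioo]
  have h := (EuclideanSpace.volume_preserving_symm_measurableEquiv_toLp (Fin 3)).measure_preimage
    (s := Set.pi univ fun i => Ioo (a i) (b i))
    (MeasurableSet.univ_pi fun i => measurableSet_Ioo).nullMeasurableSet
  rw [← h]
  congr 1
  ext x
  simp

theorem volume_box (κ a b : ℝ) :
    volume (box κ a b) =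
      ENNReal.ofReal (2 * κ) * ENNReal.ofReal (2 * κ) * ENNReal.ofReal (b - a) := by
  have h := volume_coordinate_box ![1 / 2 - κ, 1 / 2 - κ, a] ![1 / 2 + κ, 1 / 2 + κ, b]
  simp only [Fin.prod_univ_three, Matrix.cons_val_zero, Matrix.cons_val_one, Matrix.cons_val] at h
  rw [show 1 / 2 + κ - (1 / 2 - κ) = 2 * κ by ring] at h
  rw [← h]
  congr 1
  ext x
  simp [box, Fin.forall_fin_succ]

theorem isOpen_cube (L : ℝ) : IsOpen (cube L) := by
  have : cube L = ⋂ i : Fin 3, (fun x : E3 => x i) ⁻¹' Ioo 0 L := by ext; simp [cube]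
  rw [this]
  exact isOpen_iInter_of_finite fun i => isOpen_Ioo.preimage (by fun_prop)

theorem volume_cube_one : volume (cube 1) = 1 := by
  have h := volume_coordinate_box (fun _ => 0) (fun _ => 1)
  simpa [cube] using h

theorem box_subset_cube {κ a b : ℝ} (hκ : κ ≤ 1 / 2) (ha : 0 ≤ a) (hb : b ≤ 1) :
    box κ a b ⊆ cube 1 := by
  rintro x ⟨⟨h1, h2⟩, ⟨h3, h4⟩, h5, h6⟩ i
  fin_cases i <;> simp only [Fin.zero_eta, Fin.mk_one, Fin.reduceFinMk] <;>
    constructor <;> linarith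

@[simp] theorem eXi_two : eXi 2 = 0 := by simp [eXi]
@[simp] theorem eEta_two : eEta 2 = 0 := by simp [eEta]

theorem norm_eXi : ‖eXi‖ = 1 := by
  rw [EuclideanSpace.norm_eq]
  simp [eXi, Fin.sum_univ_three]
  norm_num

theorem norm_eEta : ‖eEta‖ = 1 := by
  rw [EuclideanSpace.norm_eq]
  simp [eEta, Fin.sum_univ_three]
  norm_num

theorem norm_e3 : ‖e3‖ = 1 := by
  rw [EuclideanSpace.norm_eq]
  simp [e3, Fin.sum_univ_three]

theorem inner_eXi_eEta : inner ℝ eXi eEta = (0 : ℝ) := by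
  simp [eXi, eEta, PiLp.inner_apply, Fin.sum_univ_three]

theorem abs_coord_le_norm (v : E3) (i : Fin 3) : |v i| ≤ ‖v‖ := by
  simpa using PiLp.norm_apply_le v i

theorem add_smul_mem_box {κ κ' a b : ℝ} {e : E3} (he : ‖e‖ ≤ 1) (he2 : e 2 = 0) {t : ℝ}
    (ht : 0 ≤ t) (hκ : κ + t ≤ κ') {x : E3} (hx : x ∈ box κ a b) : x + t • e ∈ box κ' a b := by
  obtain ⟨⟨h1, h2⟩, ⟨h3, h4⟩, h5⟩ := hx
  have hb : ∀ i, |t * e i| ≤ t := fun i => by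
    rw [abs_mul, abs_of_nonneg ht]
    exact mul_le_of_le_one_right ht ((abs_coord_le_norm e i).trans he)
  have h0 := abs_le.1 (hb 0)
  have h1' := abs_le.1 (hb 1)
  refine ⟨?_, ?_, ?_⟩
  · simp only [PiLp.add_apply, PiLp.smul_apply, smul_eq_mul]
    constructor <;> linarith [h0.1, h0.2]
  · simp only [PiLp.add_apply, PiLp.smul_apply, smul_eq_mul]
    constructor <;> linarith [h1'.1, h1'.2]
  · simpa [he2] using h5

/-- The closed counterpart of `box`. -/
def closedBox (κ a b : ℝ) : Set E3 :=
  {x | x 0 ∈ Icc (1 / 2 - κ) (1 / 2 + κ) ∧ x 1 ∈ Icc (1 / 2 - κ) (1 / 2 + κ) ∧ x 2 ∈ Icc a b}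

theorem isCompact_closedBox (κ a b : ℝ) : IsCompact (closedBox κ a b) := by
  have h : closedBox κ a b = (EuclideanSpace.equiv (Fin 3) ℝ) ⁻¹'
      (Set.pi univ fun i => Icc (![1 / 2 - κ, 1 / 2 - κ, a] i) (![1 / 2 + κ, 1 / 2 + κ, b] i)) := by
    ext x
    simp only [closedBox, mem_ofPred_eq, mem_preimage, mem_univ_pi, Fin.forall_fin_succ]
    simp [EuclideanSpace.equiv]
  rw [h]
  exact ((EuclideanSpace.equiv (Fin 3) ℝ).toHomeomorph.isCompact_preimage).2
    (isCompact_univ_pi fun i => isCompact_Icc)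

theorem box_subset_closedBox (κ a b : ℝ) : box κ a b ⊆ closedBox κ a b :=
  fun _ hx => ⟨Ioo_subset_Icc_self hx.1, Ioo_subset_Icc_self hx.2.1, Ioo_subset_Icc_self hx.2.2⟩

theorem closedBall_subset_box {κ κ' a a' b b' δ : ℝ} (hκ : κ + δ < κ') (ha : a' + δ < a)
    (hb : b + δ < b') {x : E3} (hx : x ∈ closedBox κ a b) :
    Metric.closedBall x δ ⊆ box κ' a' b' := by
  intro y hy
  have hd : ∀ i, |y i - x i| ≤ δ := fun i => by
    have h1 := abs_coord_le_norm (y - x) i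
    rw [Metric.mem_closedBall, dist_eq_norm] at hy
    simpa using h1.trans hy
  obtain ⟨⟨h1, h2⟩, ⟨h3, h4⟩, h5, h6⟩ := hx
  have d0 := abs_le.1 (hd 0)
  have d1 := abs_le.1 (hd 1)
  have d2 := abs_le.1 (hd 2)
  refine ⟨⟨?_, ?_⟩, ⟨?_, ?_⟩, ?_, ?_⟩ <;> linarith [d0.1, d0.2, d1.1, d1.2, d2.1, d2.2]

theorem ae_integrableOn_translate {F : Type*} [NormedAddCommGroup F] {q : E3 → F}
    (hq : LocallyIntegrable q volume) (v : E3) (s : ℝ) :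
    ∀ᵐ x, IntegrableOn (fun t : ℝ => q (x + t • v)) (Icc 0 s) := by
  have h : ∀ n : ℕ, ∀ᵐ x ∂(volume.restrict (Metric.closedBall (0 : E3) n)),
      IntegrableOn (fun t : ℝ => q (x + t • v)) (Icc 0 s) := by
    intro n
    have h1 := integrableOn_translate hq (isCompact_closedBall (0 : E3) n) v s
    rw [IntegrableOn, ← Measure.prod_restrict] at h1
    exact h1.prod_left_ae
  have h2 := ae_restrict_iUnion_iff (fun n : ℕ => Metric.closedBall (0 : E3) n)
    (fun x => IntegrableOn (fun t : ℝ => q (x + t • v)) (Icc 0 s)) (μ := volume)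
  rw [Metric.iUnion_closedBall_nat, Measure.restrict_univ] at h2
  exact h2.2 h

/-- Averaging over translations in direction `w` does not increase the variation in direction
`v`. -/
theorem dirVariation_average_le {Ω U : Set E3} {q : E3 → ℝ}
    (hq : Integrable q) (hq0 : ∀ x ∉ Ω, q x = 0) (v w : E3) {r : ℝ} (hr : 0 < r)
    (hUΩ : ∀ x ∈ U, ∀ t ∈ Icc 0 r, x + t • w ∈ Ω) :
    dirVariation U v (fun x => ∫ t in (0 : ℝ)..r, q (x + t • w)) ≤
      ENNReal.ofReal r * dirVariation Ω v q := by
  by_cases hV : dirVariation Ω v q = ⊤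
  · rw [hV, ENNReal.mul_top (by simpa using hr)]; exact le_top
  refine iSup₂_le ?_
  rintro φ ⟨hφ, hc, hs, h1⟩
  have hr0 := hr.le
  have hdc : Continuous fun x => fderiv ℝ φ x v :=
    (hφ.continuous_fderiv (by simp)).clm_apply continuous_const
  have hdt : ∀ x ∉ tsupport φ, fderiv ℝ φ x v = 0 := fun x hx => by
    rw [fderiv_of_notMem_tsupport ℝ hx]; simp
  have hprod : Integrable (Function.uncurry fun (t : ℝ) (x : E3) =>
      q (x + t • w) * fderiv ℝ φ x v) ((volume.restrict (Icc 0 r)).prod volume) := by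
    have h1 := integrableOn_translate hq.locallyIntegrable hc w r
    obtain ⟨C, hC⟩ := (hc.fderiv_apply ℝ v).exists_bound_of_continuous hdc
    have h2 : IntegrableOn (fun p : ℝ × E3 => q (p.2 + p.1 • w) * fderiv ℝ φ p.2 v)
        (Icc 0 r ×ˢ tsupport φ) ((volume : Measure ℝ).prod volume) :=
      h1.mul_bdd (c := C) (by exact (hdc.comp continuous_snd).aestronglyMeasurable)
        (Eventually.of_forall fun p => hC p.2)
    have h3 : IntegrableOn (fun p : ℝ × E3 => q (p.2 + p.1 • w) * fderiv ℝ φ p.2 v)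
        (Icc 0 r ×ˢ univ) ((volume : Measure ℝ).prod volume) := by
      refine h2.of_forall_sdiff_eq_zero (measurableSet_Icc.prod MeasurableSet.univ) ?_
      rintro ⟨t, x⟩ ⟨⟨ht, -⟩, hn⟩
      have : x ∉ tsupport φ := fun hx => hn ⟨ht, hx⟩
      simp [hdt x this]
    rw [IntegrableOn, ← Measure.prod_restrict, Measure.restrict_univ] at h3
    exact h3
  have e1 : ∫ x in U, (∫ t in (0 : ℝ)..r, q (x + t • w)) * fderiv ℝ φ x v =
      ∫ t in Icc 0 r, ∫ x, q (x + t • w) * fderiv ℝ φ x v := by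
    rw [setIntegral_eq_integral_of_forall_compl_eq_zero (fun x hx => by
      rw [hdt x fun h => hx (hs h), mul_zero]), integral_integral_swap hprod]
    refine integral_congr_ae (Eventually.of_forall fun x => ?_)
    simp only [intervalIntegral.integral_of_le hr0, ← integral_Icc_eq_integral_Ioc]
    rw [integral_mul_const]
  have e2 : ∀ t ∈ Icc 0 r, ∫ x, q (x + t • w) * fderiv ℝ φ x v ≤ (dirVariation Ω v q).toReal := by
    intro t ht
    have hts : tsupport (fun x => φ (x - t • w)) ⊆ Ω := by
      have : tsupport (fun x => φ (x - t • w)) = (fun x => x - t • w) ⁻¹' tsupport φ :=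
        tsupport_comp_eq_preimage φ (Homeomorph.subRight (t • w))
      rw [this]
      intro x hx
      have := hUΩ _ (hs hx) t ht
      simpa using this
    have hle : ENNReal.ofReal (∫ x in Ω, q x * fderiv ℝ (fun x => φ (x - t • w)) x v) ≤
        dirVariation Ω v q :=
      le_iSup₂_of_le (f := fun φ _ => ENNReal.ofReal (∫ x in Ω, q x * fderiv ℝ φ x v))
        (fun x => φ (x - t • w)) ⟨by fun_prop,
        hc.comp_homeomorph (Homeomorph.subRight (t • w)), hts, fun x => h1 _⟩ le_rfl
    rw [setIntegral_eq_integral_of_forall_compl_eq_zero (fun x hx => by rw [hq0 x hx, zero_mul]),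
      integral_fderiv_translate] at hle
    rw [← integral_add_right_eq_self _ (t • w)] at hle
    simp only [add_sub_cancel_right] at hle
    exact (ENNReal.ofReal_le_iff_le_toReal hV).1 hle
  rw [e1, ← ENNReal.ofReal_toReal hV, ← ENNReal.ofReal_mul hr0]
  refine ENNReal.ofReal_le_ofReal ?_
  calc ∫ t in Icc 0 r, ∫ x, q (x + t • w) * fderiv ℝ φ x v
      ≤ ∫ t in Icc 0 r, (dirVariation Ω v q).toReal :=
        setIntegral_mono_on hprod.integral_prod_left (by simp) measurableSet_Icc e2
    _ = r * (dirVariation Ω v q).toReal := by simp [hr0]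

/-! ### The lower bound on the unit cube -/

/-- The gradient of the far field `u₀`. -/
noncomputable def farGrad (θ : ℝ) : E3 := (1 - θ) • eXi + θ • eEta

theorem farField_eq_inner (θ : ℝ) (x : E3) : farField θ x = inner ℝ x (farGrad θ) := by
  simp [farField, farGrad, xiComp, etaComp, inner_add_right, inner_smul_right]

theorem hasGradientAt_farField (θ : ℝ) (x : E3) : HasGradientAt (farField θ) (farGrad θ) x := by
  have h : farField θ = fun x => (InnerProductSpace.toDual ℝ E3) (farGrad θ) x := by
    ext x
    rw [farField_eq_inner, InnerProductSpace.toDual_apply_apply, real_inner_comm]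
  rw [h, hasGradientAt_iff_hasFDerivAt]
  exact ContinuousLinearMap.hasFDerivAt _

theorem gradient_farField (θ : ℝ) (x : E3) : (∇ (farField θ)) x = farGrad θ :=
  (hasGradientAt_farField θ x).gradient

theorem lipschitz_farField (θ : ℝ) : LipschitzWith ‖farGrad θ‖₊ (farField θ) := by
  refine LipschitzWith.of_dist_le_mul fun x y => ?_
  rw [farField_eq_inner, farField_eq_inner, Real.dist_eq, ← inner_sub_left, dist_eq_norm, mul_comm]
  exact abs_real_inner_le_norm _ _

theorem hasWeakGradient_farField (θ : ℝ) : HasWeakGradient (farField θ) fun _ => farGrad θ := by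
  have h := hasWeakGradient_of_lipschitz (lipschitz_farField θ)
  rwa [show (∇ (farField θ)) = fun _ => farGrad θ from funext (gradient_farField θ)] at h

@[simp] theorem farGrad_two (θ : ℝ) : farGrad θ 2 = 0 := by simp [farGrad]

theorem inner_e3 (v : E3) : inner ℝ v e3 = v 2 := by
  simp [e3, PiLp.inner_apply, Fin.sum_univ_three]

theorem inner_farGrad_eXi (θ : ℝ) : inner ℝ (farGrad θ) eXi = 1 - θ := by
  simp [farGrad, inner_add_left, inner_smul_left, real_inner_comm eXi eEta, inner_eXi_eEta,
    norm_eXi]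

theorem inner_farGrad_eEta (θ : ℝ) : inner ℝ (farGrad θ) eEta = θ := by
  simp [farGrad, inner_add_left, inner_smul_left, inner_eXi_eEta, norm_eEta]

theorem farField_add_smul (θ : ℝ) (x v : E3) (t : ℝ) :
    farField θ (x + t • v) = farField θ x + t * inner ℝ (farGrad θ) v := by
  simp only [farField_eq_inner, inner_add_left, inner_smul_left, real_inner_comm (farGrad θ) v]
  simp

theorem sq_add_le (a b : ℝ≥0∞) : (a + b) ^ 2 ≤ 2 * (a ^ 2 + b ^ 2) := by
  have h := ENNReal.rpow_add_le_mul_rpow_add_rpow a b (p := 2) (by norm_num)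
  norm_num at h
  exact_mod_cast h

/-- A deformation on `ℝ³` with its weak gradient and an admissible plastic strain on the unit cube,
with measurable representatives and the strain extended by zero. -/
structure Competitor (u : E3 → ℝ) (g β : E3 → E3) : Prop where
  measurable_u : Measurable u
  measurable_g : Measurable g
  measurable_β : Measurable β
  weakGradient : HasWeakGradient u g
  integrable : Integrable β
  eq_zero : ∀ x ∉ cube 1, β x = 0
  admissible : ∀ᵐ x, x ∈ cube 1 → β x 2 = 0 ∧ xiComp (β x) * etaComp (β x) = 0 ∧
    0 ≤ etaComp (β x) ∧ 0 ≤ xiComp (β x)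

/-- The elastic strain in the unit cube. -/
noncomputable def innerError (g β : E3 → E3) : E3 → ℝ≥0∞ :=
  (cube 1).indicator fun x => ‖g x - β x‖ₑ

/-- The deviation from the far field outside the unit cube. -/
noncomputable def outerError (θ : ℝ) (g : E3 → E3) : E3 → ℝ≥0∞ :=
  (cube 1)ᶜ.indicator fun x => ‖g x - farGrad θ‖ₑ

namespace Competitor

variable {u : E3 → ℝ} {g β : E3 → E3}

theorem measurable_innerError (hc : Competitor u g β) : Measurable (innerError g β) :=
  ((hc.measurable_g.sub hc.measurable_β).enorm).indicator (isOpen_cube 1).measurableSet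

theorem measurable_outerError (hc : Competitor u g β) (θ : ℝ) : Measurable (outerError θ g) :=
  ((hc.measurable_g.sub_const _).enorm).indicator (isOpen_cube 1).measurableSet.compl

theorem measurable_xi (hc : Competitor u g β) : Measurable fun x => xiComp (β x) :=
  hc.measurable_β.inner_const (𝕜 := ℝ)

theorem integrable_xi (hc : Competitor u g β) : Integrable fun x => xiComp (β x) :=
  hc.integrable.inner_const (𝕜 := ℝ) _

theorem integrable_eta (hc : Competitor u g β) : Integrable fun x => etaComp (β x) :=
  hc.integrable.inner_const (𝕜 := ℝ) _

/-- The trace estimate for the deviation of the deformation from the far field. -/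
theorem sum_trace_le (hc : Competitor u g β) (θ : ℝ) {e : E3} (he : ‖e‖ ≤ 1) (he2 : e 2 = 0)
    {κ : ℝ} (hκ : κ ≤ 7 / 16) {s : ℝ} (hs : 0 < s) (hs1 : s ≤ 1 / 16) (N : ℕ) :
    ∑ n ∈ Finset.range N, (ENNReal.ofReal (s / 4 ^ n))⁻¹ * ∫⁻ x in box κ (1 / 8) (1 / 4),
        ‖(u (x + (s / 4 ^ n) • e) - farField θ (x + (s / 4 ^ n) • e)) -
          (u x - farField θ x)‖ₑ ^ 2 ≤
      10 * (∑ n ∈ Finset.range N, (ENNReal.ofReal (s / 4 ^ n))⁻¹) *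
        (∫⁻ x, innerError g β x ^ 2) + 85 * ∫⁻ x, outerError θ g x ^ 2 := by
  have hw := hc.weakGradient.sub (hasWeakGradient_farField θ)
  have hm : Measurable (u - farField θ) :=
    hc.measurable_u.sub (lipschitz_farField θ).continuous.measurable
  have hk : Measurable (g - fun _ => farGrad θ) := hc.measurable_g.sub measurable_const
  have h3 : ∀ᵐ x, ‖(inner ℝ ((g - (fun _ => farGrad θ) : E3 → E3) x) e3 : ℝ)‖ₑ ≤
      innerError g β x + outerError θ g x := by
    filter_upwards [hc.admissible] with x hx
    by_cases hxc : x ∈ cube 1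
    · have hb := (hx hxc).1
      have : (inner ℝ ((g - (fun _ => farGrad θ) : E3 → E3) x) e3 : ℝ) =
          inner ℝ (g x - β x) e3 := by
        simp [inner_e3, hb]
      rw [this]
      refine le_add_right ?_
      rw [innerError, indicator_of_mem hxc, ← ofReal_norm, ← ofReal_norm]
      refine ENNReal.ofReal_le_ofReal ((norm_inner_le_norm _ _).trans ?_)
      rw [norm_e3, mul_one]
    · refine le_add_left ?_
      rw [outerError, indicator_of_mem hxc, ← ofReal_norm, ← ofReal_norm]
      refine ENNReal.ofReal_le_ofReal ((norm_inner_le_norm _ _).trans ?_)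
      rw [norm_e3, mul_one]
      rfl
  have hout : ∀ᵐ x, x 2 < 0 → ‖(g - (fun _ => farGrad θ) : E3 → E3) x‖ₑ ≤ outerError θ g x := by
    refine Eventually.of_forall fun x hx => ?_
    have : x ∉ cube 1 := fun h => by have := (h 2).1; linarith
    rw [outerError, indicator_of_mem this]
    rfl
  exact sum_sq_enorm_sub_le hm hk hc.measurable_innerError (hc.measurable_outerError θ) hw h3 hout
    (fun x hx => by simp [outerError, hx]) he he2 (measurableSet_box _ _ _) (fun x hx t ht =>
      ⟨hx.2.2, by
        have := box_subset_cube (by norm_num) (by norm_num) (by norm_num)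
          (add_smul_mem_box (κ' := 1 / 2) he he2 ht.1 (by linarith [ht.2]) hx)
        exact ⟨this 0, this 1⟩⟩) hs hs1 N

/-- The trace estimate at a single scale. -/
theorem trace_le (hc : Competitor u g β) (θ : ℝ) {e : E3} (he : ‖e‖ ≤ 1) (he2 : e 2 = 0)
    {κ : ℝ} (hκ : κ ≤ 7 / 16) {s : ℝ} (hs : 0 < s) (hs1 : s ≤ 1 / 16) :
    ∫⁻ x in box κ (1 / 8) (1 / 4),
        ‖(u (x + s • e) - farField θ (x + s • e)) - (u x - farField θ x)‖ₑ ^ 2 ≤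
      10 * (∫⁻ x, innerError g β x ^ 2) + 85 * ENNReal.ofReal s * ∫⁻ x, outerError θ g x ^ 2 := by
  have h := hc.sum_trace_le θ he he2 hκ hs hs1 1
  simp only [Finset.range_one, Finset.sum_singleton, pow_zero, div_one] at h
  have hs0 : ENNReal.ofReal s ≠ 0 := by simpa using hs
  have h2 := mul_le_mul_right h (ENNReal.ofReal s)
  rw [← mul_assoc, ENNReal.mul_inv_cancel hs0 ENNReal.ofReal_ne_top, one_mul] at h2
  refine h2.trans (le_of_eq ?_)
  calc _ = 10 * (ENNReal.ofReal s * (ENNReal.ofReal s)⁻¹) * (∫⁻ x, innerError g β x ^ 2) +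
        85 * ENNReal.ofReal s * ∫⁻ x, outerError θ g x ^ 2 := by ring
    _ = _ := by rw [ENNReal.mul_inv_cancel hs0 ENNReal.ofReal_ne_top, mul_one]

/-- On most segments of length `r` in direction `e_ξ` there is slip on the first system: the far
field has slope `1 - θ ≥ 1/2` in this direction, and by the trace estimate `u` cannot deviate much
from it. -/
theorem measure_smallSlip_le (hc : Competitor u g β) {θ : ℝ} (hθ : θ ≤ 1 / 2) {r : ℝ} (hr : 0 < r)
    (hr1 : r ≤ 1 / 16) :
    ENNReal.ofReal (r ^ 2) * volume {x ∈ box (1 / 4) (1 / 8) (1 / 4) |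
        ∫ t in (0 : ℝ)..r, xiComp (β (x + t • eXi)) < r / 4} ≤
      32 * (10 * (∫⁻ x, innerError g β x ^ 2) +
        85 * ENNReal.ofReal r * (∫⁻ x, outerError θ g x ^ 2) +
        ENNReal.ofReal (r ^ 2) * ∫⁻ x, innerError g β x ^ 2) := by
  set R := box (1 / 4) (1 / 8) (1 / 4) with hR
  have hRm : MeasurableSet R := measurableSet_box _ _ _
  set f : E3 → ℝ := fun x => u x - farField θ x with hf
  have hfm : Measurable f := hc.measurable_u.sub (lipschitz_farField θ).continuous.measurable
  set G := innerError g β with hG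
  have hGm : Measurable G := hc.measurable_innerError
  set Df : E3 → ℝ≥0∞ := fun x => ‖f (x + r • eXi) - f x‖ₑ with hDf
  have hDfm : Measurable Df := ((hfm.comp (by fun_prop)).sub hfm).enorm
  set S : E3 → ℝ≥0∞ := fun x => ∫⁻ t in Ioo 0 r, G (x + t • eXi) with hS
  have hSm : Measurable S := by
    have : Measurable fun p : E3 × ℝ => G (p.1 + p.2 • eXi) := hGm.comp (by fun_prop)
    exact this.lintegral_prod_right'
  set B := {x ∈ R | ∫ t in (0 : ℝ)..r, xiComp (β (x + t • eXi)) < r / 4} with hB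
  have hBm : MeasurableSet B := by
    suffices h : Measurable fun x => ∫ t in (0 : ℝ)..r, xiComp (β (x + t • eXi)) from
      hRm.inter (measurableSet_lt h measurable_const)
    have : Measurable fun p : E3 × ℝ => xiComp (β (p.1 + p.2 • eXi)) :=
      hc.measurable_xi.comp (by fun_prop)
    simp only [intervalIntegral.integral_of_le hr.le]
    exact (this.stronglyMeasurable.integral_prod_right' (ν := volume.restrict (Ioc 0 r))).measurable
  have hRc : ∀ x ∈ R, ∀ t ∈ Ioo 0 r, x + t • eXi ∈ cube 1 := fun x hx t ht =>
    box_subset_cube (by norm_num) (by norm_num) (by norm_num)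
      (add_smul_mem_box (κ' := 1 / 2) norm_eXi.le eXi_two ht.1.le (by linarith [ht.2]) hx)
  have hpt : ∀ᵐ x ∂(volume.restrict B), ENNReal.ofReal (r / 4) ≤ Df x + S x := by
    have i1 := ae_integrableOn_translate hc.weakGradient.2.1 eXi r
    have i2 := ae_integrableOn_translate hc.integrable.locallyIntegrable eXi r
    filter_upwards [ae_restrict_of_ae (hc.weakGradient.ae_sub_eq eXi hr.le), ae_restrict_of_ae i1,
      ae_restrict_of_ae i2, ae_restrict_mem hBm] with x hx j1 j2 hxB
    have k1 : IntervalIntegrable (fun t : ℝ => inner ℝ (g (x + t • eXi)) eXi) volume 0 r :=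
      (intervalIntegrable_iff_integrableOn_Icc_of_le hr.le).2 (j1.inner_const (𝕜 := ℝ) _)
    have k2 : IntervalIntegrable (fun t : ℝ => xiComp (β (x + t • eXi))) volume 0 r :=
      (intervalIntegrable_iff_integrableOn_Icc_of_le hr.le).2 (j2.inner_const (𝕜 := ℝ) _)
    have e1 : f (x + r • eXi) - f x = (∫ t in (0 : ℝ)..r, inner ℝ (g (x + t • eXi)) eXi) -
        r * (1 - θ) := by
      rw [← hx, hf]
      simp only [farField_add_smul, inner_farGrad_eXi]
      ring
    have e2 : r / 4 ≤ |f (x + r • eXi) - f x| +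
        |∫ t in (0 : ℝ)..r, (inner ℝ (g (x + t • eXi)) eXi - xiComp (β (x + t • eXi)))| := by
      rw [intervalIntegral.integral_sub k1 k2, e1]
      have h3 := hxB.2
      set a := ∫ t in (0 : ℝ)..r, xiComp (β (x + t • eXi))
      set b := ∫ t in (0 : ℝ)..r, inner ℝ (g (x + t • eXi)) eXi
      have h4 := neg_abs_le (b - r * (1 - θ))
      have h5 := le_abs_self (b - a)
      nlinarith
    have e3 : ‖∫ t in (0 : ℝ)..r, (inner ℝ (g (x + t • eXi)) eXi - xiComp (β (x + t • eXi)))‖ₑ ≤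
        S x := by
      rw [intervalIntegral.integral_of_le hr.le]
      refine (enorm_integral_le_lintegral_enorm _).trans ?_
      rw [← restrict_Ioo_eq_restrict_Ioc]
      refine setLIntegral_mono' measurableSet_Ioo fun t ht => ?_
      rw [hG, innerError, indicator_of_mem (hRc x hxB.1 t ht), xiComp, ← inner_sub_left,
        ← ofReal_norm, ← ofReal_norm]
      refine ENNReal.ofReal_le_ofReal ((norm_inner_le_norm _ _).trans ?_)
      rw [norm_eXi, mul_one]
    calc ENNReal.ofReal (r / 4) ≤ ENNReal.ofReal (|f (x + r • eXi) - f x| +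
        |∫ t in (0 : ℝ)..r, (inner ℝ (g (x + t • eXi)) eXi - xiComp (β (x + t • eXi)))|) :=
          ENNReal.ofReal_le_ofReal e2
      _ ≤ _ := by
          rw [ENNReal.ofReal_add (abs_nonneg _) (abs_nonneg _), ← Real.enorm_eq_ofReal_abs,
            ← Real.enorm_eq_ofReal_abs]
          exact add_le_add le_rfl e3
  have hS2 : ∫⁻ x in R, S x ^ 2 ≤ ENNReal.ofReal (r ^ 2) * ∫⁻ x, G x ^ 2 := by
    calc ∫⁻ x in R, S x ^ 2 ≤ ∫⁻ x in R, ENNReal.ofReal r *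
          ∫⁻ t in Ioo 0 r, G (x + t • eXi) ^ 2 := by
          refine lintegral_mono fun x => ?_
          have : Measurable fun t : ℝ => G (x + t • eXi) := hGm.comp (by fun_prop)
          refine (sq_setLIntegral_le (μ := volume) this.aemeasurable).trans (le_of_eq ?_)
          simp
      _ ≤ ∫⁻ x, ENNReal.ofReal r * ∫⁻ t in Ioo 0 r, G (x + t • eXi) ^ 2 :=
          setLIntegral_le_lintegral _ _
      _ = _ := by
          have : Measurable fun p : E3 × ℝ => G (p.1 + p.2 • eXi) ^ 2 :=
            (hGm.comp (by fun_prop)).pow_const 2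
          rw [lintegral_const_mul _ this.lintegral_prod_right',
            lintegral_segment_le (hGm.pow_const 2)]
          rw [Real.volume_Ioo, sub_zero, ← mul_assoc, ← ENNReal.ofReal_mul hr.le, sq]
  have hsq : ENNReal.ofReal ((r / 4) ^ 2) * volume B ≤
      2 * ((∫⁻ x in R, Df x ^ 2) + ∫⁻ x in R, S x ^ 2) := by
    calc ENNReal.ofReal ((r / 4) ^ 2) * volume B
        = ∫⁻ x in B, ENNReal.ofReal (r / 4) ^ 2 := by
          rw [setLIntegral_const, ENNReal.ofReal_pow (by positivity)]
      _ ≤ ∫⁻ x in B, 2 * (Df x ^ 2 + S x ^ 2) := by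
          refine lintegral_mono_ae ?_
          filter_upwards [hpt] with x hx
          refine (pow_le_pow_left' hx 2).trans ?_
          exact sq_add_le _ _
      _ ≤ ∫⁻ x in R, 2 * (Df x ^ 2 + S x ^ 2) := lintegral_mono_set fun x hx => hx.1
      _ = _ := by
          rw [lintegral_const_mul _ (by fun_prop), lintegral_add_left (by fun_prop)]
  have hT := hc.trace_le θ norm_eXi.le eXi_two (κ := 1 / 4) (by norm_num) hr hr1
  have e16 : ENNReal.ofReal (r ^ 2) = 16 * ENNReal.ofReal ((r / 4) ^ 2) := by
    rw [show (16 : ℝ≥0∞) = ENNReal.ofReal 16 by simp, ← ENNReal.ofReal_mul (by norm_num)]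
    congr 1; ring
  calc ENNReal.ofReal (r ^ 2) * volume B = 16 * (ENNReal.ofReal ((r / 4) ^ 2) * volume B) := by
        rw [e16, mul_assoc]
    _ ≤ 16 * (2 * ((∫⁻ x in R, Df x ^ 2) + ∫⁻ x in R, S x ^ 2)) := by gcongr
    _ = 32 * ((∫⁻ x in R, Df x ^ 2) + ∫⁻ x in R, S x ^ 2) := by rw [← mul_assoc]; norm_num
    _ ≤ _ := by gcongr

end Competitor

namespace Competitor

variable {u : E3 → ℝ} {g β : E3 → E3}

theorem measurable_average (hc : Competitor u g β) {r : ℝ} (hr : 0 ≤ r) :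
    Measurable fun x => ∫ t in (0 : ℝ)..r, xiComp (β (x + t • eXi)) := by
  have : Measurable fun p : E3 × ℝ => xiComp (β (p.1 + p.2 • eXi)) :=
    hc.measurable_xi.comp (by fun_prop)
  simp only [intervalIntegral.integral_of_le hr]
  exact (this.stronglyMeasurable.integral_prod_right' (ν := volume.restrict (Ioc 0 r))).measurable

theorem integrableOn_average (hc : Competitor u g β) {r : ℝ} (hr : 0 ≤ r) {K : Set E3}
    (hK : IsCompact K) :
    IntegrableOn (fun x => ∫ t in (0 : ℝ)..r, xiComp (β (x + t • eXi))) K := by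
  have h := integrableOn_translate hc.integrable_xi.locallyIntegrable hK eXi r
  rw [IntegrableOn, ← Measure.prod_restrict] at h
  have h2 := h.integral_prod_right
  refine h2.congr (Eventually.of_forall fun x => ?_)
  simp only [intervalIntegral.integral_of_le hr, integral_Icc_eq_integral_Ioc]

/-- Wherever there is slip on the first system close by in direction `e_ξ`, the slip on the second
system is controlled by its variation, since the two systems exclude each other. -/
theorem exists_eta_majorant (hc : Competitor u g β) {r : ℝ} (hr : 0 < r) (hr1 : r ≤ 1 / 16) :
    ∃ W : E3 → ℝ≥0∞, Measurable W ∧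
      ∫⁻ x in box (3 / 8) (1 / 8) (1 / 4), W x ≤ ENNReal.ofReal r * lineEnergy 1 β ∧
      ∀ᵐ x ∂(volume.restrict (box (3 / 8) (1 / 8) (1 / 4))),
        0 < ∫ t in (0 : ℝ)..r, xiComp (β (x + t • eXi)) → ‖etaComp (β x)‖ₑ ≤ W x := by
  have hsh : ∀ x ∈ box (3 / 8) (1 / 8) (1 / 4), ∀ t ∈ Icc 0 r, x + t • eXi ∈
      box (7 / 16) (1 / 8) (1 / 4) := fun x hx t ht =>
    add_smul_mem_box norm_eXi.le eXi_two ht.1 (by linarith [ht.2]) hx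
  obtain ⟨W, hW, hW1, hW2⟩ := exists_variation_majorant (isOpen_cube 1)
    (hc.integrable_eta.integrableOn) eXi (measurableSet_box (3 / 8) (1 / 8) (1 / 4))
    (isCompact_closedBox (7 / 16) (1 / 8) (1 / 4)) hr (δ := 1 / 32) (by norm_num)
    (fun x hx t ht => box_subset_closedBox _ _ _ (hsh x hx t ht))
    (fun x hx => (closedBall_subset_box (κ' := 1 / 2) (a' := 0) (b' := 1) (by norm_num)
      (by norm_num) (by norm_num) hx).trans (box_subset_cube le_rfl le_rfl le_rfl))
  refine ⟨W, hW, hW1.trans ?_, ?_⟩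
  · refine mul_le_mul_right ?_ _
    unfold lineEnergy
    exact le_add_right (le_add_right (le_add_right le_rfl))
  filter_upwards [hW2, ae_restrict_of_ae (ae_ae_translate hc.admissible eXi),
    ae_restrict_mem (measurableSet_box _ _ _)] with x h1 h2 hx hpos
  by_contra hlt
  have hz : ∀ᵐ t ∂(volume.restrict (Ioo 0 r)), xiComp (β (x + t • eXi)) = 0 := by
    filter_upwards [h1, ae_restrict_of_ae h2, ae_restrict_mem measurableSet_Ioo] with t k1 k2 ht
    have hcu := box_subset_cube (by norm_num) (by norm_num) (by norm_num)
      (hsh x hx t (Ioo_subset_Icc_self ht))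
    rcases mul_eq_zero.1 (k2 hcu).2.1 with h | h
    · exact h
    · rw [h, zero_sub, enorm_neg] at k1
      exact absurd k1 hlt
  rw [intervalIntegral.integral_of_le hr.le, ← restrict_Ioo_eq_restrict_Ioc,
    integral_congr_ae hz] at hpos
  simp at hpos

/-- The slip on the first system, summed over segments in direction `e_ξ`, hardly varies in
direction `e_η`, since `∂_η β_ξ` is part of the line energy. -/
theorem exists_slip_majorant (hc : Competitor u g β) {r s : ℝ} (hr : 0 < r) (hr1 : r ≤ 1 / 16)
    (hs : 0 < s) (hs1 : s ≤ 1 / 16) :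
    ∃ W : E3 → ℝ≥0∞, Measurable W ∧
      ∫⁻ x in box (1 / 4) (1 / 8) (1 / 4), W x ≤
        ENNReal.ofReal s * (ENNReal.ofReal r * lineEnergy 1 β) ∧
      ∀ᵐ x ∂(volume.restrict (box (1 / 4) (1 / 8) (1 / 4))), ∀ᵐ t ∂(volume.restrict (Ioo 0 s)),
        ‖(∫ τ in (0 : ℝ)..r, xiComp (β (x + t • eEta + τ • eXi))) -
          ∫ τ in (0 : ℝ)..r, xiComp (β (x + τ • eXi))‖ₑ ≤ W x := by
  obtain ⟨W, hW, hW1, hW2⟩ := exists_variation_majorant (isOpen_box (3 / 8) (1 / 16) (5 / 16))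
    ((hc.integrableOn_average hr.le (isCompact_closedBox (3 / 8) (1 / 16) (5 / 16))).mono_set
      (box_subset_closedBox _ _ _)) eEta (measurableSet_box (1 / 4) (1 / 8) (1 / 4))
    (isCompact_closedBox (5 / 16) (1 / 8) (1 / 4)) hs (δ := 1 / 32) (by norm_num)
    (fun x hx t ht => box_subset_closedBox _ _ _
      (add_smul_mem_box norm_eEta.le eEta_two ht.1 (by linarith [ht.2]) hx))
    (fun x hx => closedBall_subset_box (by norm_num) (by norm_num) (by norm_num) hx)
  refine ⟨W, hW, hW1.trans (mul_le_mul_right ?_ _), hW2⟩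
  refine (dirVariation_average_le (Ω := cube 1) hc.integrable_xi
    (fun x hx => by simp [hc.eq_zero x hx, xiComp]) eEta eXi hr fun x hx t ht =>
      box_subset_cube (κ := 7 / 16) (a := 1 / 16) (b := 5 / 16) (by norm_num) (by norm_num)
        (by norm_num) (add_smul_mem_box norm_eXi.le eXi_two ht.1 (by linarith [ht.2]) hx)).trans
    (mul_le_mul_right ?_ _)
  unfold lineEnergy
  exact le_add_right (le_add_left le_rfl)

/-- Outside a small exceptional set there is little slip on the second system, and `u` hardly
changes in direction `e_η`. -/
theorem exists_exceptional_set (hc : Competitor u g β) {r s : ℝ} (hr : 0 < r) (hr1 : r ≤ 1 / 16)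
    (hs : 0 < s) (hs1 : s ≤ 1 / 16) :
    ∃ B ⊆ box (1 / 4) (1 / 8) (1 / 4), MeasurableSet B ∧
      volume B ≤ volume {x ∈ box (1 / 4) (1 / 8) (1 / 4) |
        ∫ t in (0 : ℝ)..r, xiComp (β (x + t • eXi)) < r / 4} +
          4 * ENNReal.ofReal s * lineEnergy 1 β ∧
      ∫⁻ x in box (1 / 4) (1 / 8) (1 / 4) \ B, ‖u (x + s • eEta) - u x‖ₑ ≤
        ENNReal.ofReal s * (∫⁻ x in cube 1, innerError g β x) +
          ENNReal.ofReal s * (ENNReal.ofReal r * lineEnergy 1 β) := by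
  set R := box (1 / 4) (1 / 8) (1 / 4) with hR
  have hRm : MeasurableSet R := measurableSet_box _ _ _
  obtain ⟨W', hW', hW'1, hW'2⟩ := hc.exists_eta_majorant hr hr1
  obtain ⟨W, hW, hW1, hW2⟩ := hc.exists_slip_majorant hr hr1 hs hs1
  set a : E3 → ℝ := fun x => ∫ t in (0 : ℝ)..r, xiComp (β (x + t • eXi)) with ha
  have ham : Measurable a := hc.measurable_average hr.le
  set B₁ := {x ∈ R | a x < r / 4} with hB₁
  set B₂ := {x ∈ R | ENNReal.ofReal (r / 4) ≤ W x} with hB₂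
  have hB₁m : MeasurableSet B₁ := hRm.inter (measurableSet_lt ham measurable_const)
  have hB₂m : MeasurableSet B₂ := hRm.inter (measurableSet_le measurable_const hW)
  have hB₂v : volume B₂ ≤ 4 * ENNReal.ofReal s * lineEnergy 1 β := by
    have h := mul_meas_ge_le_lintegral (μ := volume.restrict R) hW (ENNReal.ofReal (r / 4))
    rw [Measure.restrict_apply (measurableSet_le measurable_const hW), inter_comm] at h
    have h2 := h.trans hW1
    have h3 : ENNReal.ofReal r = ENNReal.ofReal (r / 4) * 4 := by
      rw [show (4 : ℝ≥0∞) = ENNReal.ofReal 4 by simp, ← ENNReal.ofReal_mul (by positivity)]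
      congr 1; ring
    rw [h3, show ENNReal.ofReal s * (ENNReal.ofReal (r / 4) * 4 * lineEnergy 1 β) =
      ENNReal.ofReal (r / 4) * (4 * ENNReal.ofReal s * lineEnergy 1 β) by ring] at h2
    exact (ENNReal.mul_le_mul_iff_right (by simpa using hr) ENNReal.ofReal_ne_top).1 h2
  -- at points outside `B₁` there is slip on the first system close by in direction `e_ξ`, and
  -- outside `B₂` this remains true along the whole segment in direction `e_η`
  refine ⟨B₁ ∪ B₂, union_subset (fun x hx => hx.1) fun x hx => hx.1, hB₁m.union hB₂m,
    (measure_union_le _ _).trans (add_le_add le_rfl hB₂v), ?_⟩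
  have hsh : ∀ x ∈ R, ∀ t ∈ Ioo 0 s, x + t • eEta ∈ box (3 / 8) (1 / 8) (1 / 4) := fun x hx t ht =>
    add_smul_mem_box norm_eEta.le eEta_two ht.1.le (by linarith [ht.2]) hx
  have hbc : box (3 / 8) (1 / 8) (1 / 4) ⊆ cube 1 :=
    box_subset_cube (by norm_num) (by norm_num) (by norm_num)
  set G := innerError g β with hG
  have hGm : Measurable G := hc.measurable_innerError
  have hW'a : ∀ᵐ x, x ∈ box (3 / 8) (1 / 8) (1 / 4) → 0 < a x → ‖etaComp (β x)‖ₑ ≤ W' x :=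
    (ae_restrict_iff' (measurableSet_box _ _ _)).1 hW'2
  have hpt : ∀ᵐ x ∂(volume.restrict (R \ (B₁ ∪ B₂))), ‖u (x + s • eEta) - u x‖ₑ ≤
      (∫⁻ t in Ioo 0 s, G (x + t • eEta)) + ∫⁻ t in Ioo 0 s, W' (x + t • eEta) := by
    filter_upwards [ae_restrict_of_ae (hc.weakGradient.ae_enorm_sub_le eEta hs.le),
      ae_restrict_of_ae (ae_ae_translate hW'a eEta), ae_restrict_mem (hRm.diff (hB₁m.union hB₂m)),
      ae_restrict_of_ae_restrict_of_subset sdiff_subset hW2] with x h1 h2 hx h3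
    refine h1.trans ?_
    have hmt : Measurable fun t : ℝ => G (x + t • eEta) := hGm.comp (by fun_prop)
    rw [← lintegral_add_left hmt]
    refine lintegral_mono_ae ?_
    have hax : r / 4 ≤ a x := not_lt.1 fun h => hx.2 (Or.inl ⟨hx.1, h⟩)
    have hWx : W x < ENNReal.ofReal (r / 4) := not_le.1 fun h => hx.2 (Or.inr ⟨hx.1, h⟩)
    filter_upwards [h3, ae_restrict_of_ae h2, ae_restrict_mem measurableSet_Ioo] with t k1 k2 ht
    have hb := hsh x hx.1 t ht
    have hat : 0 < a (x + t • eEta) := by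
      have k3 : ‖a (x + t • eEta) - a x‖ₑ < ENNReal.ofReal (r / 4) := k1.trans_lt hWx
      rw [Real.enorm_eq_ofReal_abs, ENNReal.ofReal_lt_ofReal_iff (by positivity)] at k3
      have := neg_abs_le (a (x + t • eEta) - a x)
      linarith
    have k4 := k2 hb hat
    refine le_trans ?_ (add_le_add le_rfl k4)
    rw [hG, innerError, indicator_of_mem (hbc hb)]
    have : (inner ℝ (g (x + t • eEta)) eEta : ℝ) =
        inner ℝ (g (x + t • eEta) - β (x + t • eEta)) eEta + etaComp (β (x + t • eEta)) := by
      rw [inner_sub_left, etaComp]; ring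
    rw [this]
    refine (enorm_add_le _ _).trans (add_le_add ?_ le_rfl)
    rw [← ofReal_norm, ← ofReal_norm]
    refine ENNReal.ofReal_le_ofReal ((norm_inner_le_norm _ _).trans ?_)
    rw [norm_eEta, mul_one]
  have hmG : Measurable fun x => ∫⁻ t in Ioo 0 s, G (x + t • eEta) := by
    have : Measurable fun p : E3 × ℝ => G (p.1 + p.2 • eEta) := hGm.comp (by fun_prop)
    exact this.lintegral_prod_right'
  calc ∫⁻ x in R \ (B₁ ∪ B₂), ‖u (x + s • eEta) - u x‖ₑ
      ≤ ∫⁻ x in R \ (B₁ ∪ B₂), ((∫⁻ t in Ioo 0 s, G (x + t • eEta)) +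
          ∫⁻ t in Ioo 0 s, W' (x + t • eEta)) := lintegral_mono_ae hpt
    _ ≤ ∫⁻ x in R, ((∫⁻ t in Ioo 0 s, G (x + t • eEta)) +
          ∫⁻ t in Ioo 0 s, W' (x + t • eEta)) := lintegral_mono_set sdiff_subset
    _ = (∫⁻ x in R, ∫⁻ t in Ioo 0 s, G (x + t • eEta)) +
          ∫⁻ x in R, ∫⁻ t in Ioo 0 s, W' (x + t • eEta) := lintegral_add_left hmG _
    _ ≤ _ := by
      refine add_le_add (setLIntegral_segment_le hGm fun x hx t ht => hbc (hsh x hx t ht)) ?_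
      exact (setLIntegral_segment_le hW' hsh).trans (mul_le_mul_right hW'1 _)

end Competitor

theorem le_ofReal_sqrt {x : ℝ≥0∞} {y : ℝ} (h : x ^ 2 ≤ ENNReal.ofReal y) :
    x ≤ ENNReal.ofReal √y := by
  have hx : x ≠ ⊤ := by
    rintro rfl
    simp at h
  rw [← ENNReal.ofReal_toReal hx] at h ⊢
  refine ENNReal.ofReal_le_ofReal ?_
  rw [← ENNReal.ofReal_pow ENNReal.toReal_nonneg] at h
  by_cases hy : 0 ≤ y
  · exact Real.le_sqrt_of_sq_le ((ENNReal.ofReal_le_ofReal_iff hy).1 h)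
  · rw [ENNReal.ofReal_of_nonpos (not_le.1 hy).le] at h
    have : x.toReal ^ 2 ≤ 0 := ENNReal.ofReal_eq_zero.1 (le_antisymm h zero_le)
    have : x.toReal = 0 := by nlinarith [sq_nonneg x.toReal]
    rw [this]; positivity

namespace Competitor

variable {u : E3 → ℝ} {g β : E3 → E3}

/-- The change of `u` over the fixed distance `1 / 16` is a sum of changes over distance `s`. Since
it is close to that of the far field, the deviation from the far field over distance `s` has to be
large on the exceptional set. -/
theorem oneScale_le (hc : Competitor u g β) {θ : ℝ} (hθ : 0 < θ) {A X V r s b : ℝ}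
    (hX0 : 0 ≤ X) (hV0 : 0 ≤ V) (hA : ∫⁻ x, innerError g β x ^ 2 ≤ ENNReal.ofReal A)
    (hX : ∫⁻ x, outerError θ g x ^ 2 ≤ ENNReal.ofReal X)
    (hV : lineEnergy 1 β ≤ ENNReal.ofReal V) (hA0 : 0 ≤ A)
    (hA1 : A ≤ θ ^ 2 / 2 ^ 26) (hX1 : X ≤ θ ^ 2 / 2 ^ 26) (hr : 0 < r) (hr1 : r ≤ 1 / 16)
    (hrV : r * V ≤ θ / 512) {m : ℕ} (hm : 0 < m) (hms : m * s = 1 / 16)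
    (hb0 : 0 < b) (hb1 : b ≤ 1 / 512)
    (hb : volume {x ∈ box (1 / 4) (1 / 8) (1 / 4) |
        ∫ t in (0 : ℝ)..r, xiComp (β (x + t • eXi)) < r / 4} +
          4 * ENNReal.ofReal s * lineEnergy 1 β ≤ ENNReal.ofReal b) :
    ENNReal.ofReal (θ ^ 2 * s ^ 2 / 2 ^ 18) ≤ ENNReal.ofReal b *
      ∫⁻ x in box (1 / 4) (1 / 8) (1 / 4),
        ‖(u (x + s • eEta) - farField θ (x + s • eEta)) - (u x - farField θ x)‖ₑ ^ 2 := by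
  have hm0 : (0 : ℝ) < m := by exact_mod_cast hm
  have hs : 0 < s := by
    by_contra h
    nlinarith [mul_nonpos_of_nonneg_of_nonpos hm0.le (not_lt.1 h)]
  have hs1 : s ≤ 1 / 16 := by
    rw [← hms]
    have : (1 : ℝ) ≤ m := by exact_mod_cast hm
    nlinarith
  set R := box (1 / 4) (1 / 8) (1 / 4) with hR
  have hRm : MeasurableSet R := measurableSet_box _ _ _
  set R₀ := box (1 / 8) (1 / 8) (1 / 4) with hR₀
  have hR₀m : MeasurableSet R₀ := measurableSet_box _ _ _
  have hR₀v : volume R₀ = ENNReal.ofReal (1 / 128) := by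
    rw [hR₀, volume_box, ← ENNReal.ofReal_mul (by norm_num), ← ENNReal.ofReal_mul (by norm_num)]
    norm_num
  set f : E3 → ℝ := fun x => u x - farField θ x with hf
  have hfm : Measurable f := hc.measurable_u.sub (lipschitz_farField θ).continuous.measurable
  have hum := hc.measurable_u
  change _ ≤ ENNReal.ofReal b * ∫⁻ x in R, ‖f (x + s • eEta) - f x‖ₑ ^ 2
  set J := ∫⁻ x in R, ‖f (x + s • eEta) - f x‖ₑ ^ 2 with hJ
  by_cases hJt : J = ⊤
  · rw [hJt, ENNReal.mul_top (by simpa using hb0)]; exact le_top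
  obtain ⟨B, hBR, hBm, hBv, hBu⟩ := hc.exists_exceptional_set hr hr1 hs hs1
  replace hBv := hBv.trans hb
  have hDu : ∀ (t : ℝ) (x : E3), u (x + t • eEta) - u x = (f (x + t • eEta) - f x) + t * θ :=
    fun t x => by
      simp only [hf, farField_add_smul, inner_farGrad_eEta]; ring
  set j := J.toReal with hj
  have hJj : J = ENNReal.ofReal j := (ENNReal.ofReal_toReal hJt).symm
  have hj0 : 0 ≤ j := ENNReal.toReal_nonneg
  -- the change over distance `s`
  have h1 : ∫⁻ x in R, ‖u (x + s • eEta) - u x‖ₑ ≤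
      ENNReal.ofReal (s * √A + s * (r * V) + (√(b * j) + s * θ * b)) := by
    have hin : ∫⁻ x in cube 1, innerError g β x ≤ ENNReal.ofReal √A := by
      refine le_ofReal_sqrt ((sq_setLIntegral_le hc.measurable_innerError.aemeasurable).trans ?_)
      rw [volume_cube_one, one_mul]
      exact (setLIntegral_le_lintegral _ _).trans hA
    have hBf : ∫⁻ x in B, ‖f (x + s • eEta) - f x‖ₑ ≤ ENNReal.ofReal √(b * j) := by
      refine le_ofReal_sqrt ((sq_setLIntegral_le (by fun_prop)).trans ?_)
      rw [ENNReal.ofReal_mul hb0.le, ← hJj]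
      exact mul_le_mul' hBv (lintegral_mono_set hBR)
    have e1 : ∫⁻ x in B, ‖u (x + s • eEta) - u x‖ₑ ≤ ENNReal.ofReal (√(b * j) + s * θ * b) := by
      calc ∫⁻ x in B, ‖u (x + s • eEta) - u x‖ₑ
          ≤ ∫⁻ x in B, (‖f (x + s • eEta) - f x‖ₑ + ENNReal.ofReal (s * θ)) := by
            refine lintegral_mono fun x => ?_
            rw [hDu]
            refine (enorm_add_le _ _).trans (add_le_add le_rfl (le_of_eq ?_))
            rw [Real.enorm_eq_ofReal (by positivity)]
        _ = (∫⁻ x in B, ‖f (x + s • eEta) - f x‖ₑ) + ENNReal.ofReal (s * θ) * volume B := by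
            rw [lintegral_add_right _ measurable_const, setLIntegral_const]
        _ ≤ ENNReal.ofReal √(b * j) + ENNReal.ofReal (s * θ) * ENNReal.ofReal b := by gcongr
        _ = _ := by
            rw [← ENNReal.ofReal_mul (by positivity), ENNReal.ofReal_add (by positivity)
              (by positivity)]
    have e2 : ∫⁻ x in R \ B, ‖u (x + s • eEta) - u x‖ₑ ≤
        ENNReal.ofReal (s * √A + s * (r * V)) := by
      refine hBu.trans ?_
      rw [ENNReal.ofReal_add (by positivity) (by positivity), ENNReal.ofReal_mul hs.le,
        ENNReal.ofReal_mul hs.le, ENNReal.ofReal_mul hr.le]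
      gcongr
    calc ∫⁻ x in R, ‖u (x + s • eEta) - u x‖ₑ
        ≤ (∫⁻ x in R \ B, ‖u (x + s • eEta) - u x‖ₑ) + ∫⁻ x in B, ‖u (x + s • eEta) - u x‖ₑ := by
          refine le_trans ?_ (lintegral_union_le _ _ _)
          rw [sdiff_union_of_subset hBR]
      _ ≤ _ := by
          refine (add_le_add e2 e1).trans (le_of_eq ?_)
          rw [← ENNReal.ofReal_add (by positivity) (by positivity)]
  -- telescoping
  have h2 : ∫⁻ x in R₀, ‖u (x + (1 / 16 : ℝ) • eEta) - u x‖ₑ ≤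
      m * ∫⁻ x in R, ‖u (x + s • eEta) - u x‖ₑ := by
    have hp : ∀ x, ‖u (x + (1 / 16 : ℝ) • eEta) - u x‖ₑ ≤ ∑ i ∈ Finset.range m,
        ‖u (x + ((i * s : ℝ)) • eEta + s • eEta) - u (x + ((i * s : ℝ)) • eEta)‖ₑ := by
      intro x
      have h := Finset.sum_range_sub (fun i : ℕ => u (x + ((i * s : ℝ)) • eEta)) m
      simp only [Nat.cast_zero, zero_mul, zero_smul, add_zero, hms] at h
      rw [← h]
      refine (enorm_sum_le _ _).trans (le_of_eq (Finset.sum_congr rfl fun i _ => ?_))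
      rw [add_assoc, ← add_smul]
      congr 5
      push_cast; ring
    calc ∫⁻ x in R₀, ‖u (x + (1 / 16 : ℝ) • eEta) - u x‖ₑ
        ≤ ∫⁻ x in R₀, ∑ i ∈ Finset.range m,
          ‖u (x + ((i * s : ℝ)) • eEta + s • eEta) - u (x + ((i * s : ℝ)) • eEta)‖ₑ :=
          lintegral_mono hp
      _ = ∑ i ∈ Finset.range m, ∫⁻ x in R₀,
          ‖u (x + ((i * s : ℝ)) • eEta + s • eEta) - u (x + ((i * s : ℝ)) • eEta)‖ₑ :=
          lintegral_finsetSum _ fun i _ => by fun_prop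
      _ ≤ ∑ i ∈ Finset.range m, ∫⁻ x in R, ‖u (x + s • eEta) - u x‖ₑ := by
          refine Finset.sum_le_sum fun i hi => ?_
          refine lintegral_translate_le (K := R) (fun x hx => ?_)
            (fun y => ‖u (y + s • eEta) - u y‖ₑ)
          refine add_smul_mem_box norm_eEta.le eEta_two (by positivity) ?_ hx
          have : (i : ℝ) ≤ m := by exact_mod_cast (Finset.mem_range.1 hi).le
          nlinarith
      _ = _ := by rw [Finset.sum_const, Finset.card_range, nsmul_eq_mul]
  -- the deviation over distance `1 / 16`
  have h3 : ∫⁻ x in R₀, ‖f (x + (1 / 16 : ℝ) • eEta) - f x‖ₑ ≤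
      ENNReal.ofReal √(1 / 128 * (10 * A + 85 * (1 / 16) * X)) := by
    refine le_ofReal_sqrt ((sq_setLIntegral_le (by fun_prop)).trans ?_)
    rw [hR₀v, ENNReal.ofReal_mul (by norm_num)]
    refine mul_le_mul_right ?_ _
    refine (hc.trace_le θ norm_eEta.le eEta_two (κ := 1 / 8) (by norm_num)
      (by norm_num : (0 : ℝ) < 1 / 16) le_rfl).trans ?_
    rw [ENNReal.ofReal_add (by positivity) (by positivity), ENNReal.ofReal_mul (by norm_num),
      ENNReal.ofReal_mul (by norm_num), ENNReal.ofReal_mul (by norm_num),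
      ENNReal.ofReal_ofNat, ENNReal.ofReal_ofNat]
    gcongr
  have h4 : ENNReal.ofReal (θ / 2048) ≤
      (∫⁻ x in R₀, ‖u (x + (1 / 16 : ℝ) • eEta) - u x‖ₑ) +
        ∫⁻ x in R₀, ‖f (x + (1 / 16 : ℝ) • eEta) - f x‖ₑ := by
    calc ENNReal.ofReal (θ / 2048) = ∫⁻ x in R₀, ENNReal.ofReal (1 / 16 * θ) := by
          rw [setLIntegral_const, hR₀v, ← ENNReal.ofReal_mul (by positivity)]
          congr 1; ring
      _ ≤ ∫⁻ x in R₀, (‖u (x + (1 / 16 : ℝ) • eEta) - u x‖ₑ +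
          ‖f (x + (1 / 16 : ℝ) • eEta) - f x‖ₑ) := by
          refine lintegral_mono fun x => ?_
          rw [← Real.enorm_eq_ofReal (by positivity : (0 : ℝ) ≤ 1 / 16 * θ)]
          have : 1 / 16 * θ = (u (x + (1 / 16 : ℝ) • eEta) - u x) -
            (f (x + (1 / 16 : ℝ) • eEta) - f x) := by rw [hDu]; ring
          rw [this]
          exact enorm_sub_le
      _ = _ := lintegral_add_left (by fun_prop) _
  have h5 : θ / 2048 ≤ m * (s * √A + s * (r * V) + (√(b * j) + s * θ * b)) +
      √(1 / 128 * (10 * A + 85 * (1 / 16) * X)) := by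
    have h := h4.trans (add_le_add (h2.trans (mul_le_mul_right h1 _)) h3)
    rw [← ENNReal.ofReal_natCast, ← ENNReal.ofReal_mul (by positivity),
      ← ENNReal.ofReal_add (by positivity) (by positivity)] at h
    exact (ENNReal.ofReal_le_ofReal_iff (by positivity)).1 h
  -- all terms but the one due to the deviation on the exceptional set can be absorbed
  have h6 : √A ≤ θ / 2 ^ 13 := by
    refine Real.sqrt_le_iff.2 ⟨by positivity, hA1.trans (le_of_eq (by ring))⟩
  have h7 : √(1 / 128 * (10 * A + 85 * (1 / 16) * X)) ≤ θ / 2 ^ 14 := by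
    refine Real.sqrt_le_iff.2 ⟨by positivity, ?_⟩
    have : (θ / 2 ^ 14) ^ 2 = θ ^ 2 / 2 ^ 26 / 4 := by ring
    nlinarith
  have h8 : θ / 2 ^ 13 ≤ m * √(b * j) := by
    have e1 : (m : ℝ) * (s * √A) ≤ 1 / 16 * (θ / 2 ^ 13) := by
      rw [← mul_assoc, hms]; gcongr
    have e2 : (m : ℝ) * (s * (r * V)) ≤ 1 / 16 * (θ / 512) := by
      rw [← mul_assoc, hms]; gcongr
    have e3 : (m : ℝ) * (s * θ * b) ≤ 1 / 16 * (θ * (1 / 512)) := by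
      rw [mul_assoc, ← mul_assoc, hms]; gcongr
    rw [mul_add, mul_add, mul_add] at h5
    linarith
  have h9 : θ ^ 2 * s ^ 2 / 2 ^ 18 ≤ b * j := by
    have hsq : (θ / 2 ^ 13) ^ 2 ≤ m ^ 2 * (b * j) := by
      calc (θ / 2 ^ 13) ^ 2 ≤ (m * √(b * j)) ^ 2 := by gcongr
        _ = _ := by rw [mul_pow, Real.sq_sqrt (by positivity)]
    have hs2 : s ^ 2 * m ^ 2 = 1 / 256 := by rw [← mul_pow, mul_comm, hms]; norm_num
    have : s ^ 2 * (θ / 2 ^ 13) ^ 2 ≤ 1 / 256 * (b * j) := by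
      rw [← hs2, mul_assoc]; gcongr
    nlinarith
  rw [hJj, ← ENNReal.ofReal_mul hb0.le]
  exact ENNReal.ofReal_le_ofReal h9

end Competitor

theorem sum_inv_scale_le {h : ℝ} (hh : 0 < h) {N : ℕ} (hN : 0 < N) :
    ∑ n ∈ Finset.range N, (ENNReal.ofReal (h / 4 ^ n))⁻¹ ≤
      ENNReal.ofReal (7 / 5 * (4 ^ (N - 1) / h)) := by
  have e : ∀ n : ℕ, (ENNReal.ofReal (h / 4 ^ n))⁻¹ = ENNReal.ofReal (4 ^ n / h) := fun n => by
    rw [← ENNReal.ofReal_inv_of_pos (by positivity), inv_div]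
  simp only [e]
  rw [← ENNReal.ofReal_sum_of_nonneg (fun i _ => by positivity), ← Finset.sum_div,
    geom_sum_eq (by norm_num)]
  refine ENNReal.ofReal_le_ofReal ?_
  obtain ⟨k, rfl⟩ := Nat.exists_eq_succ_of_ne_zero hN.ne'
  rw [Nat.succ_sub_one, Nat.succ_eq_add_one, ← mul_div_assoc]
  gcongr
  rw [pow_succ]
  linarith [pow_pos (by norm_num : (0 : ℝ) < 4) k]

namespace Competitor

variable {u : E3 → ℝ} {g β : E3 → E3}

/-- Summing `oneScale_le` over the scales `h / 4 ^ n`, `n < N`, each of which contributes the same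
amount, and comparing with the trace estimate. -/
theorem multiscale_le (hc : Competitor u g β) {θ : ℝ} (hθ : 0 < θ) (hθ1 : θ ≤ 1 / 2)
    {A X V r h : ℝ} (hX0 : 0 ≤ X) (hV0 : 0 ≤ V)
    (hA : ∫⁻ x, innerError g β x ^ 2 ≤ ENNReal.ofReal A)
    (hX : ∫⁻ x, outerError θ g x ^ 2 ≤ ENNReal.ofReal X)
    (hV : lineEnergy 1 β ≤ ENNReal.ofReal V) (hA0 : 0 ≤ A)
    (hA1 : A ≤ θ ^ 2 / 2 ^ 26) (hX1 : X ≤ θ ^ 2 / 2 ^ 26) (hr : 0 < r) (hr1 : r ≤ 1 / 16)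
    (hrV : r * V ≤ θ / 512) {q N : ℕ} (hN : 0 < N) (hh : 4 ^ q * h = 1 / 16)
    (hVh : V * h ≤ 1 / 2 ^ 12)
    (hp : 3000 * (A / r ^ 2 + X / r + A) * 4 ^ (N - 1) ≤ 1 / 2 ^ 12) :
    N * (θ ^ 2 * h / 320) ≤ 14 * A * (4 ^ (N - 1) / h) + 85 * X := by
  have h0 : 0 < h := by
    by_contra hn
    have : (0 : ℝ) < 4 ^ q := by positivity
    nlinarith [mul_nonpos_of_nonneg_of_nonpos this.le (not_lt.1 hn)]
  have h1 : h ≤ 1 / 16 := by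
    rw [← hh]
    have : (1 : ℝ) ≤ 4 ^ q := one_le_pow₀ (by norm_num)
    nlinarith
  set p := 3000 * (A / r ^ 2 + X / r + A) with hpdef
  have hp0 : 0 ≤ p := by positivity
  have hsmall : volume {x ∈ box (1 / 4) (1 / 8) (1 / 4) |
      ∫ t in (0 : ℝ)..r, xiComp (β (x + t • eXi)) < r / 4} ≤ ENNReal.ofReal p := by
    have k := hc.measure_smallSlip_le hθ1 hr hr1
    have k2 : ENNReal.ofReal (r ^ 2) * volume {x ∈ box (1 / 4) (1 / 8) (1 / 4) |
        ∫ t in (0 : ℝ)..r, xiComp (β (x + t • eXi)) < r / 4} ≤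
        ENNReal.ofReal (r ^ 2) * ENNReal.ofReal p := by
      refine k.trans ?_
      calc _ ≤ 32 * (10 * ENNReal.ofReal A + 85 * ENNReal.ofReal r * ENNReal.ofReal X +
            ENNReal.ofReal (r ^ 2) * ENNReal.ofReal A) := by gcongr
        _ = ENNReal.ofReal (32 * (10 * A + 85 * r * X + r ^ 2 * A)) := by
            rw [ENNReal.ofReal_mul (by norm_num),
              ENNReal.ofReal_add (by positivity) (by positivity),
              ENNReal.ofReal_add (by positivity) (by positivity), ENNReal.ofReal_mul (by norm_num),
              ENNReal.ofReal_mul (by positivity), ENNReal.ofReal_mul (by positivity),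
              ENNReal.ofReal_mul (by positivity)]
            simp only [ENNReal.ofReal_ofNat]
        _ ≤ _ := by
            rw [← ENNReal.ofReal_mul (by positivity)]
            refine ENNReal.ofReal_le_ofReal ?_
            have : r ^ 2 * p = 3000 * (A + r * X + r ^ 2 * A) := by
              rw [hpdef]; field_simp
            rw [this]
            nlinarith [mul_nonneg hr.le hX0, mul_nonneg (sq_nonneg r) hA0]
    exact (ENNReal.mul_le_mul_iff_right (by simpa using hr.ne') ENNReal.ofReal_ne_top).1 k2
  have hterm : ∀ n ∈ Finset.range N, ENNReal.ofReal (θ ^ 2 * h / 320) ≤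
      (ENNReal.ofReal (h / 4 ^ n))⁻¹ * ∫⁻ x in box (1 / 4) (1 / 8) (1 / 4),
        ‖(u (x + (h / 4 ^ n) • eEta) - farField θ (x + (h / 4 ^ n) • eEta)) -
          (u x - farField θ x)‖ₑ ^ 2 := by
    intro n hn
    have hnN : n ≤ N - 1 := Nat.le_pred_of_lt (Finset.mem_range.1 hn)
    have h4n : (0 : ℝ) < 4 ^ n := by positivity
    have hb : volume {x ∈ box (1 / 4) (1 / 8) (1 / 4) |
        ∫ t in (0 : ℝ)..r, xiComp (β (x + t • eXi)) < r / 4} +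
          4 * ENNReal.ofReal (h / 4 ^ n) * lineEnergy 1 β ≤
            ENNReal.ofReal (5 / 2 ^ 12 / 4 ^ n) := by
      calc _ ≤ ENNReal.ofReal p + 4 * ENNReal.ofReal (h / 4 ^ n) * ENNReal.ofReal V := by gcongr
        _ = ENNReal.ofReal (p + 4 * (h / 4 ^ n) * V) := by
            rw [ENNReal.ofReal_add hp0 (by positivity),
              ENNReal.ofReal_mul (p := 4 * (h / 4 ^ n)) (by positivity),
              ENNReal.ofReal_mul (p := 4) (by norm_num), ENNReal.ofReal_ofNat]
        _ ≤ _ := by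
            refine ENNReal.ofReal_le_ofReal ?_
            rw [le_div_iff₀ h4n]
            have e1 : p * 4 ^ n ≤ 1 / 2 ^ 12 := by
              refine le_trans ?_ hp
              gcongr
              norm_num
            have e2 : 4 * (h / 4 ^ n) * V * 4 ^ n = 4 * (V * h) := by field_simp
            rw [add_mul, e2]
            linarith
    have hone := hc.oneScale_le hθ hX0 hV0 hA hX hV hA0 hA1 hX1 hr hr1 hrV (s := h / 4 ^ n)
      (m := 4 ^ (q + n)) (by positivity)
      (by push_cast; rw [pow_add, ← hh]; field_simp) (b := 5 / 2 ^ 12 / 4 ^ n) (by positivity)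
      (by
        rw [div_le_iff₀ h4n]
        have : (1 : ℝ) ≤ 4 ^ n := one_le_pow₀ (by norm_num)
        linarith) hb
    set J := ∫⁻ x in box (1 / 4) (1 / 8) (1 / 4),
        ‖(u (x + (h / 4 ^ n) • eEta) - farField θ (x + (h / 4 ^ n) • eEta)) -
          (u x - farField θ x)‖ₑ ^ 2 with hJ
    have hpos : ENNReal.ofReal (5 / 2 ^ 12 / 4 ^ n * (h / 4 ^ n)) ≠ 0 := by
      rw [Ne, ENNReal.ofReal_eq_zero, not_le]; positivity
    refine (ENNReal.mul_le_mul_iff_right hpos ENNReal.ofReal_ne_top).1 ?_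
    calc ENNReal.ofReal (5 / 2 ^ 12 / 4 ^ n * (h / 4 ^ n)) * ENNReal.ofReal (θ ^ 2 * h / 320)
        = ENNReal.ofReal (θ ^ 2 * (h / 4 ^ n) ^ 2 / 2 ^ 18) := by
          rw [← ENNReal.ofReal_mul (by positivity)]
          congr 1
          field_simp
          norm_num
      _ ≤ ENNReal.ofReal (5 / 2 ^ 12 / 4 ^ n) * J := hone
      _ = _ := by
          have hs : ENNReal.ofReal (h / 4 ^ n) ≠ 0 := by
            rw [Ne, ENNReal.ofReal_eq_zero, not_le]; positivity
          rw [ENNReal.ofReal_mul (by positivity), mul_assoc,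
            ← mul_assoc (ENNReal.ofReal (h / 4 ^ n)),
            ENNReal.mul_inv_cancel hs ENNReal.ofReal_ne_top, one_mul]
  have hsum := (Finset.sum_le_sum hterm).trans
    (hc.sum_trace_le θ norm_eEta.le eEta_two (κ := 1 / 4) (by norm_num) h0 h1 N)
  rw [Finset.sum_const, Finset.card_range, nsmul_eq_mul] at hsum
  have hfin : ENNReal.ofReal (N * (θ ^ 2 * h / 320)) ≤
      ENNReal.ofReal (14 * A * (4 ^ (N - 1) / h) + 85 * X) := by
    calc ENNReal.ofReal (N * (θ ^ 2 * h / 320)) = N * ENNReal.ofReal (θ ^ 2 * h / 320) := by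
          rw [ENNReal.ofReal_mul (by positivity), ENNReal.ofReal_natCast]
      _ ≤ _ := hsum
      _ ≤ 10 * ENNReal.ofReal (7 / 5 * (4 ^ (N - 1) / h)) * ENNReal.ofReal A +
          85 * ENNReal.ofReal X := by
          gcongr
          exact sum_inv_scale_le h0 hN
      _ = ENNReal.ofReal (10 * (7 / 5 * (4 ^ (N - 1) / h)) * A + 85 * X) := by
          rw [ENNReal.ofReal_add (by positivity) (by positivity),
            ENNReal.ofReal_mul (p := 10 * (7 / 5 * (4 ^ (N - 1) / h))) (by positivity),
            ENNReal.ofReal_mul (p := 10) (by norm_num), ENNReal.ofReal_mul (p := 85) (by norm_num)]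
          simp only [ENNReal.ofReal_ofNat]
      _ = _ := by congr 1; ring
  exact (ENNReal.ofReal_le_ofReal_iff (by positivity)).1 hfin

end Competitor

/-! ### The choice of the scales -/

/-- Every length below `1/16` is comparable to one of the form `4⁻ᑫ / 16`. -/
theorem exists_scale {y : ℝ} (hy : 0 < y) (hy1 : y < 1 / 16) :
    ∃ q : ℕ, (1 / 16 : ℝ) / 4 ^ q ≤ y ∧ y < 4 * ((1 / 16 : ℝ) / 4 ^ q) := by
  have hex : ∃ q : ℕ, (1 / 16 : ℝ) / 4 ^ q ≤ y := by
    obtain ⟨q, hq⟩ := pow_unbounded_of_one_lt (1 / (16 * y)) (by norm_num : (1 : ℝ) < 4)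
    refine ⟨q, ?_⟩
    rw [div_lt_iff₀ (by positivity)] at hq
    rw [div_le_iff₀ (by positivity)]
    linarith
  classical
  refine ⟨Nat.find hex, Nat.find_spec hex, ?_⟩
  rcases Nat.eq_zero_or_pos (Nat.find hex) with h | h
  · rw [h]; norm_num; linarith
  · have h2 := Nat.find_min hex (Nat.sub_lt h one_pos)
    rw [not_le] at h2
    refine h2.trans_le (le_of_eq ?_)
    obtain ⟨k, hk⟩ := Nat.exists_eq_succ_of_ne_zero h.ne'
    rw [hk, Nat.succ_sub_one, Nat.succ_eq_add_one, pow_succ]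
    field_simp

/-- The multiscale inequality cannot hold for an energy `θ² F` below the thresholds. Here `r` is
the length over which the first slip system is averaged, and `h` is the largest length scale: either
`1 / 16` or comparable to `e / F`. -/
theorem Competitor.false_of_small {u : E3 → ℝ} {g β : E3 → E3} (hc : Competitor u g β)
    {θ F e μ : ℝ} (hθ : 0 < θ) (hθ1 : θ ≤ 1 / 2) (hF : 0 < F) (he : 0 < e) (hμ : 0 < μ)
    (hA : ∫⁻ x, innerError g β x ^ 2 ≤ ENNReal.ofReal (θ ^ 2 * F))
    (hX : ∫⁻ x, outerError θ g x ^ 2 ≤ ENNReal.ofReal (θ ^ 2 * (F / μ)))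
    (hV : lineEnergy 1 β ≤ ENNReal.ofReal (F / e))
    (hF1 : F ≤ 1 / 2 ^ 40) (hFμ : F / μ ≤ 1 / 2 ^ 40) {N : ℕ} (hN : 0 < N)
    (h1 : F ^ 3 / e ^ 2 * 4 ^ (N - 1) ≤ 16 / 2 ^ 120) (h2 : F ^ 2 / (e * μ) ≤ 16 / 2 ^ 80 * N)
    (h3 : θ ^ 2 * 4 ^ (N - 1) ≤ 1) (h4 : θ * (F ^ 2 / (e * μ)) * 4 ^ (N - 1) ≤ 8 / 2 ^ 80) :
    False := by
  -- the largest length for which `r` times the line energy is small compared to `θ`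
  set r := min (1 / 16) (θ * e / (512 * F)) with hr
  have hr0 : 0 < r := by positivity
  have hr1 : r ≤ 1 / 16 := min_le_left _ _
  have hrV : r * (F / e) ≤ θ / 512 := by
    calc r * (F / e) ≤ θ * e / (512 * F) * (F / e) := by gcongr; exact min_le_right _ _
      _ = θ / 512 := by field_simp
  have hA0 : 0 ≤ θ ^ 2 * F := by positivity
  have hX0 : 0 ≤ θ ^ 2 * (F / μ) := by positivity
  have hV0 : 0 ≤ F / e := by positivity
  have hA1 : θ ^ 2 * F ≤ θ ^ 2 / 2 ^ 26 := by
    rw [div_eq_mul_one_div]; gcongr; exact hF1.trans (by norm_num)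
  have hX1 : θ ^ 2 * (F / μ) ≤ θ ^ 2 / 2 ^ 26 := by
    calc θ ^ 2 * (F / μ) ≤ θ ^ 2 * (1 / 2 ^ 26) := by
          have : F / μ ≤ 1 / 2 ^ 26 := hFμ.trans (by norm_num)
          gcongr
      _ = _ := by ring
  have hrinv : 1 / r ≤ 16 + 512 * F / (θ * e) := by
    rcases min_choice (1 / 16 : ℝ) (θ * e / (512 * F)) with h | h
    · rw [hr, h]
      have : 0 ≤ 512 * F / (θ * e) := by positivity
      norm_num; linarith
    · rw [hr, h, one_div_div]
      linarith
  have hp : 3000 * (θ ^ 2 * F / r ^ 2 + θ ^ 2 * (F / μ) / r + θ ^ 2 * F) * 4 ^ (N - 1) ≤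
      1 / 2 ^ 12 := by
    set P : ℝ := 4 ^ (N - 1) with hP
    have hP0 : 0 < P := by positivity
    have e1 : θ ^ 2 * F / r ^ 2 * P ≤ 512 * F + 2 ^ 19 * (F ^ 3 / e ^ 2 * P) := by
      calc θ ^ 2 * F / r ^ 2 * P = θ ^ 2 * F * P * (1 / r) ^ 2 := by field_simp
        _ ≤ θ ^ 2 * F * P * (16 + 512 * F / (θ * e)) ^ 2 := by gcongr
        _ ≤ θ ^ 2 * F * P * (2 * (16 ^ 2 + (512 * F / (θ * e)) ^ 2)) := by
            gcongr; exact _root_.add_sq_le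
        _ = 512 * F * (θ ^ 2 * P) + 2 ^ 19 * (F ^ 3 / e ^ 2 * P) := by field_simp; ring
        _ ≤ 512 * F * 1 + 2 ^ 19 * (F ^ 3 / e ^ 2 * P) := by gcongr
        _ = _ := by ring
    have e2 : θ ^ 2 * (F / μ) / r * P ≤ 16 * (F / μ) + 512 * (θ * (F ^ 2 / (e * μ)) * P) := by
      calc θ ^ 2 * (F / μ) / r * P = θ ^ 2 * (F / μ) * P * (1 / r) := by field_simp
        _ ≤ θ ^ 2 * (F / μ) * P * (16 + 512 * F / (θ * e)) := by gcongr
        _ = 16 * (F / μ) * (θ ^ 2 * P) + 512 * (θ * (F ^ 2 / (e * μ)) * P) := by field_simp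
        _ ≤ 16 * (F / μ) * 1 + 512 * (θ * (F ^ 2 / (e * μ)) * P) := by gcongr
        _ = _ := by ring
    have e3 : θ ^ 2 * F * P ≤ F := by
      calc θ ^ 2 * F * P = F * (θ ^ 2 * P) := by ring
        _ ≤ F * 1 := by gcongr
        _ = F := mul_one F
    calc _ = 3000 * (θ ^ 2 * F / r ^ 2 * P + θ ^ 2 * (F / μ) / r * P + θ ^ 2 * F * P) := by ring
      _ ≤ 3000 * ((512 * (1 / 2 ^ 40) + 2 ^ 19 * (16 / 2 ^ 120)) +
          (16 * (1 / 2 ^ 40) + 512 * (8 / 2 ^ 80)) + 1 / 2 ^ 40) := by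
          gcongr
          · exact e1.trans (by gcongr)
          · exact e2.trans (by gcongr)
          · exact e3.trans hF1
      _ ≤ _ := by norm_num
  have hθ2 : 0 < θ ^ 2 := by positivity
  rcases le_or_gt (F / e) (1 / 2 ^ 8) with hcase | hcase
  · -- the line energy is small, and the single scale `1 / 16` leads to a contradiction
    have h := hc.multiscale_le hθ hθ1 hX0 hV0 hA hX hV hA0 hA1 hX1 hr0 hr1 hrV (q := 0) (N := 1)
      (h := 1 / 16) one_pos (by norm_num) (by linarith) (by
        refine le_trans ?_ hp
        gcongr
        · norm_num
        · exact hN)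
    norm_num at h
    have h5 : θ ^ 2 * F ≤ θ ^ 2 * (1 / 2 ^ 40) := by gcongr
    have h6 : θ ^ 2 * (F / μ) ≤ θ ^ 2 * (1 / 2 ^ 40) := by gcongr
    norm_num at h5 h6
    linarith
  · -- the largest scale `h` at which the line energy times `h` is small is of order `e / F`
    have hy : e / F / 2 ^ 12 < 1 / 16 := by
      rw [lt_div_iff₀ he] at hcase
      rw [div_div, div_lt_iff₀ (by positivity)]
      linarith
    obtain ⟨q, hq1, hq2⟩ := exists_scale (by positivity : 0 < e / F / 2 ^ 12) hy
    set h : ℝ := 1 / 16 / 4 ^ q with hh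
    have hh0 : 0 < h := by positivity
    have k := hc.multiscale_le hθ hθ1 hX0 hV0 hA hX hV hA0 hA1 hX1 hr0 hr1 hrV (q := q) (N := N)
      (h := h) hN (by rw [hh]; field_simp) (by
        calc F / e * h ≤ F / e * (e / F / 2 ^ 12) := by gcongr
          _ = 1 / 2 ^ 12 := by field_simp) hp
    set P : ℝ := 4 ^ (N - 1) with hP
    have hP0 : 0 < P := by positivity
    have k2 : N * h ^ 2 / 320 ≤ 14 * F * P + 85 * (F / μ) * h := by
      have : N * (θ ^ 2 * h / 320) * h = θ ^ 2 * (N * h ^ 2 / 320) := by ring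
      have e2 : (14 * (θ ^ 2 * F) * (P / h) + 85 * (θ ^ 2 * (F / μ))) * h =
        θ ^ 2 * (14 * F * P + 85 * (F / μ) * h) := by field_simp
      have k3 := mul_le_mul_of_nonneg_right k hh0.le
      rw [this, e2] at k3
      exact le_of_mul_le_mul_left k3 hθ2
    have k4 : N * (e / F / 2 ^ 14) ^ 2 / 320 ≤ 14 * F * P + 85 * (F / μ) * (e / F / 2 ^ 12) := by
      refine le_trans ?_ (k2.trans ?_)
      · have : e / F / 2 ^ 14 ≤ h := by linarith
        gcongr
      · gcongr
    have k5 : (N : ℝ) ≤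
        2 ^ 28 * 320 * (14 * (F ^ 3 / e ^ 2 * P) + 85 / 2 ^ 12 * (F ^ 2 / (e * μ))) := by
      have e1 : N * (e / F / 2 ^ 14) ^ 2 / 320 * (F ^ 2 / e ^ 2 * (2 ^ 28 * 320)) = N := by
        field_simp
      rw [← e1]
      refine (mul_le_mul_of_nonneg_right k4 (by positivity)).trans (le_of_eq ?_)
      field_simp
    have hN1 : (1 : ℝ) ≤ N := by exact_mod_cast hN
    have k6 : (N : ℝ) ≤ 2 ^ 28 * 320 * (14 * (16 / 2 ^ 120) + 85 / 2 ^ 12 * (16 / 2 ^ 80 * N)) := by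
      refine k5.trans ?_
      gcongr
    norm_num at k6
    linarith

theorem scalingMin_pos {e μ θ : ℝ} (he : 0 < e) (hμ : 0 < μ) (hθ : 0 < θ) (hθ1 : θ ≤ 1 / 2) :
    0 < scalingMin e μ θ := by
  have h1 : 0 < Real.log (1 / θ) := Real.log_pos (by rw [lt_div_iff₀ hθ]; linarith)
  have h2 : 0 < Real.log (3 + e / μ ^ 3) := Real.log_pos (by
    have : 0 < e / μ ^ 3 := by positivity
    linarith)
  unfold scalingMin
  positivity

/-- The number of scales `N`, of the order of the logarithm in the scaling law. -/
theorem exists_number_of_scales {e μ θ F : ℝ} (he : 0 < e) (hμ : 0 < μ) (hθ : 0 < θ)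
    (hθ1 : θ ≤ 1 / 2) (hF : F = 1 / 2 ^ 40 * scalingMin e μ θ) :
    ∃ N : ℕ, 0 < N ∧ F ^ 3 / e ^ 2 * 4 ^ (N - 1) ≤ 16 / 2 ^ 120 ∧
      F ^ 2 / (e * μ) ≤ 16 / 2 ^ 80 * N ∧ θ ^ 2 * 4 ^ (N - 1) ≤ 1 ∧
      θ * (F ^ 2 / (e * μ)) * 4 ^ (N - 1) ≤ 8 / 2 ^ 80 := by
  have hM := scalingMin_pos he hμ hθ hθ1
  have hF0 : 0 < F := by rw [hF]; positivity
  have hl1 : 0 < Real.log (1 / θ) := Real.log_pos (by rw [lt_div_iff₀ hθ]; linarith)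
  have hl2 : 0 < Real.log (3 + e / μ ^ 3) := Real.log_pos (by
    have : 0 < e / μ ^ 3 := by positivity
    linarith)
  have hM1 : scalingMin e μ θ ≤ e ^ (2 / 3 : ℝ) := min_le_left _ _
  have hM2 : scalingMin e μ θ ≤ (e * μ) ^ (1 / 2 : ℝ) * Real.log (3 + e / μ ^ 3) ^ (1 / 2 : ℝ) :=
    (min_le_right _ _).trans (min_le_left _ _)
  have hM3 : scalingMin e μ θ ≤ (e * μ) ^ (1 / 2 : ℝ) * Real.log (1 / θ) ^ (1 / 2 : ℝ) :=
    (min_le_right _ _).trans ((min_le_right _ _).trans (min_le_left _ _))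
  have hcube : F ^ 3 / e ^ 2 ≤ 1 / 2 ^ 120 := by
    have h : scalingMin e μ θ ^ 3 ≤ e ^ 2 := by
      calc scalingMin e μ θ ^ 3 ≤ (e ^ (2 / 3 : ℝ)) ^ 3 := by gcongr
        _ = e ^ 2 := by
          rw [← Real.rpow_natCast, ← Real.rpow_mul he.le]; norm_num
    rw [div_le_iff₀ (by positivity), hF, mul_pow]
    nlinarith
  have hsq : ∀ l : ℝ, 0 < l → scalingMin e μ θ ≤ (e * μ) ^ (1 / 2 : ℝ) * l ^ (1 / 2 : ℝ) →
      F ^ 2 / (e * μ) ≤ 1 / 2 ^ 80 * l := by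
    intro l hl h
    have h2 : scalingMin e μ θ ^ 2 ≤ e * μ * l := by
      calc scalingMin e μ θ ^ 2 ≤ ((e * μ) ^ (1 / 2 : ℝ) * l ^ (1 / 2 : ℝ)) ^ 2 := by gcongr
        _ = e * μ * l := by
          rw [mul_pow, ← Real.sqrt_eq_rpow, ← Real.sqrt_eq_rpow, Real.sq_sqrt (by positivity),
            Real.sq_sqrt hl.le]
    rw [div_le_iff₀ (by positivity), hF, mul_pow]
    nlinarith
  set l := min (Real.log (3 + e / μ ^ 3)) (Real.log (1 / θ)) with hl
  have hl0 : 0 < l := lt_min hl2 hl1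
  have hFl : F ^ 2 / (e * μ) ≤ 1 / 2 ^ 80 * l := by
    rcases min_choice (Real.log (3 + e / μ ^ 3)) (Real.log (1 / θ)) with h | h
    · rw [hl, h]; exact hsq _ hl2 hM2
    · rw [hl, h]; exact hsq _ hl1 hM3
  have hexpθ : Real.exp l * θ ≤ 1 := by
    have : Real.exp l ≤ 1 / θ := by
      rw [← Real.exp_log (by positivity : 0 < 1 / θ)]
      exact Real.exp_le_exp.2 (min_le_right _ _)
    rwa [le_div_iff₀ hθ] at this
  have hexp1 : Real.exp l ≤ 3 + e / μ ^ 3 := by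
    rw [← Real.exp_log (by positivity : 0 < 3 + e / μ ^ 3)]
    exact Real.exp_le_exp.2 (min_le_left _ _)
  have hlexp : l ≤ Real.exp l := by linarith [Real.add_one_le_exp l]
  rcases le_or_gt l 16 with hcase | hcase
  · refine ⟨1, one_pos, ?_, ?_, ?_, ?_⟩
    · simp only [Nat.sub_self, pow_zero, mul_one]
      exact hcube.trans (by norm_num)
    · push_cast; linarith
    · simp only [Nat.sub_self, pow_zero, mul_one]
      nlinarith
    · simp only [Nat.sub_self, pow_zero, mul_one]
      calc θ * (F ^ 2 / (e * μ)) ≤ θ * (1 / 2 ^ 80 * Real.exp l) := by gcongr; linarith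
        _ = 1 / 2 ^ 80 * (Real.exp l * θ) := by ring
        _ ≤ 1 / 2 ^ 80 * 1 := by gcongr
        _ ≤ _ := by norm_num
  · -- the factor `16` makes `4 ^ (N - 1)` a small power of `1 / θ` and of `3 + e / μ ^ 3`
    refine ⟨⌊l / 16⌋₊ + 1, Nat.succ_pos _, ?_⟩
    have hP : (4 : ℝ) ^ ⌊l / 16⌋₊ ≤ Real.exp (l / 8) := by
      calc (4 : ℝ) ^ ⌊l / 16⌋₊ ≤ (Real.exp 2) ^ ⌊l / 16⌋₊ := by
            gcongr
            have := Real.add_one_le_exp (1 : ℝ)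
            have h2 : Real.exp 2 = Real.exp 1 * Real.exp 1 := by rw [← Real.exp_add]; norm_num
            nlinarith
        _ = Real.exp (⌊l / 16⌋₊ * 2) := by rw [← Real.exp_nat_mul]
        _ ≤ _ := by
            refine Real.exp_le_exp.2 ?_
            have := Nat.floor_le (by positivity : 0 ≤ l / 16)
            linarith
    rw [Nat.add_sub_cancel]
    set P : ℝ := 4 ^ ⌊l / 16⌋₊ with hPd
    have hP0 : 0 < P := by positivity
    set E := Real.exp (l / 8) with hE
    have hE0 : 0 < E := Real.exp_pos _
    have hE1 : 1 ≤ E := Real.one_le_exp (by positivity)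
    have hE8 : Real.exp l = E ^ 8 := by rw [hE, ← Real.exp_nat_mul]; congr 1; push_cast; ring
    have hl8 : l ≤ 8 * E := by linarith [Real.add_one_le_exp (l / 8)]
    have hl4 : l ≤ 4 * E ^ 2 := by
      have h := Real.add_one_le_exp (l / 4)
      have : Real.exp (l / 4) = E ^ 2 := by rw [hE, ← Real.exp_nat_mul]; congr 1; push_cast; ring
      linarith
    rw [hE8] at hexpθ hexp1
    have hEθ : E ^ 2 * θ ≤ 1 := by
      refine le_trans ?_ hexpθ
      gcongr
      norm_num
    refine ⟨?_, ?_, ?_, ?_⟩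
    · -- compare squares, so that only integer powers occur
      have hbig : E ^ 8 ≤ 4 * (e / μ ^ 3) := by
        have : 8 ≤ E ^ 8 := by
          rw [← hE8]
          linarith [Real.add_one_le_exp l]
        linarith
      have hμe : μ ^ 3 / e * E ^ 8 ≤ 4 := by
        calc μ ^ 3 / e * E ^ 8 ≤ μ ^ 3 / e * (4 * (e / μ ^ 3)) := by gcongr
          _ = 4 := by field_simp
      have h6 : (F ^ 3 / e ^ 2 * P) ^ 2 ≤ (16 / 2 ^ 120) ^ 2 := by
        calc (F ^ 3 / e ^ 2 * P) ^ 2 = (F ^ 2 / (e * μ)) ^ 3 * (μ ^ 3 / e) * P ^ 2 := by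
              field_simp
          _ ≤ (1 / 2 ^ 80 * l) ^ 3 * (μ ^ 3 / e) * E ^ 2 := by gcongr
          _ ≤ (1 / 2 ^ 80 * (4 * E ^ 2)) ^ 3 * (μ ^ 3 / e) * E ^ 2 := by gcongr
          _ = 64 / 2 ^ 240 * (μ ^ 3 / e * E ^ 8) := by ring
          _ ≤ 64 / 2 ^ 240 * 4 := by gcongr
          _ ≤ _ := by norm_num
      exact (pow_le_pow_iff_left₀ (by positivity) (by positivity) two_ne_zero).1 h6
    · have := Nat.lt_floor_add_one (l / 16)
      push_cast
      linarith
    · calc θ ^ 2 * P ≤ θ ^ 2 * E := by gcongr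
        _ ≤ θ * (θ * E ^ 2) := by
          rw [sq, mul_assoc]; gcongr; nlinarith
        _ ≤ 1 := by
          rw [mul_comm θ (E ^ 2)]
          nlinarith
    · calc θ * (F ^ 2 / (e * μ)) * P ≤ θ * (1 / 2 ^ 80 * (8 * E)) * E := by gcongr; linarith
        _ = 8 / 2 ^ 80 * (E ^ 2 * θ) := by ring
        _ ≤ 8 / 2 ^ 80 * 1 := by gcongr
        _ = _ := mul_one _

/-! ### Passing to measurable representatives -/

theorem dirVariation_congr {U : Set E3} {v : E3} {f₁ f₂ : E3 → ℝ}
    (h : f₁ =ᵐ[volume.restrict U] f₂) : dirVariation U v f₁ = dirVariation U v f₂ := by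
  unfold dirVariation
  refine iSup_congr fun φ => iSup_congr fun _ => ?_
  congr 1
  refine integral_congr_ae ?_
  filter_upwards [h] with x hx
  rw [hx]

theorem lineEnergy_congr {L : ℝ} {β₁ β₂ : E3 → E3} (h : β₁ =ᵐ[volume.restrict (cube L)] β₂) :
    lineEnergy L β₁ = lineEnergy L β₂ := by
  have h1 : (fun x => xiComp (β₁ x)) =ᵐ[volume.restrict (cube L)] fun x => xiComp (β₂ x) :=
    h.fun_comp xiComp
  have h2 : (fun x => etaComp (β₁ x)) =ᵐ[volume.restrict (cube L)] fun x => etaComp (β₂ x) :=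
    h.fun_comp etaComp
  simp only [lineEnergy, dirVariation_congr h1, dirVariation_congr h2]

theorem HasWeakGradient.congr {u₁ u₂ : E3 → ℝ} {g₁ g₂ : E3 → E3} (h : HasWeakGradient u₁ g₁)
    (hu : u₁ =ᵐ[volume] u₂) (hg : g₁ =ᵐ[volume] g₂) : HasWeakGradient u₂ g₂ := by
  refine ⟨h.1.congr hu, h.2.1.congr hg, fun φ hφ hc v => ?_⟩
  have e1 : ∫ x, u₂ x * fderiv ℝ φ x v = ∫ x, u₁ x * fderiv ℝ φ x v :=
    integral_congr_ae (by filter_upwards [hu] with x hx; rw [hx])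
  have e2 : ∫ x, inner ℝ (g₂ x) v * φ x = ∫ x, inner ℝ (g₁ x) v * φ x :=
    integral_congr_ae (by filter_upwards [hg] with x hx; rw [hx])
  rw [e1, e2, h.2.2 φ hφ hc v]

/-- The lower bound on the unit cube. -/
theorem lower_bound_unit {ε μ θ : ℝ} (hε : 0 < ε) (hμ : 0 < μ) (hθ : 0 < θ) (hθ1 : θ ≤ 1 / 2) :
    ENNReal.ofReal (θ ^ 2 * (1 / 2 ^ 40 * scalingMin (ε / θ ^ 2) μ θ)) ≤ infEnergy ε μ θ 1 := by
  set e := ε / θ ^ 2 with he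
  have he0 : 0 < e := by positivity
  set F := 1 / 2 ^ 40 * scalingMin e μ θ with hF
  have hM := scalingMin_pos he0 hμ hθ hθ1
  have hF0 : 0 < F := by positivity
  unfold infEnergy
  refine le_iInf₂ ?_
  rintro ⟨u, β⟩ ⟨hu, hβ, hadm⟩
  by_contra hlt
  rw [not_le, energy] at hlt
  simp only at hu hβ hadm hlt
  have hel := lt_of_le_of_lt le_self_add hlt
  have hline := (lt_of_le_of_lt le_add_self hlt).le
  simp only [elasticEnergy, iInf_lt_iff] at hel
  obtain ⟨g, hg, hel⟩ := hel
  have hgw : HasWeakGradient u g := hg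
  set c := cube 1 with hcube
  have hcm : MeasurableSet c := (isOpen_cube 1).measurableSet
  have hum := hgw.1.aestronglyMeasurable
  have hgm := hgw.2.1.aestronglyMeasurable
  have hβm := hβ.aestronglyMeasurable
  set u' := hum.mk u with hu'
  set g' := hgm.mk g with hg'
  set β' := c.indicator (hβm.mk β) with hβ'
  have hgg : g =ᵐ[volume] g' := hgm.ae_eq_mk
  have hββ : β =ᵐ[volume.restrict c] β' := by
    filter_upwards [hβm.ae_eq_mk, ae_restrict_mem hcm] with x hx hxc
    rw [hβ', indicator_of_mem hxc, hx]
  have hc : Competitor u' g' β' :=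
    { measurable_u := hum.stronglyMeasurable_mk.measurable
      measurable_g := hgm.stronglyMeasurable_mk.measurable
      measurable_β := hβm.stronglyMeasurable_mk.measurable.indicator hcm
      weakGradient := hgw.congr hum.ae_eq_mk hgg
      integrable := (integrable_indicator_iff hcm).2 (hβ.congr hβm.ae_eq_mk)
      eq_zero := fun x hx => indicator_of_notMem hx _
      admissible := by
        rw [← ae_restrict_iff' hcm]
        filter_upwards [hadm, hββ] with x hx hxb
        rwa [← hxb] }
  have hin : ∫⁻ x, innerError g' β' x ^ 2 = ∫⁻ x in c, ‖g x - β x‖ₑ ^ 2 := by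
    rw [← lintegral_indicator hcm]
    have hββ' := (ae_restrict_iff' hcm).1 hββ
    refine lintegral_congr_ae ?_
    filter_upwards [hgg, hββ'] with x h1 h2
    by_cases hx : x ∈ c
    · rw [innerError, ← hcube, indicator_of_mem hx, indicator_of_mem hx, h1, h2 hx]
    · rw [innerError, ← hcube, indicator_of_notMem hx, indicator_of_notMem hx]; simp
  have hout : ∫⁻ x, outerError θ g' x ^ 2 = ∫⁻ x in cᶜ, ‖g x - ∇ (farField θ) x‖ₑ ^ 2 := by
    rw [← lintegral_indicator hcm.compl]
    refine lintegral_congr_ae ?_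
    filter_upwards [hgg] with x h1
    by_cases hx : x ∈ cᶜ
    · rw [outerError, ← hcube, indicator_of_mem hx, indicator_of_mem hx, h1, gradient_farField]
    · rw [outerError, ← hcube, indicator_of_notMem hx, indicator_of_notMem hx]; simp
  rw [← hin, ← hout] at hel
  obtain ⟨N, hN, h1, h2, h3, h4⟩ := exists_number_of_scales he0 hμ hθ hθ1 hF
  have hM4 : scalingMin e μ θ ≤ μ :=
    (min_le_right _ _).trans ((min_le_right _ _).trans ((min_le_right _ _).trans (min_le_left _ _)))
  have hM5 : scalingMin e μ θ ≤ 1 :=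
    (min_le_right _ _).trans
      ((min_le_right _ _).trans ((min_le_right _ _).trans (min_le_right _ _)))
  refine hc.false_of_small hθ hθ1 hF0 he0 hμ ((le_self_add.trans_lt hel).le) ?_ ?_ ?_ ?_ hN
    h1 h2 h3 h4
  · have h := (le_add_self.trans_lt hel).le
    rw [show θ ^ 2 * F = μ * (θ ^ 2 * (F / μ)) by field_simp, ENNReal.ofReal_mul hμ.le] at h
    exact (ENNReal.mul_le_mul_iff_right (by simpa using hμ) ENNReal.ofReal_ne_top).1 h
  · rw [← lineEnergy_congr hββ]
    rw [show θ ^ 2 * F = ε * (F / e) by rw [he]; field_simp, ENNReal.ofReal_mul hε.le] at hline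
    exact (ENNReal.mul_le_mul_iff_right (by simpa using hε) ENNReal.ofReal_ne_top).1 hline
  · rw [hF]; linarith
  · rw [hF, div_le_iff₀ hμ]; linarith

/-! ### Rescaling -/

open scoped Pointwise in
theorem smul_preimage_cube {l : ℝ} (hl : 0 < l) (L : ℝ) :
    (fun x : E3 => l • x) ⁻¹' cube L = cube (L / l) := by
  ext x
  simp only [cube, mem_preimage, mem_ofPred_eq, PiLp.smul_apply, smul_eq_mul, mem_Ioo]
  refine forall_congr' fun i => ?_
  rw [lt_div_iff₀' hl, mul_pos_iff_of_pos_left hl]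

theorem lintegral_comp_smul {l : ℝ} (hl : 0 < l) (F : E3 → ℝ≥0∞) :
    ENNReal.ofReal (l ^ 3) * ∫⁻ x, F (l • x) = ∫⁻ x, F x := by
  let e : E3 ≃ᵐ E3 := (Homeomorph.smul (Units.mk0 l hl.ne')).toMeasurableEquiv
  have h := Measure.map_addHaar_smul (volume : Measure E3) hl.ne'
  have h2 : ∫⁻ x, F (l • x) = ∫⁻ y, F y ∂(volume.map (l • · : E3 → E3)) :=
    (lintegral_map_equiv F e).symm
  rw [h2, h, lintegral_smul_measure, smul_eq_mul, ← mul_assoc, ← ENNReal.ofReal_mul (by positivity)]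
  rw [abs_of_pos (by positivity), finrank_euclideanSpace, Fintype.card_fin,
    mul_inv_cancel₀ (by positivity)]
  simp

theorem setLIntegral_comp_smul {l : ℝ} (hl : 0 < l) (F : E3 → ℝ≥0∞) {S : Set E3}
    (hS : MeasurableSet S) :
    ENNReal.ofReal (l ^ 3) * ∫⁻ x in (fun x : E3 => l • x) ⁻¹' S, F (l • x) = ∫⁻ x in S, F x := by
  rw [← lintegral_indicator hS, ← lintegral_comp_smul hl,
    ← lintegral_indicator (hS.preimage (measurable_const_smul l))]
  rfl

theorem locallyIntegrable_comp_smul {F : Type*} [NormedAddCommGroup F] {f : E3 → F}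
    (hf : LocallyIntegrable f volume) {l : ℝ} (hl : l ≠ 0) :
    LocallyIntegrable (fun x => f (l • x)) volume := by
  rw [locallyIntegrable_iff]
  intro K hK
  have hK' : IsCompact ((fun x : E3 => l • x) '' K) := hK.image (continuous_const_smul l)
  have h1 := ((integrable_indicator_iff hK'.measurableSet).2
    (hf.integrableOn_isCompact hK')).comp_smul hl
  refine (h1.integrableOn (s := K)).congr_fun (fun x hx => ?_) hK.measurableSet
  exact indicator_of_mem (mem_image_of_mem _ hx) f

theorem fderiv_comp_inv_smul {φ : E3 → ℝ} (hφ : ContDiff ℝ ∞ φ) {l : ℝ} (hl : l ≠ 0) (x v : E3) :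
    fderiv ℝ φ x v = l * fderiv ℝ (fun y => φ (l⁻¹ • y)) (l • x) v := by
  have h1 : HasFDerivAt φ (fderiv ℝ φ x) (l⁻¹ • l • x) := by
    rw [inv_smul_smul₀ hl]
    exact ((hφ.differentiable (by simp)) x).hasFDerivAt
  have h2 : HasFDerivAt (fun y : E3 => l⁻¹ • y) (l⁻¹ • ContinuousLinearMap.id ℝ E3) (l • x) :=
    (hasFDerivAt_id _).const_smul l⁻¹
  have h3 : fderiv ℝ (fun y => φ (l⁻¹ • y)) (l • x) = _ := (h1.comp (l • x) h2).fderiv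
  rw [h3]
  simp [hl]

theorem hasCompactSupport_comp_inv_smul {φ : E3 → ℝ} (hc : HasCompactSupport φ) {l : ℝ}
    (hl : l ≠ 0) : HasCompactSupport fun y => φ (l⁻¹ • y) :=
  hc.comp_homeomorph (Homeomorph.smulOfNeZero l⁻¹ (inv_ne_zero hl))

theorem integral_comp_smul_E3 {l : ℝ} (hl : 0 < l) (f : E3 → ℝ) :
    ∫ x, f (l • x) = (l ^ 3)⁻¹ * ∫ x, f x := by
  rw [Measure.integral_comp_smul_of_nonneg volume f l (hR := hl.le), finrank_euclideanSpace,
    Fintype.card_fin, smul_eq_mul]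

theorem HasWeakGradient.comp_smul {u : E3 → ℝ} {g : E3 → E3} (h : HasWeakGradient u g) {l : ℝ}
    (hl : 0 < l) : HasWeakGradient (fun x => u (l • x) / l) fun x => g (l • x) := by
  refine ⟨?_, locallyIntegrable_comp_smul h.2.1 hl.ne', fun φ hφ hc v => ?_⟩
  · have := (locallyIntegrable_comp_smul h.1 hl.ne').smul l⁻¹
    refine this.congr (Eventually.of_forall fun x => ?_)
    simp [div_eq_inv_mul]
  set ψ : E3 → ℝ := fun y => φ (l⁻¹ • y) with hψ
  have key := h.2.2 ψ (by fun_prop) (hasCompactSupport_comp_inv_smul hc hl.ne') v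
  have e1 : ∫ x, u (l • x) / l * fderiv ℝ φ x v = (l ^ 3)⁻¹ * ∫ x, u x * fderiv ℝ ψ x v := by
    rw [← integral_comp_smul_E3 hl]
    refine integral_congr_ae (Eventually.of_forall fun x => ?_)
    simp only
    rw [fderiv_comp_inv_smul hφ hl.ne' x v, ← hψ]
    field_simp
  have e2 : ∫ x, inner ℝ (g (l • x)) v * φ x = (l ^ 3)⁻¹ * ∫ x, inner ℝ (g x) v * ψ x := by
    rw [← integral_comp_smul_E3 hl (fun x => inner ℝ (g x) v * ψ x)]
    refine integral_congr_ae (Eventually.of_forall fun x => ?_)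
    simp [hψ, inv_smul_smul₀ hl.ne']
  rw [e1, e2, key, mul_neg]

theorem dirVariation_comp_smul_le {l : ℝ} (hl : 0 < l) {U : Set E3} (hU : MeasurableSet U) (v : E3)
    (f : E3 → ℝ) :
    ENNReal.ofReal (l ^ 2) * dirVariation ((fun x : E3 => l • x) ⁻¹' U) v (fun x => f (l • x)) ≤
      dirVariation U v f := by
  unfold dirVariation
  rw [ENNReal.mul_iSup]
  refine iSup_le fun φ => ?_
  rw [ENNReal.mul_iSup]
  refine iSup_le ?_
  rintro ⟨hφ, hc, hs, h1⟩
  set ψ : E3 → ℝ := fun y => φ (l⁻¹ • y) with hψ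
  refine le_iSup₂_of_le ψ ⟨by fun_prop, hasCompactSupport_comp_inv_smul hc hl.ne', ?_,
    fun x => h1 _⟩ (le_of_eq ?_)
  · have : tsupport ψ = (fun y : E3 => l⁻¹ • y) ⁻¹' tsupport φ :=
      tsupport_comp_eq_preimage φ (Homeomorph.smulOfNeZero l⁻¹ (inv_ne_zero hl.ne'))
    rw [this]
    intro x hx
    have h2 := hs hx
    simpa [smul_inv_smul₀ hl.ne'] using h2
  · rw [← ENNReal.ofReal_mul (by positivity)]
    congr 1
    rw [← integral_indicator hU, ← integral_indicator (hU.preimage (measurable_const_smul l))]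
    have e1 : ∫ x, ((fun x : E3 => l • x) ⁻¹' U).indicator (fun x => f (l • x) * fderiv ℝ φ x v) x =
        ∫ x, l * U.indicator (fun x => f x * fderiv ℝ ψ x v) (l • x) := by
      refine integral_congr_ae (Eventually.of_forall fun x => ?_)
      simp only
      by_cases hx : l • x ∈ U
      · rw [indicator_of_mem hx, indicator_of_mem (show x ∈ (fun x : E3 => l • x) ⁻¹' U from hx),
          fderiv_comp_inv_smul hφ hl.ne' x v, ← hψ]
        ring
      · rw [indicator_of_notMem hx,
          indicator_of_notMem (show x ∉ (fun x : E3 => l • x) ⁻¹' U from hx), mul_zero]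
    rw [e1, integral_const_mul, integral_comp_smul_E3 hl]
    field_simp

theorem lineEnergy_comp_smul_le {l : ℝ} (hl : 0 < l) (L : ℝ) (β : E3 → E3) :
    ENNReal.ofReal (l ^ 2) * lineEnergy (L / l) (fun x => β (l • x)) ≤ lineEnergy L β := by
  have hm : MeasurableSet (cube L) := (isOpen_cube L).measurableSet
  unfold lineEnergy
  rw [← smul_preimage_cube hl, mul_add, mul_add, mul_add]
  exact add_le_add (add_le_add (add_le_add
    (dirVariation_comp_smul_le hl hm eXi fun x => etaComp (β x))
    (dirVariation_comp_smul_le hl hm e3 fun x => etaComp (β x)))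
    (dirVariation_comp_smul_le hl hm eEta fun x => xiComp (β x)))
    (dirVariation_comp_smul_le hl hm e3 fun x => xiComp (β x))

theorem elasticEnergy_comp_smul_le {l : ℝ} (hl : 0 < l) (μ θ L : ℝ) (u : E3 → ℝ) (β : E3 → E3) :
    ENNReal.ofReal (l ^ 3) * elasticEnergy μ θ (L / l) (fun x => u (l • x) / l)
      (fun x => β (l • x)) ≤ elasticEnergy μ θ L u β := by
  have hm : MeasurableSet (cube L) := (isOpen_cube L).measurableSet
  unfold elasticEnergy
  refine le_iInf₂ fun g hg => ?_
  have h := iInf₂_le (f := fun (g : E3 → E3) (_ : g ∈ {g : E3 → E3 |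
    HasWeakGradient (fun x => u (l • x) / l) g}) =>
    (∫⁻ x in cube (L / l), ‖g x - β (l • x)‖ₑ ^ 2) +
      ENNReal.ofReal μ * ∫⁻ x in (cube (L / l))ᶜ, ‖g x - ∇ (farField θ) x‖ₑ ^ 2)
    (fun x => g (l • x)) (HasWeakGradient.comp_smul hg hl)
  refine (mul_le_mul_right h _).trans (le_of_eq ?_)
  rw [mul_add, ← mul_assoc, mul_comm _ (ENNReal.ofReal μ), mul_assoc, ← smul_preimage_cube hl,
    ← preimage_compl]
  simp only [gradient_farField]
  rw [setLIntegral_comp_smul hl (fun x => ‖g x - β x‖ₑ ^ 2) hm,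
    setLIntegral_comp_smul hl (fun x => ‖g x - farGrad θ‖ₑ ^ 2) hm.compl]

theorem admissible_comp_smul {l : ℝ} (hl : 0 < l) {L : ℝ} {u : E3 → ℝ} {β : E3 → E3}
    (h : (u, β) ∈ admissible L) :
    ((fun x => u (l • x) / l), fun x => β (l • x)) ∈ admissible (L / l) := by
  obtain ⟨h1, h2, h3⟩ := h
  simp only at h1 h2 h3
  have hm : MeasurableSet (cube L) := (isOpen_cube L).measurableSet
  refine ⟨?_, ?_, ?_⟩ <;> simp only
  · have := (locallyIntegrable_comp_smul h1 hl.ne').smul l⁻¹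
    refine this.congr (Eventually.of_forall fun x => ?_)
    simp [div_eq_inv_mul]
  · rw [← smul_preimage_cube hl]
    have k := ((integrable_indicator_iff hm).2 h2).comp_smul hl.ne'
    exact (integrable_indicator_iff (hm.preimage (measurable_const_smul l))).1 k
  · rw [← smul_preimage_cube hl, ae_restrict_iff' (hm.preimage (measurable_const_smul l))]
    rw [ae_restrict_iff' hm] at h3
    exact (Measure.quasiMeasurePreserving_smul (volume : Measure E3) hl.ne').ae h3

/-- Rescaling by the factor `l`. -/
theorem infEnergy_rescale_le {l : ℝ} (hl : 0 < l) (ε μ θ L : ℝ) :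
    ENNReal.ofReal (l ^ 3) * infEnergy (ε / l) μ θ (L / l) ≤ infEnergy ε μ θ L := by
  unfold infEnergy
  refine le_iInf₂ ?_
  rintro ⟨u, β⟩ h
  refine (mul_le_mul_right (iInf₂_le _ (admissible_comp_smul hl h)) _).trans ?_
  simp only [energy]
  rw [mul_add]
  refine add_le_add (elasticEnergy_comp_smul_le hl _ _ _ _ _) ?_
  rw [show ENNReal.ofReal (l ^ 3) *
      (ENNReal.ofReal (ε / l) * lineEnergy (L / l) fun x => β (l • x)) =
    ENNReal.ofReal ε * (ENNReal.ofReal (l ^ 2) * lineEnergy (L / l) fun x => β (l • x)) by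
      rw [← mul_assoc, ← mul_assoc, ← ENNReal.ofReal_mul (by positivity),
        ← ENNReal.ofReal_mul' (by positivity)]
      congr 2
      field_simp]
  exact mul_le_mul_right (lineEnergy_comp_smul_le hl L β) _

/-! ### The branched profile -/

/-- The cone of generation `j` with apex `k w / 2ʲ` that enters the branched profile. Its value at
the apex lies on the line of slope `a`, except that generations finer than `κ` are raised. -/
noncomputable def cone (a w ρ κ : ℝ) (j k : ℕ) : ℝ :=
  a * (k * (w / 2 ^ j)) + a * w * max (κ - 1 / 2 ^ j) 0 + max (ρ - k * (w / 2 ^ j)) 0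

/-- The profile of a refining family of needles on a cell of width `w`, with volume fraction `a`.
It is an infimum of cones, of which only the generations of mesh at least comparable to `w κ` matter
at refinement parameter `κ`; hence its slope in `ρ` is `0` or `1` if `κ > 0`.
At `κ = 0` it is linear, and `κ = 1` corresponds to a single needle. -/
noncomputable def branch (a w ρ κ : ℝ) : ℝ :=
  ⨅ p : (j : ℕ) × Fin (2 ^ j + 1), cone a w ρ κ p.1 p.2

section branch

variable {a w : ℝ}

theorem cone_nonneg (ha : 0 ≤ a) (hw : 0 ≤ w) (ρ κ : ℝ) (j k : ℕ) : 0 ≤ cone a w ρ κ j k := by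
  unfold cone; positivity

theorem branch_le_cone (ha : 0 ≤ a) (hw : 0 ≤ w) (ρ κ : ℝ) {j k : ℕ} (hk : k ≤ 2 ^ j) :
    branch a w ρ κ ≤ cone a w ρ κ j k :=
  ciInf_le ⟨0, by rintro _ ⟨p, rfl⟩; exact cone_nonneg ha hw _ _ _ _⟩
    (⟨j, ⟨k, Nat.lt_succ_of_le hk⟩⟩ : (j : ℕ) × Fin (2 ^ j + 1))

theorem le_branch {ρ κ c : ℝ} (h : ∀ j k : ℕ, k ≤ 2 ^ j → c ≤ cone a w ρ κ j k) :
    c ≤ branch a w ρ κ := by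
  have : Nonempty ((j : ℕ) × Fin (2 ^ j + 1)) := ⟨⟨0, 0⟩⟩
  exact le_ciInf fun p => h _ _ (Nat.le_of_lt_succ p.2.2)

theorem branch_nonneg (ha : 0 ≤ a) (hw : 0 ≤ w) (ρ κ : ℝ) : 0 ≤ branch a w ρ κ :=
  le_branch fun _ _ _ => cone_nonneg ha hw _ _ _ _

theorem branch_le_add (ha : 0 ≤ a) (hw : 0 ≤ w) (ρ ρ' κ κ' : ℝ) :
    branch a w ρ' κ' ≤ branch a w ρ κ + max (ρ' - ρ) 0 + a * w * max (κ' - κ) 0 := by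
  rw [← sub_le_iff_le_add, ← sub_le_iff_le_add]
  refine le_branch fun j k hk => ?_
  rw [sub_le_iff_le_add, sub_le_iff_le_add]
  refine (branch_le_cone ha hw ρ' κ' hk).trans ?_
  unfold cone
  have h1 : max (ρ' - k * (w / 2 ^ j)) 0 ≤ max (ρ - k * (w / 2 ^ j)) 0 + max (ρ' - ρ) 0 := by
    refine max_le ?_ (by positivity)
    linarith [le_max_left (ρ - k * (w / 2 ^ j)) 0, le_max_left (ρ' - ρ) 0]
  have h2 : max (κ' - 1 / 2 ^ j) 0 ≤ max (κ - 1 / 2 ^ j) 0 + max (κ' - κ) 0 := by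
    refine max_le ?_ (by positivity)
    linarith [le_max_left (κ - 1 / 2 ^ j) 0, le_max_left (κ' - κ) 0]
  have h3 := mul_le_mul_of_nonneg_left h2 (mul_nonneg ha hw)
  linarith

theorem branch_mono (ha : 0 ≤ a) (hw : 0 ≤ w) {ρ ρ' : ℝ} (h : ρ ≤ ρ') (κ : ℝ) :
    branch a w ρ κ ≤ branch a w ρ' κ := by
  have := branch_le_add ha hw ρ' ρ κ κ
  rw [max_eq_right (by linarith), sub_self, max_self] at this
  linarith

theorem branch_le_add_sub (ha : 0 ≤ a) (hw : 0 ≤ w) {ρ ρ' : ℝ} (h : ρ ≤ ρ') (κ : ℝ) :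
    branch a w ρ' κ ≤ branch a w ρ κ + (ρ' - ρ) := by
  have := branch_le_add ha hw ρ ρ' κ κ
  rw [max_eq_left (by linarith), sub_self, max_self] at this
  linarith

theorem abs_branch_sub_le_left (ha : 0 ≤ a) (hw : 0 ≤ w) (ρ ρ' κ : ℝ) :
    |branch a w ρ κ - branch a w ρ' κ| ≤ |ρ - ρ'| := by
  wlog h : ρ' ≤ ρ generalizing ρ ρ'
  · rw [abs_sub_comm, abs_sub_comm ρ]; exact this _ _ (not_le.1 h).le
  rw [abs_of_nonneg (sub_nonneg.2 (branch_mono ha hw h κ)), abs_of_nonneg (sub_nonneg.2 h)]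
  linarith [branch_le_add_sub ha hw h κ]

theorem abs_branch_sub_le_right (ha : 0 ≤ a) (hw : 0 ≤ w) (ρ κ κ' : ℝ) :
    |branch a w ρ κ - branch a w ρ κ'| ≤ a * w * |κ - κ'| := by
  have haw := mul_nonneg ha hw
  have h1 := branch_le_add ha hw ρ ρ κ κ'
  have h2 := branch_le_add ha hw ρ ρ κ' κ
  rw [sub_self, max_self] at h1 h2
  have h3 : max (κ' - κ) 0 ≤ |κ - κ'| :=
    max_le (by rw [abs_sub_comm]; exact le_abs_self _) (abs_nonneg _)
  have h4 : max (κ - κ') 0 ≤ |κ - κ'| := max_le (le_abs_self _) (abs_nonneg _)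
  have h5 := mul_le_mul_of_nonneg_left h3 haw
  have h6 := mul_le_mul_of_nonneg_left h4 haw
  rw [abs_le]
  constructor <;> linarith

theorem branch_of_nonpos (ha : 0 ≤ a) (hw : 0 ≤ w) {ρ κ : ℝ} (hρ : ρ ≤ 0) (hκ : κ ≤ 1) :
    branch a w ρ κ = 0 := by
  refine le_antisymm ((branch_le_cone ha hw ρ κ (j := 0) (k := 0) (by simp)).trans ?_)
    (branch_nonneg ha hw _ _)
  simp [cone, hρ, hκ]

theorem grid_le_width (hw : 0 ≤ w) {j k : ℕ} (hk : k ≤ 2 ^ j) : k * (w / 2 ^ j) ≤ w := by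
  have : (k : ℝ) ≤ 2 ^ j := by exact_mod_cast hk
  calc k * (w / 2 ^ j) ≤ 2 ^ j * (w / 2 ^ j) := by gcongr
    _ = w := by field_simp

theorem mul_le_branch (ha : 0 ≤ a) (ha1 : a ≤ 1) (hw : 0 ≤ w) (ρ κ : ℝ) :
    a * ρ ≤ branch a w ρ κ := by
  refine le_branch fun j k hk => ?_
  unfold cone
  set b := k * (w / 2 ^ j)
  have h0 : 0 ≤ a * w * max (κ - 1 / 2 ^ j) 0 := by positivity
  have h1 : a * (ρ - b) ≤ max (ρ - b) 0 := by
    rcases le_total ρ b with h | h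
    · exact (mul_nonpos_of_nonneg_of_nonpos ha (by linarith)).trans (le_max_right _ _)
    · exact (mul_le_of_le_one_left (by linarith) ha1).trans (le_max_left _ _)
  nlinarith

theorem branch_width (ha : 0 ≤ a) (ha1 : a ≤ 1) (hw : 0 ≤ w) {κ : ℝ} (hκ : κ ≤ 1) :
    branch a w w κ = a * w := by
  refine le_antisymm ?_ (mul_le_branch ha ha1 hw w κ)
  refine (branch_le_cone ha hw w κ (j := 0) (k := 1) (by simp)).trans ?_
  simp [cone, hκ]

theorem branch_zero (ha : 0 ≤ a) (ha1 : a ≤ 1) (hw : 0 ≤ w) {ρ : ℝ} (h0 : 0 ≤ ρ) (hρ : ρ ≤ w) :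
    branch a w ρ 0 = a * ρ := by
  refine le_antisymm ?_ (mul_le_branch ha ha1 hw ρ 0)
  rcases hw.eq_or_lt with rfl | hw0
  · obtain rfl : ρ = 0 := le_antisymm hρ h0
    rw [branch_of_nonpos ha hw le_rfl zero_le_one, mul_zero]
  have key : ∀ j : ℕ, branch a w ρ 0 ≤ a * ρ + w / 2 ^ j := fun j => by
    set l := w / 2 ^ j with hl
    have hl0 : 0 < l := by positivity
    set k := ⌊ρ / l⌋₊ with hk
    have hk1 : k * l ≤ ρ := by
      have := Nat.floor_le (by positivity : 0 ≤ ρ / l)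
      rwa [le_div_iff₀ hl0] at this
    have hk2 : ρ < (k + 1) * l := by
      have := Nat.lt_floor_add_one (ρ / l)
      rwa [div_lt_iff₀ hl0] at this
    have hkj : k ≤ 2 ^ j := by
      have h2 : ρ / l ≤ ((2 ^ j : ℕ) : ℝ) := by
        rw [div_le_iff₀ hl0, hl]
        push_cast
        rw [mul_div_cancel₀ _ (by positivity)]
        exact hρ
      exact Nat.floor_le_of_le h2
    refine (branch_le_cone ha hw ρ 0 hkj).trans ?_
    unfold cone
    rw [← hl, max_eq_right (a := (0 : ℝ) - 1 / 2 ^ j) (by simp), max_eq_left (by linarith)]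
    nlinarith
  have hlim : Tendsto (fun j : ℕ => a * ρ + w / 2 ^ j) atTop (𝓝 (a * ρ + 0)) := by
    refine tendsto_const_nhds.add ?_
    have := (tendsto_pow_atTop_nhds_zero_of_lt_one (by norm_num : (0 : ℝ) ≤ 1 / 2)
      (by norm_num)).const_mul w
    simpa [div_eq_mul_inv] using this
  rw [add_zero] at hlim
  exact ge_of_tendsto' hlim key

/-- At refinement parameter at least `2⁻ᴶ`, the cones beyond generation `J` are not needed. -/
theorem exists_cone_le (ha : 0 ≤ a) (hw : 0 ≤ w) {κ : ℝ} {J j k : ℕ} (hJ : 1 / 2 ^ J ≤ κ)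
    (hk : k ≤ 2 ^ j) (hj : J ≤ j) :
    ∃ k' ≤ 2 ^ J, ∀ ρ, cone a w ρ κ J k' ≤ cone a w ρ κ j k := by
  obtain ⟨d, rfl⟩ := Nat.exists_eq_add_of_le hj
  have hD : 0 < 2 ^ d := by positivity
  set k' := (k + (2 ^ d - 1)) / 2 ^ d with hk'
  have h1 : k' * 2 ^ d + 1 ≤ k + 2 ^ d := by
    have := Nat.div_mul_le_self (k + (2 ^ d - 1)) (2 ^ d)
    rw [← hk'] at this
    omega
  have h2 : k ≤ k' * 2 ^ d := by
    have := Nat.lt_div_mul_add (a := k + (2 ^ d - 1)) hD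
    rw [← hk'] at this
    omega
  have h3 : k' ≤ 2 ^ J := by
    rw [pow_add] at hk
    by_contra h
    have : (2 ^ J + 1) * 2 ^ d ≤ k' * 2 ^ d := Nat.mul_le_mul_right _ (not_le.1 h)
    rw [add_mul, one_mul] at this
    omega
  refine ⟨k', h3, fun ρ => ?_⟩
  have hDr : (0 : ℝ) < 2 ^ d := by positivity
  have h1' : (k' : ℝ) * 2 ^ d + 1 ≤ k + 2 ^ d := by exact_mod_cast h1
  have h2' : (k : ℝ) ≤ k' * 2 ^ d := by exact_mod_cast h2
  have hjle : (1 : ℝ) / 2 ^ (J + d) ≤ 1 / 2 ^ J :=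
    one_div_pow_le_one_div_pow_of_le (by norm_num) (Nat.le_add_right J d)
  unfold cone
  rw [max_eq_left (by linarith : (0 : ℝ) ≤ κ - 1 / 2 ^ J),
    max_eq_left (by linarith : (0 : ℝ) ≤ κ - 1 / 2 ^ (J + d))]
  set l := w / 2 ^ (J + d) with hl
  have hl0 : 0 ≤ l := by positivity
  have e1 : w / 2 ^ J = 2 ^ d * l := by rw [hl, pow_add]; field_simp
  have e2 : a * w * (κ - 1 / 2 ^ J) = a * w * κ - a * (2 ^ d * l) := by rw [← e1]; ring
  have e3 : a * w * (κ - 1 / 2 ^ (J + d)) = a * w * κ - a * l := by rw [hl]; ring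
  rw [e1, e2, e3]
  have h4 : max (ρ - k' * (2 ^ d * l)) 0 ≤ max (ρ - k * l) 0 := by
    refine max_le_max ?_ le_rfl
    nlinarith
  have h5 := mul_le_mul_of_nonneg_right h1' (mul_nonneg ha hl0)
  nlinarith

/-- Between neighbouring grid points of generation `J` the profile first has slope `1` and then is
constant: it depends only on its values at the two grid points. -/
theorem branch_cell (ha : 0 ≤ a) (hw : 0 ≤ w) {ρ κ : ℝ} {J i : ℕ} (hJ : 1 / 2 ^ J ≤ κ)
    (h1 : i * (w / 2 ^ J) ≤ ρ) (h2 : ρ ≤ (i + 1) * (w / 2 ^ J)) :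
    branch a w ρ κ = min (branch a w (i * (w / 2 ^ J)) κ + (ρ - i * (w / 2 ^ J)))
      (branch a w ((i + 1) * (w / 2 ^ J)) κ) := by
  refine le_antisymm (le_min (branch_le_add_sub ha hw h1 κ) (branch_mono ha hw h2 κ)) ?_
  have key : ∀ j k : ℕ, k ≤ 2 ^ j → j ≤ J →
      min (branch a w (i * (w / 2 ^ J)) κ + (ρ - i * (w / 2 ^ J)))
        (branch a w ((i + 1) * (w / 2 ^ J)) κ) ≤ cone a w ρ κ j k := by
    intro j k hk hj
    obtain ⟨d, rfl⟩ := Nat.exists_eq_add_of_le hj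
    have hg : w / 2 ^ j = 2 ^ d * (w / 2 ^ (j + d)) := by rw [pow_add]; field_simp
    set l := w / 2 ^ (j + d) with hl
    have hl0 : 0 ≤ l := by positivity
    rcases Nat.lt_or_ge i (k * 2 ^ d) with h | h
    · -- the apex lies to the right of the cell
      have h' : ((i + 1 : ℕ) : ℝ) ≤ ((k * 2 ^ d : ℕ) : ℝ) := by exact_mod_cast h
      push_cast at h'
      have hle : (i + 1) * l ≤ k * (2 ^ d * l) := by nlinarith
      refine (min_le_right _ _).trans ((branch_le_cone ha hw _ κ hk).trans (le_of_eq ?_))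
      unfold cone
      rw [hg, max_eq_right (a := (i + 1) * l - k * (2 ^ d * l)) (by linarith),
        max_eq_right (a := ρ - k * (2 ^ d * l)) (by linarith)]
    · -- the apex lies to the left of the cell
      have h' : ((k * 2 ^ d : ℕ) : ℝ) ≤ (i : ℝ) := by exact_mod_cast h
      push_cast at h'
      have hle : k * (2 ^ d * l) ≤ i * l := by nlinarith
      refine (min_le_left _ _).trans
        ((add_le_add (branch_le_cone ha hw _ κ hk) le_rfl).trans (le_of_eq ?_))
      unfold cone
      rw [hg, max_eq_left (a := i * l - k * (2 ^ d * l)) (by linarith),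
        max_eq_left (a := ρ - k * (2 ^ d * l)) (by linarith)]
      ring
  refine le_branch fun j k hk => ?_
  rcases le_total j J with hj | hj
  · exact key j k hk hj
  · obtain ⟨k', hk', hle⟩ := exists_cone_le ha hw hJ hk hj
    exact (key J k' hk' le_rfl).trans (hle ρ)

/-- The needles of the branched profile: the set where the profile has slope `1`. -/
def Needle (a w ρ κ : ℝ) : Prop :=
  0 ≤ ρ ∧ ∃ ρ' ≤ w, ρ < ρ' ∧ branch a w ρ' κ = branch a w ρ κ + (ρ' - ρ)

theorem Needle.lt_width {ρ κ : ℝ} (h : Needle a w ρ κ) : ρ < w := by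
  obtain ⟨-, ρ', h1, h2, -⟩ := h
  linarith

/-- Each grid cell of generation `J` contains one needle, adjacent to its left end point, whose
length is the increment of the profile. -/
theorem needle_iff (ha : 0 ≤ a) (hw : 0 ≤ w) {ρ κ : ℝ} {J i : ℕ} (hJ : 1 / 2 ^ J ≤ κ)
    (hi : i < 2 ^ J) (h1 : i * (w / 2 ^ J) ≤ ρ) (h2 : ρ < (i + 1) * (w / 2 ^ J)) :
    Needle a w ρ κ ↔ ρ < i * (w / 2 ^ J) +
      (branch a w ((i + 1) * (w / 2 ^ J)) κ - branch a w (i * (w / 2 ^ J)) κ) := by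
  have hc := branch_cell ha hw hJ h1 h2.le
  have hl0 : 0 ≤ w / 2 ^ J := by positivity
  have hwi : ((i : ℝ) + 1) * (w / 2 ^ J) ≤ w := by
    have := grid_le_width hw (Nat.succ_le_of_lt hi)
    simpa using this
  set l := w / 2 ^ J with hl
  set A := branch a w (i * l) κ
  set B := branch a w ((i + 1) * l) κ
  have hBA : B ≤ A + l := by
    have := branch_le_add_sub ha hw (by nlinarith : i * l ≤ (i + 1) * l) κ
    linarith
  constructor
  · rintro ⟨-, ρ', hρ', hlt, he⟩
    by_contra hn
    rw [not_lt] at hn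
    rw [min_eq_right (by linarith)] at hc
    rcases le_total ρ' ((i + 1) * l) with h | h
    · have := branch_mono ha hw h κ
      linarith
    · have := branch_le_add_sub ha hw h κ
      linarith
  · intro h
    refine ⟨le_trans (by positivity) h1, i * l + (B - A), by linarith, h, ?_⟩
    have hAB : i * l ≤ i * l + (B - A) := by linarith
    rw [branch_cell ha hw hJ hAB (by rw [← hl]; linarith), hc, min_eq_left (by linarith),
      min_eq_left (by linarith)]
    ring

theorem exists_cell (hw : 0 < w) {ρ : ℝ} (h0 : 0 ≤ ρ) (hρ : ρ < w) (J : ℕ) :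
    ∃ i : ℕ, i < 2 ^ J ∧ i * (w / 2 ^ J) ≤ ρ ∧ ρ < (i + 1) * (w / 2 ^ J) := by
  have hl0 : 0 < w / 2 ^ J := by positivity
  refine ⟨⌊ρ / (w / 2 ^ J)⌋₊, ?_, ?_, ?_⟩
  · rw [Nat.floor_lt (by positivity), div_lt_iff₀ hl0]
    push_cast
    rwa [mul_div_cancel₀ _ (by positivity)]
  · have := Nat.floor_le (by positivity : 0 ≤ ρ / (w / 2 ^ J))
    rwa [le_div_iff₀ hl0] at this
  · have := Nat.lt_floor_add_one (ρ / (w / 2 ^ J))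
    rwa [div_lt_iff₀ hl0] at this

open Classical in
/-- The profile has a right derivative at every point, namely the indicator function of the
needles. -/
theorem hasDerivWithinAt_branch (ha : 0 ≤ a) (hw : 0 < w) {κ : ℝ} (hκ : 0 < κ)
    (hκ1 : κ ≤ 1) (ρ : ℝ) :
    HasDerivWithinAt (fun ρ => branch a w (min ρ w) κ) (if Needle a w ρ κ then 1 else 0) (Ici ρ)
      ρ := by
  have hconst : ∀ c ρ' : ℝ, ρ < ρ' → (∀ r ∈ Ico ρ ρ', branch a w (min r w) κ = c) →
      HasDerivWithinAt (fun ρ => branch a w (min ρ w) κ) 0 (Ici ρ) ρ := fun c ρ' h1 h2 =>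
    (hasDerivWithinAt_const ρ (Ici ρ) c).congr_of_eventuallyEq
      (by filter_upwards [Ico_mem_nhdsGE h1] with r hr using h2 r hr) (h2 ρ ⟨le_rfl, h1⟩)
  rcases lt_or_ge ρ 0 with h0 | h0
  · rw [if_neg fun h => absurd h.1 (not_le.2 h0)]
    refine hconst 0 0 h0 fun r hr => branch_of_nonpos ha hw.le ?_ hκ1
    exact (min_le_left _ _).trans hr.2.le
  rcases le_or_gt w ρ with h1 | h1
  · rw [if_neg fun h => absurd h.lt_width (not_lt.2 h1)]
    exact hconst (branch a w w κ) (ρ + 1) (by linarith) fun r hr => by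
      rw [min_eq_right (h1.trans hr.1)]
  obtain ⟨J, hJ⟩ := exists_pow_lt_of_lt_one hκ (by norm_num : (1 / 2 : ℝ) < 1)
  rw [one_div_pow] at hJ
  obtain ⟨i, hi, hi1, hi2⟩ := exists_cell hw h0 h1 J
  have hwi : ((i : ℝ) + 1) * (w / 2 ^ J) ≤ w := by
    have := grid_le_width hw.le (Nat.succ_le_of_lt hi)
    simpa using this
  have hn := needle_iff ha hw.le hJ.le hi hi1 hi2
  have hc : ∀ r ∈ Ico ρ ((i + 1) * (w / 2 ^ J)), branch a w (min r w) κ =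
      min (branch a w (i * (w / 2 ^ J)) κ + (r - i * (w / 2 ^ J)))
      (branch a w ((i + 1) * (w / 2 ^ J)) κ) := fun r hr => by
    rw [min_eq_left (by linarith [hr.2])]
    exact branch_cell ha hw.le hJ.le (by linarith [hr.1]) hr.2.le
  set l := w / 2 ^ J
  set A := branch a w (i * l) κ
  set B := branch a w ((i + 1) * l) κ
  have hBA : B ≤ A + l := by
    have := branch_le_add_sub ha hw.le (by nlinarith : i * l ≤ (i + 1) * l) κ
    linarith
  by_cases h : Needle a w ρ κ
  · rw [if_pos h]
    have hρ := hn.1 h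
    have hd : HasDerivWithinAt (fun r : ℝ => A + (r - i * l)) 1 (Ici ρ) ρ :=
      (((hasDerivAt_id ρ).sub_const (i * l)).const_add A).hasDerivWithinAt
    have he : ∀ r ∈ Ico ρ (i * l + (B - A)), branch a w (min r w) κ = A + (r - i * l) :=
      fun r hr => by
        rw [hc r ⟨hr.1, by linarith [hr.2]⟩, min_eq_left (by linarith [hr.2])]
    exact hd.congr_of_eventuallyEq
      (by filter_upwards [Ico_mem_nhdsGE hρ] with r hr using he r hr) (he ρ ⟨le_rfl, hρ⟩)
  · rw [if_neg h]
    have hρ := not_lt.1 fun h' => h (hn.2 h')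
    refine hconst B _ hi2 fun r hr => ?_
    rw [hc r hr, min_eq_right (by linarith [hr.1])]

/-- If the volume fraction is `1`, the profile is that of a single needle. -/
theorem branch_one (hw : 0 ≤ w) {ρ κ : ℝ} (h0 : 0 ≤ ρ) (hκ : κ ≤ 1) :
    branch 1 w ρ κ = ρ := by
  refine le_antisymm ?_ (by simpa using mul_le_branch zero_le_one le_rfl hw ρ κ)
  refine (branch_le_cone zero_le_one hw ρ κ (j := 0) (k := 0) (by simp)).trans ?_
  simp [cone, hκ, h0]

/-- If only one of two nearby points of the `(ρ, κ)`-plane belongs to a needle, then they are close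
to the boundary of one of the `2ᴶ` needles. -/
theorem near_boundary_of_needle (ha : 0 ≤ a) (hw : 0 < w) {J : ℕ} {ρ ρ' κ κ' t : ℝ}
    (hJ : 1 / 2 ^ J ≤ κ) (hJ' : 1 / 2 ^ J ≤ κ') (ht : |ρ - ρ'| ≤ t)
    (hb : ∀ r ≤ w, |branch a w r κ - branch a w r κ'| ≤ t)
    (h : ¬(Needle a w ρ κ ↔ Needle a w ρ' κ')) :
    ∃ i : ℕ, i < 2 ^ J ∧ (|ρ - i * (w / 2 ^ J)| ≤ t ∨ |ρ - (i + 1) * (w / 2 ^ J)| ≤ t ∨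
      |ρ - (i * (w / 2 ^ J) +
        (branch a w ((i + 1) * (w / 2 ^ J)) κ - branch a w (i * (w / 2 ^ J)) κ))| ≤ 3 * t) := by
  have hρρ := abs_le.1 ht
  have hl0 : 0 < w / 2 ^ J := by positivity
  have hends : ∀ i : ℕ, i < 2 ^ J →
      |(branch a w ((i + 1) * (w / 2 ^ J)) κ - branch a w (i * (w / 2 ^ J)) κ) -
        (branch a w ((i + 1) * (w / 2 ^ J)) κ' - branch a w (i * (w / 2 ^ J)) κ')| ≤ 2 * t := by
    intro i hi
    have hwi : ((i : ℝ) + 1) * (w / 2 ^ J) ≤ w := by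
      have := grid_le_width hw.le (Nat.succ_le_of_lt hi)
      simpa using this
    have h1 := abs_le.1 (hb _ hwi)
    have h2 := abs_le.1 (hb (i * (w / 2 ^ J)) (by nlinarith))
    rw [abs_le]
    constructor <;> linarith [h1.1, h1.2, h2.1, h2.2]
  by_cases hn : Needle a w ρ κ
  · have hn' : ¬Needle a w ρ' κ' := fun h' => h ⟨fun _ => h', fun _ => hn⟩
    obtain ⟨i, hi, hi1, hi2⟩ := exists_cell hw hn.1 hn.lt_width J
    refine ⟨i, hi, ?_⟩
    have he := abs_le.1 (hends i hi)
    have hρ := (needle_iff ha hw.le hJ hi hi1 hi2).1 hn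
    rcases lt_or_ge ρ' (i * (w / 2 ^ J)) with h1 | h1
    · exact Or.inl (abs_le.2 ⟨by linarith, by linarith⟩)
    rcases lt_or_ge ρ' ((i + 1) * (w / 2 ^ J)) with h2 | h2
    · have hρ' := not_lt.1 fun h' => hn' ((needle_iff ha hw.le hJ' hi h1 h2).2 h')
      exact Or.inr (Or.inr (abs_le.2 ⟨by linarith, by linarith⟩))
    · exact Or.inr (Or.inl (abs_le.2 ⟨by linarith, by linarith⟩))
  · have hn' : Needle a w ρ' κ' := by
      by_contra h'
      exact h ⟨fun k => absurd k hn, fun k => absurd k h'⟩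
    obtain ⟨i, hi, hi1, hi2⟩ := exists_cell hw hn'.1 hn'.lt_width J
    refine ⟨i, hi, ?_⟩
    have he := abs_le.1 (hends i hi)
    have hρ' := (needle_iff ha hw.le hJ' hi hi1 hi2).1 hn'
    rcases lt_or_ge ρ (i * (w / 2 ^ J)) with h1 | h1
    · exact Or.inl (abs_le.2 ⟨by linarith, by linarith⟩)
    rcases lt_or_ge ρ ((i + 1) * (w / 2 ^ J)) with h2 | h2
    · have hρ := not_lt.1 fun h' => hn ((needle_iff ha hw.le hJ hi h1 h2).2 h')
      exact Or.inr (Or.inr (abs_le.2 ⟨by linarith, by linarith⟩))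
    · exact Or.inr (Or.inl (abs_le.2 ⟨by linarith, by linarith⟩))

end branch

/-! ### Estimating variations and gradients by differences -/

/-- The variation in direction `v` is controlled by the `L¹` norm of difference quotients. -/
theorem dirVariation_le_of_translate {U : Set E3} {f : E3 → ℝ} (hf : LocallyIntegrable f volume)
    (v : E3) {C : ℝ} (hC : 0 ≤ C)
    (h : ∀ K ⊆ U, IsCompact K → ∀ᶠ t in 𝓝[>] (0 : ℝ),
      ∫⁻ x in K, ‖f (x - t • v) - f x‖ₑ ≤ ENNReal.ofReal (C * t)) :
    dirVariation U v f ≤ ENNReal.ofReal C := by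
  refine iSup₂_le ?_
  rintro φ ⟨hφ, hc, hs, h1⟩
  refine ENNReal.ofReal_le_ofReal ?_
  have hdt : ∀ x ∉ tsupport φ, fderiv ℝ φ x v = 0 := fun x hx => by
    rw [fderiv_of_notMem_tsupport ℝ hx]; simp
  rw [setIntegral_eq_integral_of_forall_compl_eq_zero (fun x hx => by
    rw [hdt x fun h => hx (hs h), mul_zero])]
  -- differentiate the correlation of `f` with translates of the test function
  have hd := hasDerivAt_integral_mul_translate hf hφ hc (-v) 0
  simp only [zero_smul, sub_zero, map_neg, mul_neg, integral_neg, neg_neg] at hd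
  have hd' := hd.hasDerivWithinAt (s := Ioi 0)
  rw [hasDerivWithinAt_iff_tendsto_slope' (by simp)] at hd'
  refine le_of_tendsto hd' ?_
  filter_upwards [h _ hs hc, self_mem_nhdsWithin] with t ht ht0
  have ht0' : (0 : ℝ) < t := ht0
  rw [slope_def_field, sub_zero, div_le_iff₀ ht0']
  simp only [zero_smul, smul_neg, neg_zero, sub_zero, sub_neg_eq_add]
  have hint : ∀ a : E3, Integrable fun x => f (x - a) * φ x := fun a => by
    have hfa : LocallyIntegrable (fun x => f (x - a)) volume := by
      rw [locallyIntegrable_iff]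
      intro K hK
      have hK' : IsCompact ((fun x => x - a) '' K) := hK.image (by fun_prop)
      have h2 := ((integrable_indicator_iff hK'.measurableSet).2
        (hf.integrableOn_isCompact hK')).comp_sub_right a
      refine (h2.integrableOn (s := K)).congr_fun (fun x hx => ?_) hK.measurableSet
      exact indicator_of_mem (mem_image_of_mem _ hx) f
    have := hfa.integrable_smul_right_of_hasCompactSupport hφ.continuous hc
    simpa using this
  have e1 : ∫ x, f x * φ (x + t • v) = ∫ x, f (x - t • v) * φ x := by
    rw [← integral_sub_right_eq_self _ (t • v)]
    simp
  have hint0 : Integrable fun x => f x * φ x := by simpa using hint 0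
  rw [e1, ← integral_sub (hint _) hint0]
  have hle : ‖∫ x, (f (x - t • v) * φ x - f x * φ x)‖ₑ ≤ ENNReal.ofReal (C * t) := by
    refine (enorm_integral_le_lintegral_enorm _).trans (le_trans ?_ ht)
    rw [← lintegral_indicator hc.isCompact.measurableSet]
    refine lintegral_mono fun x => ?_
    by_cases hx : x ∈ tsupport φ
    · rw [indicator_of_mem hx, ← sub_mul, enorm_mul]
      refine mul_le_of_le_one_right' ?_
      rw [Real.enorm_eq_ofReal_abs]
      exact ENNReal.ofReal_le_one.2 (h1 x)
    · rw [image_eq_zero_of_notMem_tsupport hx]; simp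
  rw [Real.enorm_eq_ofReal_abs] at hle
  exact (le_abs_self _).trans ((ENNReal.ofReal_le_ofReal_iff (by positivity)).1 hle)

theorem HasGradientAt.hasDerivAt_line {V : E3 → ℝ} {G x : E3} (h : HasGradientAt V G x) (e : E3) :
    HasDerivAt (fun t : ℝ => V (x + t • e)) (inner ℝ G e) 0 := by
  have h1 := h.hasFDerivAt
  have h2 : HasDerivAt (fun t : ℝ => x + t • e) e 0 := by
    simpa using ((hasDerivAt_id (0 : ℝ)).smul_const e).const_add x
  have h3 : HasFDerivAt V (InnerProductSpace.toDual ℝ E3 G) (x + (0 : ℝ) • e) := by simpa using h1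
  have h4 : HasDerivAt (fun t : ℝ => V (x + t • e)) (InnerProductSpace.toDual ℝ E3 G e) 0 :=
    h3.comp_hasDerivAt 0 h2
  rwa [InnerProductSpace.toDual_apply_apply] at h4

/-- Where a gradient exists, a one-sided derivative along a line determines its component. -/
theorem inner_gradient_eq {V : E3 → ℝ} {G x e : E3} (h : HasGradientAt V G x) {c : ℝ}
    (hc : HasDerivWithinAt (fun t : ℝ => V (x + t • e)) c (Ici 0) 0) : inner ℝ G e = c :=
  (uniqueDiffOn_Ici (0 : ℝ) 0 self_mem_Ici).eq_deriv _
    (HasGradientAt.hasDerivAt_line h e).hasDerivWithinAt hc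

/-- Where a gradient exists, a one-sided bound on difference quotients bounds its component. -/
theorem abs_inner_gradient_le {V : E3 → ℝ} {G x e : E3} (h : HasGradientAt V G x) {A : ℝ}
    (hA : ∀ᶠ t in 𝓝[>] (0 : ℝ), |V (x + t • e) - V x| ≤ A * t) : |inner ℝ G e| ≤ A := by
  have hd := (HasGradientAt.hasDerivAt_line h e).hasDerivWithinAt (s := Ioi 0)
  rw [hasDerivWithinAt_iff_tendsto_slope' (by simp)] at hd
  refine le_of_tendsto hd.abs ?_
  filter_upwards [hA, self_mem_nhdsWithin] with t ht ht0
  have ht0' : (0 : ℝ) < t := ht0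
  rw [slope_def_field, sub_zero, abs_div, abs_of_pos ht0', div_le_iff₀ ht0']
  simpa using ht

/-! ### The distance to the lateral faces -/

/-- The signed distance to the four faces of the unit cube that are parallel to the direction of
the second coordinate. -/
def depth (x : E3) : ℝ := min (min (x 0) (1 - x 0)) (min (x 2) (1 - x 2))

theorem abs_depth_sub_le (x y : E3) : |depth x - depth y| ≤ ‖x - y‖ := by
  have h : ∀ i, |x i - y i| ≤ ‖x - y‖ := fun i => by simpa using abs_coord_le_norm (x - y) i
  unfold depth
  refine (abs_min_sub_min_le_max _ _ _ _).trans (max_le ?_ ?_) <;>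
    refine (abs_min_sub_min_le_max _ _ _ _).trans (max_le (h _) ?_) <;>
    rw [sub_sub_sub_cancel_left, abs_sub_comm] <;> exact h _

theorem depth_le_half (x : E3) : depth x ≤ 1 / 2 := by
  have h := min_le_left (min (x 0) (1 - x 0)) (min (x 2) (1 - x 2))
  have h1 := h.trans (min_le_left _ _)
  have h2 := h.trans (min_le_right _ _)
  unfold depth
  linarith

theorem depth_congr {x y : E3} (h0 : x 0 = y 0) (h2 : x 2 = y 2) : depth x = depth y := by
  simp [depth, h0, h2]

theorem mem_cube_one_iff {x : E3} : x ∈ cube 1 ↔ x 1 ∈ Ioo 0 1 ∧ 0 < depth x := by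
  simp only [cube, depth, mem_ofPred_eq, Fin.forall_fin_succ, mem_Ioo, lt_min_iff, sub_pos]
  simp
  tauto

/-- An open cube of side `3` around the unit cube. -/
def bigCube : Set E3 := {x | ∀ i, x i ∈ Ioo (-1) 2}

theorem isOpen_bigCube : IsOpen bigCube := by
  have : bigCube = ⋂ i : Fin 3, (fun x : E3 => x i) ⁻¹' Ioo (-1) 2 := by ext; simp [bigCube]
  rw [this]
  exact isOpen_iInter_of_finite fun i => isOpen_Ioo.preimage (by fun_prop)

theorem cube_subset_bigCube : cube 1 ⊆ bigCube := fun x hx i =>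
  ⟨by linarith [(hx i).1], by linarith [(hx i).2]⟩

/-- The depth is locally one of `x i` and `1 - x i` with `i ≠ 1`; here the coordinate other than `1`
and `i`, which ranges over an interval of length `3`, is integrated out. -/
theorem lintegral_bigCube_coord_le (i : Fin 3) (hi : i ≠ 1) (F : ℝ → ℝ → ℝ≥0∞) :
    ∫⁻ x in bigCube, F (x 1) (x i) ≤ 3 * ∫⁻ s, ∫⁻ y in Ioo (-1) 2, F y s := by
  obtain ⟨j, hj⟩ : ∃ j : Fin 2, i.succAbove j = 1 := Fin.exists_succAbove_eq hi.symm
  set I := Ioo (-1 : ℝ) 2 with hI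
  have hIm : MeasurableSet I := measurableSet_Ioo
  set χ : ℝ → ℝ≥0∞ := I.indicator 1 with hχ
  have hχm : Measurable χ := measurable_one.indicator hIm
  have hχt : ∀ b, χ b ≠ ⊤ := fun b => by
    by_cases hb : b ∈ I <;> simp [hχ, hb]
  have hV : ∫⁻ c, χ c = 3 := by
    rw [lintegral_indicator_one hIm, hI, Real.volume_Ioo]
    norm_num
  have hH : ∀ H : ℝ → ℝ≥0∞, ∫⁻ y, χ y * H y = ∫⁻ y in I, H y := fun H => by
    rw [← lintegral_indicator hIm]
    refine lintegral_congr fun y => ?_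
    by_cases hy : y ∈ I <;> simp [hχ, hy]
  -- the coordinate different from `i` and `1` contributes the factor `3`
  have hpair : ∀ H : ℝ → ℝ≥0∞, ∫⁻ z : Fin 2 → ℝ, χ (z 0) * (χ (z 1) * H (z j)) ≤
      3 * ∫⁻ y in I, H y := by
    intro H
    have h1 := (volume_preserving_finTwoArrow ℝ).symm.lintegral_comp_emb
      (MeasurableEquiv.finTwoArrow (α := ℝ)).symm.measurableEmbedding
      (fun z : Fin 2 → ℝ => χ (z 0) * (χ (z 1) * H (z j)))
    rw [← h1, ← hH]
    refine (lintegral_prod_le _).trans (le_of_eq ?_)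
    have hcases : j = 0 ∨ j = 1 := by omega
    rcases hcases with rfl | rfl
    · have : ∀ b, ∫⁻ c, χ b * (χ c * H b) = χ b * H b * 3 := fun b => by
        rw [← hV, ← lintegral_const_mul _ hχm]
        exact lintegral_congr fun c => by ring
      calc _ = ∫⁻ b, ∫⁻ c, χ b * (χ c * H b) := rfl
        _ = _ := by simp only [this]; rw [lintegral_mul_const' _ _ (by simp), mul_comm]
    · calc _ = ∫⁻ b, ∫⁻ c, χ b * (χ c * H c) := rfl
        _ = ∫⁻ b, χ b * ∫⁻ c, χ c * H c :=
          lintegral_congr fun b => lintegral_const_mul' _ _ (hχt b)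
        _ = _ := by rw [lintegral_mul_const _ hχm, hV]
  have hE : ∫⁻ x in bigCube, F (x 1) (x i) ≤
      ∫⁻ z : Fin 3 → ℝ, χ (z (i.succAbove 0)) * (χ (z (i.succAbove 1)) * F (z 1) (z i)) := by
    have h1 :=
      (EuclideanSpace.volume_preserving_symm_measurableEquiv_toLp (Fin 3)).lintegral_comp_emb
      (MeasurableEquiv.toLp 2 (Fin 3 → ℝ)).symm.measurableEmbedding
      (fun z : Fin 3 → ℝ => χ (z (i.succAbove 0)) * (χ (z (i.succAbove 1)) * F (z 1) (z i)))
    rw [← h1, ← lintegral_indicator isOpen_bigCube.measurableSet]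
    refine lintegral_mono fun x => ?_
    by_cases hx : x ∈ bigCube
    · rw [indicator_of_mem hx]
      have e : ∀ k : Fin 3, χ (((MeasurableEquiv.toLp 2 (Fin 3 → ℝ)).symm x) k) = 1 := fun k =>
        indicator_of_mem (hx k) 1
      rw [e, e, one_mul, one_mul]
      exact le_rfl
    · rw [indicator_of_notMem hx]; exact zero_le
  refine hE.trans ?_
  have h2 := (volume_preserving_piFinSuccAbove (fun _ : Fin 3 => ℝ) i).symm.lintegral_comp_emb
      (MeasurableEquiv.piFinSuccAbove (fun _ : Fin 3 => ℝ) i).symm.measurableEmbedding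
      (fun z : Fin 3 → ℝ => χ (z (i.succAbove 0)) * (χ (z (i.succAbove 1)) * F (z 1) (z i)))
  rw [← h2]
  refine (lintegral_prod_le _).trans ?_
  rw [← lintegral_const_mul' _ _ (by simp)]
  refine lintegral_mono fun s => (le_trans (le_of_eq ?_) (hpair fun y => F y s))
  refine lintegral_congr fun z => ?_
  simp only [MeasurableEquiv.piFinSuccAbove_symm_apply, Fin.insertNthEquiv_apply,
    Fin.insertNth_apply_succAbove, Fin.insertNth_apply_same]
  rw [← hj, Fin.insertNth_apply_succAbove]

/-- Four faces contribute to the integral of a function of the depth. -/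
theorem lintegral_depth_le (F : ℝ → ℝ → ℝ≥0∞) :
    ∫⁻ x in bigCube, F (x 1) (depth x) ≤ 12 * ∫⁻ s, ∫⁻ y in Ioo (-1) 2, F y s := by
  set I := ∫⁻ s, ∫⁻ y in Ioo (-1 : ℝ) 2, F y s with hI
  have h0 : ∫⁻ x in bigCube, F (x 1) (x 0) ≤ 3 * I := lintegral_bigCube_coord_le 0 (by simp) F
  have h2 : ∫⁻ x in bigCube, F (x 1) (x 2) ≤ 3 * I := lintegral_bigCube_coord_le 2 (by simp) F
  have hI' : ∫⁻ s, ∫⁻ y in Ioo (-1 : ℝ) 2, F y (1 - s) = I :=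
    lintegral_sub_left_eq_self (fun s => ∫⁻ y in Ioo (-1 : ℝ) 2, F y s) 1
  have h0' : ∫⁻ x in bigCube, F (x 1) (1 - x 0) ≤ 3 * I := by
    rw [← hI']; exact lintegral_bigCube_coord_le 0 (by simp) fun y s => F y (1 - s)
  have h2' : ∫⁻ x in bigCube, F (x 1) (1 - x 2) ≤ 3 * I := by
    rw [← hI']; exact lintegral_bigCube_coord_le 2 (by simp) fun y s => F y (1 - s)
  have hpart : ∀ l : E3 → ℝ, Measurable l → ∫⁻ x in bigCube, F (x 1) (l x) ≤ 3 * I →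
      ∫⁻ x in bigCube ∩ {x | depth x = l x}, F (x 1) (depth x) ≤ 3 * I := by
    intro l hl h
    have hd : Measurable depth := by unfold depth; fun_prop
    have hm : MeasurableSet (bigCube ∩ {x | depth x = l x}) :=
      isOpen_bigCube.measurableSet.inter (measurableSet_eq_fun hd hl)
    calc ∫⁻ x in bigCube ∩ {x | depth x = l x}, F (x 1) (depth x)
        = ∫⁻ x in bigCube ∩ {x | depth x = l x}, F (x 1) (l x) :=
          setLIntegral_congr_fun hm fun x hx => by
            have : depth x = l x := hx.2
            rw [this]
      _ ≤ _ := (lintegral_mono_set inter_subset_left).trans h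
  have hcov : bigCube ⊆ ((bigCube ∩ {x | depth x = x 0}) ∪ (bigCube ∩ {x | depth x = 1 - x 0})) ∪
      ((bigCube ∩ {x | depth x = x 2}) ∪ (bigCube ∩ {x | depth x = 1 - x 2})) := by
    intro x hx
    rcases min_choice (min (x 0) (1 - x 0)) (min (x 2) (1 - x 2)) with h | h
    · refine Or.inl ?_
      rcases min_choice (x 0) (1 - x 0) with h' | h'
      · exact Or.inl ⟨hx, h.trans h'⟩
      · exact Or.inr ⟨hx, h.trans h'⟩
    · refine Or.inr ?_
      rcases min_choice (x 2) (1 - x 2) with h' | h'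
      · exact Or.inl ⟨hx, h.trans h'⟩
      · exact Or.inr ⟨hx, h.trans h'⟩
  refine (lintegral_mono_set hcov).trans ((lintegral_union_le _ _ _).trans ((add_le_add
    ((lintegral_union_le _ _ _).trans (add_le_add (hpart _ (by fun_prop) h0)
      (hpart _ (by fun_prop) h0'))) ((lintegral_union_le _ _ _).trans (add_le_add
        (hpart _ (by fun_prop) h2) (hpart _ (by fun_prop) h2')))).trans (le_of_eq ?_)))
  ring

/-! ### The one-dimensional ingredients of the construction -/

/-- The function that increases linearly from `0` to `1` on `[0, b]`. -/
noncomputable def ramp (b ρ : ℝ) : ℝ := max 0 (min 1 (ρ / b))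

theorem ramp_of_nonpos {b ρ : ℝ} (hb : 0 < b) (h : ρ ≤ 0) : ramp b ρ = 0 :=
  max_eq_left ((min_le_right _ _).trans (div_nonpos_of_nonpos_of_nonneg h hb.le))

theorem ramp_of_le {b ρ : ℝ} (hb : 0 < b) (h : b ≤ ρ) : ramp b ρ = 1 := by
  rw [ramp, min_eq_left ((one_le_div hb).2 h), max_eq_right zero_le_one]

theorem ramp_of_mem {b ρ : ℝ} (hb : 0 < b) (h : ρ ∈ Icc 0 b) : ramp b ρ = ρ / b := by
  rw [ramp, min_eq_right ((div_le_one hb).2 h.2), max_eq_right (div_nonneg h.1 hb.le)]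

theorem abs_ramp_sub_le_left {b : ℝ} (hb : 0 < b) (ρ ρ' : ℝ) :
    |ramp b ρ - ramp b ρ'| ≤ |ρ - ρ'| / b := by
  have h1 : |ramp b ρ - ramp b ρ'| ≤ |min 1 (ρ / b) - min 1 (ρ' / b)| := by
    have := abs_max_sub_max_le_max 0 (min 1 (ρ / b)) 0 (min 1 (ρ' / b))
    simpa [ramp] using this
  have h2 : |min 1 (ρ / b) - min 1 (ρ' / b)| ≤ |ρ / b - ρ' / b| := by
    have := abs_min_sub_min_le_max 1 (ρ / b) 1 (ρ' / b)
    simpa using this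
  refine h1.trans (h2.trans (le_of_eq ?_))
  rw [← sub_div, abs_div, abs_of_pos hb]

theorem abs_ramp_sub_le_right {b b' : ℝ} (hb : 0 < b) (hb' : 0 < b') (ρ : ℝ) :
    |ramp b ρ - ramp b' ρ| ≤ |b - b'| / b := by
  have key : ∀ b₁ b₂ : ℝ, 0 < b₁ → b₁ ≤ b₂ →
      0 ≤ ramp b₁ ρ - ramp b₂ ρ ∧ ramp b₁ ρ - ramp b₂ ρ ≤ (b₂ - b₁) / b₂ := by
    intro b₁ b₂ h1 h12
    have h2 := h1.trans_le h12
    rcases le_total ρ 0 with h0 | h0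
    · rw [ramp_of_nonpos h1 h0, ramp_of_nonpos h2 h0, sub_self]
      exact ⟨le_rfl, div_nonneg (by linarith) h2.le⟩
    rcases le_total b₂ ρ with h3 | h3
    · rw [ramp_of_le h1 (h12.trans h3), ramp_of_le h2 h3, sub_self]
      exact ⟨le_rfl, div_nonneg (by linarith) h2.le⟩
    rw [ramp_of_mem h2 ⟨h0, h3⟩]
    rcases le_total b₁ ρ with h4 | h4
    · rw [ramp_of_le h1 h4]
      constructor
      · rw [sub_nonneg, div_le_one h2]; exact h3
      · rw [sub_le_iff_le_add, ← add_div, one_le_div h2]; linarith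
    · rw [ramp_of_mem h1 ⟨h0, h4⟩]
      constructor
      · rw [sub_nonneg]; gcongr
      · have : ρ / b₁ - ρ / b₂ = ρ / b₁ * ((b₂ - b₁) / b₂) := by field_simp
        rw [this]
        exact mul_le_of_le_one_left (div_nonneg (by linarith) h2.le) ((div_le_one h1).2 h4)
  rcases le_total b b' with h | h
  · obtain ⟨h1, h2⟩ := key b b' hb h
    rw [abs_of_nonneg h1, abs_sub_comm, abs_of_nonneg (by linarith)]
    refine h2.trans ?_
    gcongr
  · obtain ⟨h1, h2⟩ := key b' b hb' h
    rw [abs_sub_comm, abs_of_nonneg h1, abs_of_nonneg (by linarith)]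
    exact h2

open Classical in
theorem hasDerivWithinAt_ramp {b : ℝ} (hb : 0 < b) (ρ : ℝ) :
    HasDerivWithinAt (ramp b) (if ρ ∈ Ico 0 b then 1 / b else 0) (Ici ρ) ρ := by
  have hconst : ∀ c ρ' : ℝ, ρ < ρ' → (∀ r ∈ Ico ρ ρ', ramp b r = c) →
      HasDerivWithinAt (ramp b) 0 (Ici ρ) ρ := fun c ρ' h1 h2 =>
    (hasDerivWithinAt_const ρ (Ici ρ) c).congr_of_eventuallyEq
      (by filter_upwards [Ico_mem_nhdsGE h1] with r hr using h2 r hr) (h2 ρ ⟨le_rfl, h1⟩)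
  by_cases h : ρ ∈ Ico 0 b
  · rw [if_pos h]
    have hd : HasDerivWithinAt (fun r : ℝ => r / b) (1 / b) (Ici ρ) ρ :=
      ((hasDerivAt_id ρ).div_const b).hasDerivWithinAt
    have he : ∀ r ∈ Ico ρ b, ramp b r = r / b := fun r hr =>
      ramp_of_mem hb ⟨h.1.trans hr.1, hr.2.le⟩
    exact hd.congr_of_eventuallyEq
      (by filter_upwards [Ico_mem_nhdsGE h.2] with r hr using he r hr) (he ρ ⟨le_rfl, h.2⟩)
  · rw [if_neg h]
    rcases lt_or_ge ρ 0 with h0 | h0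
    · exact hconst 0 0 h0 fun r hr => ramp_of_nonpos hb hr.2.le
    · have hbρ : b ≤ ρ := not_lt.1 fun h' => h ⟨h0, h'⟩
      exact hconst 1 (ρ + 1) (by linarith) fun r hr => ramp_of_le hb (hbρ.trans hr.1)

/-- The refinement parameter at depth `s`: it is `s ^ (2/3)`, made Lipschitz below depth `δ`. With
this exponent the elastic energy density, of the order of the squared derivative `s ^ (-2/3)`, and
the number of needles, of the order of `s ^ (-2/3)`, are both integrable in `s`. -/
noncomputable def fineness (δ s : ℝ) : ℝ := max s 0 * max s δ ^ (-(1 / 3) : ℝ)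

section fineness

variable {δ : ℝ}

theorem fineness_of_nonpos {s : ℝ} (hs : s ≤ 0) : fineness δ s = 0 := by
  simp [fineness, hs]

theorem fineness_nonneg (hδ : 0 < δ) (s : ℝ) : 0 ≤ fineness δ s := by
  have : 0 < max s δ := hδ.trans_le (le_max_right _ _)
  unfold fineness; positivity

theorem fineness_pos (hδ : 0 < δ) {s : ℝ} (hs : 0 < s) : 0 < fineness δ s := by
  have : 0 < max s δ := hδ.trans_le (le_max_right _ _)
  unfold fineness; positivity

theorem fineness_eq (hδ : 0 < δ) {s : ℝ} (hs : δ ≤ s) : fineness δ s = s ^ (2 / 3 : ℝ) := by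
  have hs0 := hδ.trans_le hs
  rw [fineness, max_eq_left hs, max_eq_left hs0.le]
  nth_rewrite 1 [← Real.rpow_one s]
  rw [← Real.rpow_add hs0]
  norm_num

theorem fineness_mono (hδ : 0 < δ) {s s' : ℝ} (h : s ≤ s') : fineness δ s ≤ fineness δ s' := by
  rcases le_total s' δ with h1 | h1
  · rw [fineness, fineness, max_eq_right h1, max_eq_right (h.trans h1)]
    gcongr
  · rcases le_total s δ with h2 | h2
    · have : fineness δ s ≤ fineness δ δ := by
        rw [fineness, fineness, max_eq_right h2, max_self]
        gcongr
      refine this.trans ?_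
      rw [fineness_eq hδ le_rfl, fineness_eq hδ h1]
      gcongr
    · rw [fineness_eq hδ h2, fineness_eq hδ h1]
      have := hδ.trans_le h2
      gcongr

theorem fineness_le_one (hδ : 0 < δ) (hδ1 : δ ≤ 1) {s : ℝ} (hs : s ≤ 1) : fineness δ s ≤ 1 := by
  refine (fineness_mono hδ hs).trans ?_
  rw [fineness_eq hδ hδ1, Real.one_rpow]

theorem fineness_sub_le (hδ : 0 < δ) {s s' : ℝ} (h : s ≤ s') :
    fineness δ s' - fineness δ s ≤ max s δ ^ (-(1 / 3) : ℝ) * (s' - s) := by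
  have hA : 0 < max s δ := hδ.trans_le (le_max_right _ _)
  have hB : max s' δ ^ (-(1 / 3) : ℝ) ≤ max s δ ^ (-(1 / 3) : ℝ) :=
    Real.rpow_le_rpow_of_nonpos hA (max_le_max h le_rfl) (by norm_num)
  have h0 : max s' 0 - max s 0 ≤ s' - s := by
    have : max s' 0 ≤ max s 0 + (s' - s) := by
      refine max_le ?_ ?_
      · linarith [le_max_left s 0]
      · linarith [le_max_right s 0]
    linarith
  unfold fineness
  set A := max s δ ^ (-(1 / 3) : ℝ)
  have hA0 : 0 ≤ A := by positivity
  calc max s' 0 * max s' δ ^ (-(1 / 3) : ℝ) - max s 0 * A ≤ max s' 0 * A - max s 0 * A := by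
        gcongr
    _ = A * (max s' 0 - max s 0) := by ring
    _ ≤ A * (s' - s) := by gcongr

/-- The refinement parameter has slope at most `b ^ (-1/3)` at depths above `b`, and at most `δ ^
(-1/3)` throughout. -/
theorem abs_fineness_sub_le (hδ : 0 < δ) {s s' b : ℝ} (hb : 0 < b) (h : b ≤ max s δ)
    (h' : b ≤ max s' δ) : |fineness δ s - fineness δ s'| ≤ b ^ (-(1 / 3) : ℝ) * |s - s'| := by
  wlog hs : s' ≤ s generalizing s s'
  · rw [abs_sub_comm, abs_sub_comm s]; exact this h' h (not_le.1 hs).le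
  rw [abs_of_nonneg (sub_nonneg.2 (fineness_mono hδ hs)), abs_of_nonneg (sub_nonneg.2 hs)]
  refine (fineness_sub_le hδ hs).trans ?_
  have := Real.rpow_le_rpow_of_nonpos hb h' (by norm_num : (-(1 / 3) : ℝ) ≤ 0)
  gcongr

theorem half_fineness_le (hδ : 0 < δ) {s s' : ℝ} (hs : δ ≤ s) (h : s / 2 ≤ s') :
    fineness δ s / 2 ≤ fineness δ s' := by
  refine le_trans ?_ (fineness_mono hδ h)
  have hs0 := hδ.trans_le hs
  have h1 : max (s / 2) δ ≤ s := max_le (by linarith) hs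
  have h2 : s ^ (-(1 / 3) : ℝ) ≤ max (s / 2) δ ^ (-(1 / 3) : ℝ) :=
    Real.rpow_le_rpow_of_nonpos (hδ.trans_le (le_max_right _ _)) h1 (by norm_num)
  rw [fineness, fineness, max_eq_left hs, max_eq_left hs0.le, max_eq_left (by linarith)]
  have := mul_le_mul_of_nonneg_left h2 (by linarith : 0 ≤ s / 2)
  linarith

end fineness

/-! ### Sums over cells -/

/-- Each point of `[0, 1)` lies in exactly one cell; for the others, the relative coordinate is
negative or beyond the cell, where the profile of a cell is constant. -/
theorem exists_cell_index {N : ℕ} (hN : 0 < N) {y : ℝ} (hy : y ∈ Ico (0 : ℝ) 1) :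
    ∃ n ∈ Finset.range N, y - n * (1 / N) ∈ Ico (0 : ℝ) (1 / N) ∧
      ∀ m ∈ Finset.range N, m ≠ n → y - m * (1 / N : ℝ) < 0 ∨ (1 / N : ℝ) ≤ y - m * (1 / N) := by
  have hN0 : (0 : ℝ) < N := by exact_mod_cast hN
  have h1 := Nat.floor_le (mul_nonneg hN0.le hy.1)
  have h2 := Nat.lt_floor_add_one (N * y)
  set n := ⌊N * y⌋₊ with hn
  have e : ∀ m : ℝ, y - m * (1 / N) = (N * y - m) / N := fun m => by field_simp
  refine ⟨n, ?_, ?_, ?_⟩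
  · rw [Finset.mem_range, hn, Nat.floor_lt (mul_nonneg hN0.le hy.1)]
    nlinarith [hy.2]
  · rw [e]
    exact ⟨div_nonneg (by linarith) hN0.le, by gcongr; linarith⟩
  · intro m _ hmn
    rw [e]
    rcases lt_or_gt_of_ne hmn with h | h
    · right
      have : (m : ℝ) + 1 ≤ n := by exact_mod_cast h
      gcongr
      linarith
    · left
      have : (n : ℝ) + 1 ≤ m := by exact_mod_cast h
      exact div_neg_of_neg_of_pos (by linarith) hN0

theorem cell_of_neg {y h : ℝ} (hh : 0 < h) (hy : y ≤ 0) (n : ℕ) : y - n * h ≤ 0 := by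
  have : 0 ≤ n * h := by positivity
  linarith

theorem cell_of_one_le {N : ℕ} {y : ℝ} (hy : 1 ≤ y) {n : ℕ} (hn : n ∈ Finset.range N) :
    1 / N ≤ y - n * (1 / N : ℝ) := by
  have h1 : (n : ℝ) + 1 ≤ N := by exact_mod_cast Finset.mem_range.1 hn
  have hN0 : (0 : ℝ) < N := by
    have : (0 : ℝ) ≤ n := Nat.cast_nonneg n
    linarith
  have h2 : (n : ℝ) * (1 / N) + 1 / N ≤ 1 := by
    rw [← add_one_mul, mul_one_div, div_le_one hN0]; exact h1
  linarith

/-! ### The construction with needles -/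

/-- The parameters of a construction with `N` families of needles. Each has width `w` in a cell of
width `1 / N`, and contains needles of volume fraction `a`. In the lateral layer of width `δ` the
second slip system is inactive. The number `K` is a Lipschitz constant of the branched profile with
respect to the refinement parameter; since the latter has slope at most `δ ^ (-1/3)`, the condition
`K ^ 3 ≤ δ` bounds the slope of the needle boundaries by `1`. -/
structure NeedleData where
  N : ℕ
  θ : ℝ
  a : ℝ
  w : ℝ
  δ : ℝ
  K : ℝ
  N_pos : 0 < N
  θ_pos : 0 < θ
  a_pos : 0 < a
  a_le : a ≤ 1
  w_pos : 0 < w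
  w_le : w ≤ 1 / N
  a_mul_w : a * w = θ * (1 / N)
  δ_pos : 0 < δ
  δ_le : δ ≤ 1
  K_nonneg : 0 ≤ K
  K_cube_le : K ^ 3 ≤ δ
  lipschitz : ∀ ρ κ κ' : ℝ, κ ∈ Icc 0 1 → κ' ∈ Icc 0 1 →
    |branch a w (min ρ w) κ - branch a w (min ρ w) κ'| ≤ K * |κ - κ'|

namespace NeedleData

variable (p : NeedleData)

/-- The width of a cell. -/
noncomputable def h : ℝ := 1 / p.N

theorem N_pos' : (0 : ℝ) < p.N := by exact_mod_cast p.N_pos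

theorem h_pos : 0 < p.h := one_div_pos.2 p.N_pos'

theorem h_le_one : p.h ≤ 1 := by
  rw [h, div_le_one p.N_pos']
  exact_mod_cast p.N_pos

theorem N_mul_h : p.N * p.h = 1 := mul_one_div_cancel p.N_pos'.ne'

theorem w_le_h : p.w ≤ p.h := p.w_le

theorem a_mul_w' : p.a * p.w = p.θ * p.h := p.a_mul_w

/-- The width of the transition region at depth `s`; outside the cube it grows linearly. -/
noncomputable def outer (s : ℝ) : ℝ := min (p.w + max (-s) 0) p.h

theorem w_le_outer (s : ℝ) : p.w ≤ p.outer s :=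
  le_min (by linarith [le_max_right (-s) 0]) p.w_le_h

theorem outer_pos (s : ℝ) : 0 < p.outer s := p.w_pos.trans_le (p.w_le_outer s)

theorem outer_le (s : ℝ) : p.outer s ≤ p.h := min_le_right _ _

theorem outer_of_nonneg {s : ℝ} (hs : 0 ≤ s) : p.outer s = p.w := by
  rw [outer, max_eq_right (by linarith), add_zero, min_eq_left p.w_le_h]

theorem abs_outer_sub_le (s s' : ℝ) : |p.outer s - p.outer s'| ≤ |s - s'| := by
  unfold outer
  refine (abs_min_sub_min_le_max _ _ _ _).trans ?_
  rw [sub_self, abs_zero, max_eq_left (abs_nonneg _), add_sub_add_left_eq_sub]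
  refine (abs_max_sub_max_le_max _ _ _ _).trans ?_
  rw [sub_self, abs_zero, max_eq_left (abs_nonneg _), neg_sub_neg, abs_sub_comm]

/-- The profile of a single cell: branched needles inside, a linear transition outside. -/
noncomputable def profile (ρ s : ℝ) : ℝ :=
  branch p.a p.w (min ρ p.w) (fineness p.δ s) +
    p.a * p.w * (ramp (p.outer s) ρ - ramp p.w ρ)

theorem fineness_mem {s : ℝ} (hs : s ≤ 1) : fineness p.δ s ∈ Icc (0 : ℝ) 1 :=
  ⟨fineness_nonneg p.δ_pos s, fineness_le_one p.δ_pos p.δ_le hs⟩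

/-- Inside, only the branched needles are left. -/
theorem profile_of_nonneg {s : ℝ} (hs : 0 ≤ s) (ρ : ℝ) :
    p.profile ρ s = branch p.a p.w (min ρ p.w) (fineness p.δ s) := by
  rw [profile, outer_of_nonneg p hs, sub_self, mul_zero, add_zero]

/-- Outside, only the linear transition is left, since the branched profile is linear on the lateral
faces. -/
theorem profile_of_nonpos {s : ℝ} (hs : s ≤ 0) (ρ : ℝ) :
    p.profile ρ s = p.a * p.w * ramp (p.outer s) ρ := by
  have hb : branch p.a p.w (min ρ p.w) 0 = p.a * p.w * ramp p.w ρ := by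
    rcases le_total ρ 0 with h0 | h0
    · rw [min_eq_left (h0.trans p.w_pos.le), branch_of_nonpos p.a_pos.le p.w_pos.le h0 zero_le_one,
        ramp_of_nonpos p.w_pos h0, mul_zero]
    rcases le_total ρ p.w with h1 | h1
    · rw [min_eq_left h1, branch_zero p.a_pos.le p.a_le p.w_pos.le h0 h1,
        ramp_of_mem p.w_pos ⟨h0, h1⟩]
      have := p.w_pos
      field_simp
    · rw [min_eq_right h1, branch_width p.a_pos.le p.a_le p.w_pos.le zero_le_one,
        ramp_of_le p.w_pos h1, mul_one]
  rw [profile, fineness_of_nonpos hs, hb]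
  ring

theorem profile_of_nonpos_left {ρ s : ℝ} (hs : s ≤ 1) (hρ : ρ ≤ 0) : p.profile ρ s = 0 := by
  rw [profile, min_eq_left (hρ.trans p.w_pos.le),
    branch_of_nonpos p.a_pos.le p.w_pos.le hρ (p.fineness_mem hs).2,
    ramp_of_nonpos (p.outer_pos s) hρ, ramp_of_nonpos p.w_pos hρ]
  simp

theorem profile_of_outer_le {ρ s : ℝ} (hs : s ≤ 1) (hρ : p.outer s ≤ ρ) :
    p.profile ρ s = p.a * p.w := by
  have h1 := (p.w_le_outer s).trans hρ
  rw [profile, min_eq_right h1, branch_width p.a_pos.le p.a_le p.w_pos.le (p.fineness_mem hs).2,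
    ramp_of_le (p.outer_pos s) hρ, ramp_of_le p.w_pos h1]
  ring

theorem abs_profile_sub_le {ρ ρ' s s' : ℝ} (hs : s ≤ 1) (hs' : s' ≤ 1) :
    |p.profile ρ s - p.profile ρ' s'| ≤
      (1 + p.K * p.δ ^ (-(1 / 3) : ℝ) + p.a * p.w * (2 / p.w)) * (|ρ - ρ'| + |s - s'|) := by
  have haw : 0 ≤ p.a * p.w := mul_nonneg p.a_pos.le p.w_pos.le
  have hδK : 0 ≤ p.K * p.δ ^ (-(1 / 3) : ℝ) :=
    mul_nonneg p.K_nonneg (Real.rpow_nonneg p.δ_pos.le _)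
  have h1 : |branch p.a p.w (min ρ p.w) (fineness p.δ s) -
      branch p.a p.w (min ρ' p.w) (fineness p.δ s)| ≤ |ρ - ρ'| := by
    refine (abs_branch_sub_le_left p.a_pos.le p.w_pos.le _ _ _).trans
      ((abs_min_sub_min_le_max _ _ _ _).trans ?_)
    simp
  have h2 : |branch p.a p.w (min ρ' p.w) (fineness p.δ s) -
      branch p.a p.w (min ρ' p.w) (fineness p.δ s')| ≤ p.K * p.δ ^ (-(1 / 3) : ℝ) * |s - s'| := by
    refine (p.lipschitz _ _ _ (p.fineness_mem hs) (p.fineness_mem hs')).trans ?_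
    rw [mul_assoc]
    exact mul_le_mul_of_nonneg_left (abs_fineness_sub_le p.δ_pos p.δ_pos (le_max_right _ _)
      (le_max_right _ _)) p.K_nonneg
  have h3 : |ramp (p.outer s) ρ - ramp (p.outer s') ρ'| ≤ (|ρ - ρ'| + |s - s'|) / p.w := by
    have e1 := abs_ramp_sub_le_left (p.outer_pos s) ρ ρ'
    have e2 := abs_ramp_sub_le_right (p.outer_pos s) (p.outer_pos s') ρ'
    have e3 : |ρ - ρ'| / p.outer s ≤ |ρ - ρ'| / p.w :=
      div_le_div_of_nonneg_left (abs_nonneg _) p.w_pos (p.w_le_outer s)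
    have e4 : |p.outer s - p.outer s'| / p.outer s ≤ |s - s'| / p.w :=
      div_le_div₀ (abs_nonneg _) (p.abs_outer_sub_le s s') p.w_pos (p.w_le_outer s)
    rw [add_div]
    refine (abs_sub_le _ (ramp (p.outer s) ρ') _).trans ?_
    linarith
  have h4 : |ramp p.w ρ - ramp p.w ρ'| ≤ (|ρ - ρ'| + |s - s'|) / p.w := by
    refine (abs_ramp_sub_le_left p.w_pos ρ ρ').trans ?_
    have := p.w_pos
    gcongr
    linarith [abs_nonneg (s - s')]
  unfold profile
  set B₁ := branch p.a p.w (min ρ p.w) (fineness p.δ s)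
  set B₂ := branch p.a p.w (min ρ' p.w) (fineness p.δ s)
  set B₃ := branch p.a p.w (min ρ' p.w) (fineness p.δ s')
  set R₁ := ramp (p.outer s) ρ
  set R₂ := ramp (p.outer s') ρ'
  set R₃ := ramp p.w ρ
  set R₄ := ramp p.w ρ'
  have e : B₁ + p.a * p.w * (R₁ - R₃) - (B₃ + p.a * p.w * (R₂ - R₄)) =
      (B₁ - B₂) + (B₂ - B₃) + p.a * p.w * ((R₁ - R₂) - (R₃ - R₄)) := by ring
  rw [e]
  have h5 : |p.a * p.w * ((R₁ - R₂) - (R₃ - R₄))| ≤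
      p.a * p.w * (2 / p.w) * (|ρ - ρ'| + |s - s'|) := by
    rw [abs_mul, abs_of_nonneg haw]
    refine (mul_le_mul_of_nonneg_left ((abs_sub _ _).trans (add_le_add h3 h4)) haw).trans
      (le_of_eq ?_)
    ring
  refine (abs_add_three _ _ _).trans ?_
  rw [add_mul, add_mul, one_mul]
  refine add_le_add (add_le_add (h1.trans (le_add_of_nonneg_right (abs_nonneg _)))
    (h2.trans ?_)) h5
  exact mul_le_mul_of_nonneg_left (le_add_of_nonneg_left (abs_nonneg _)) hδK

/-- The corrector, as a function of the coordinate `y` across the cells and the depth `s`. -/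
noncomputable def planar (y s : ℝ) : ℝ :=
  (∑ n ∈ Finset.range p.N, p.profile (y - n * p.h) s) - p.θ * ramp 1 y

/-- The corrector `Z`: the deformation is `u₀ - √2 Z`. -/
noncomputable def corrector (x : E3) : ℝ := p.planar (x 1) (depth x)

theorem planar_of_nonpos {y s : ℝ} (hs : s ≤ 1) (hy : y ≤ 0) : p.planar y s = 0 := by
  rw [planar, ramp_of_nonpos one_pos hy, Finset.sum_eq_zero fun n _ =>
    p.profile_of_nonpos_left hs (cell_of_neg p.h_pos hy n)]
  simp

theorem planar_of_one_le {y s : ℝ} (hs : s ≤ 1) (hy : 1 ≤ y) : p.planar y s = 0 := by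
  have h1 : ∀ n ∈ Finset.range p.N, p.profile (y - n * p.h) s = p.a * p.w := fun n hn =>
    p.profile_of_outer_le hs ((p.outer_le s).trans (cell_of_one_le hy hn))
  rw [planar, ramp_of_le one_pos hy, Finset.sum_congr rfl h1, Finset.sum_const,
    Finset.card_range, nsmul_eq_mul, p.a_mul_w']
  have := p.N_mul_h
  linear_combination p.θ * this

theorem exists_lipschitz_corrector : ∃ C : ℝ≥0, LipschitzWith C p.corrector := by
  set c := 1 + p.K * p.δ ^ (-(1 / 3) : ℝ) + p.a * p.w * (2 / p.w) with hc
  have hc0 : 0 ≤ c := by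
    have := p.K_nonneg; have := p.δ_pos; have := p.a_pos; have := p.w_pos
    positivity
  have hC0 : 0 ≤ p.N * (c * 2) + p.θ := by have := p.θ_pos; positivity
  refine ⟨⟨_, hC0⟩, LipschitzWith.of_dist_le_mul fun x y => ?_⟩
  rw [Real.dist_eq, dist_eq_norm]
  change |p.corrector x - p.corrector y| ≤ (p.N * (c * 2) + p.θ) * ‖x - y‖
  have hd : ∀ z : E3, depth z ≤ 1 := fun z => (depth_le_half z).trans (by norm_num)
  have h1 : |x 1 - y 1| ≤ ‖x - y‖ := by simpa using abs_coord_le_norm (x - y) 1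
  have h2 := abs_depth_sub_le x y
  have hr : |ramp 1 (x 1) - ramp 1 (y 1)| ≤ ‖x - y‖ := by
    refine (abs_ramp_sub_le_left one_pos _ _).trans ?_
    rwa [div_one]
  have hs : |(∑ n ∈ Finset.range p.N, p.profile (x 1 - n * p.h) (depth x)) -
      ∑ n ∈ Finset.range p.N, p.profile (y 1 - n * p.h) (depth y)| ≤ p.N * (c * 2) * ‖x - y‖ := by
    rw [← Finset.sum_sub_distrib]
    refine (Finset.abs_sum_le_sum_abs _ _).trans ?_
    calc _ ≤ ∑ n ∈ Finset.range p.N, c * 2 * ‖x - y‖ := by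
          refine Finset.sum_le_sum fun n _ => (p.abs_profile_sub_le (hd x) (hd y)).trans ?_
          rw [sub_sub_sub_cancel_right, ← hc, mul_assoc c]
          exact mul_le_mul_of_nonneg_left (by linarith) hc0
      _ = _ := by rw [Finset.sum_const, Finset.card_range, nsmul_eq_mul]; ring
  unfold corrector planar
  set S₁ := ∑ n ∈ Finset.range p.N, p.profile (x 1 - n * p.h) (depth x)
  set S₂ := ∑ n ∈ Finset.range p.N, p.profile (y 1 - n * p.h) (depth y)
  have e : S₁ - p.θ * ramp 1 (x 1) - (S₂ - p.θ * ramp 1 (y 1)) =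
    (S₁ - S₂) - p.θ * (ramp 1 (x 1) - ramp 1 (y 1)) := by ring
  rw [e, add_mul]
  refine (abs_sub _ _).trans (add_le_add hs ?_)
  rw [abs_mul, abs_of_pos p.θ_pos]
  exact mul_le_mul_of_nonneg_left hr p.θ_pos.le

end NeedleData

/-! ### The strain of the construction -/

theorem inner_single_one (v : E3) (i : Fin 3) :
    inner ℝ v (EuclideanSpace.single i (1 : ℝ)) = v i := by
  simp [EuclideanSpace.inner_single_right]

theorem sq_norm_eq (v : E3) : ‖v‖ ^ 2 = v 0 ^ 2 + v 1 ^ 2 + v 2 ^ 2 := by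
  rw [EuclideanSpace.norm_sq_eq, Fin.sum_univ_three]
  simp

/-- If the corrector has gradient `G`, and a fraction `c` of the slip is on the second system, then
the component of the strain across the cells is proportional to `G 1 + θ - c`. -/
theorem sq_norm_farGrad_sub (θ c : ℝ) (G : E3) :
    ‖(farGrad θ - √2 • G) - (c • eEta + (1 - c) • eXi)‖ ^ 2 =
      2 * (G 0 ^ 2 + (G 1 + θ - c) ^ 2 + G 2 ^ 2) := by
  have h2 : √2 ^ 2 = (2 : ℝ) := Real.sq_sqrt zero_le_two
  have h0 : (√2 : ℝ) ≠ 0 := by positivity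
  rw [sq_norm_eq]
  simp only [farGrad, eXi, eEta, PiLp.sub_apply, PiLp.add_apply, PiLp.smul_apply, smul_eq_mul,
    Matrix.cons_val_zero, Matrix.cons_val_one, Matrix.cons_val]
  have e : (1 : ℝ) / √2 = √2 / 2 := by field_simp; exact h2.symm
  rw [e]
  ring_nf
  rw [h2]
  ring

namespace NeedleData

variable (p : NeedleData)

open Classical in
theorem hasDerivWithinAt_profile_of_pos {s : ℝ} (hs : 0 < s) (hs1 : s ≤ 1) (ρ : ℝ) :
    HasDerivWithinAt (fun ρ => p.profile ρ s)
      (if Needle p.a p.w ρ (fineness p.δ s) then 1 else 0) (Ici ρ) ρ := by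
  simp only [p.profile_of_nonneg hs.le]
  exact hasDerivWithinAt_branch p.a_pos.le p.w_pos (fineness_pos p.δ_pos hs)
    (p.fineness_mem hs1).2 ρ

open Classical in
theorem hasDerivWithinAt_profile_of_nonpos {s : ℝ} (hs : s ≤ 0) (ρ : ℝ) :
    HasDerivWithinAt (fun ρ => p.profile ρ s)
      (p.a * p.w * if ρ ∈ Ico 0 (p.outer s) then 1 / p.outer s else 0) (Ici ρ) ρ := by
  simp only [p.profile_of_nonpos hs]
  exact (hasDerivWithinAt_ramp (p.outer_pos s) ρ).const_mul _

theorem hasDerivWithinAt_planar {y s : ℝ} (hy : y ∈ Ico (0 : ℝ) 1) {D : ℝ → ℝ}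
    (hD : ∀ ρ, HasDerivWithinAt (fun ρ => p.profile ρ s) (D ρ) (Ici ρ) ρ) :
    HasDerivWithinAt (fun y => p.planar y s)
      ((∑ n ∈ Finset.range p.N, D (y - n * p.h)) - p.θ) (Ici y) y := by
  classical
  have h1 : ∀ n ∈ Finset.range p.N,
      HasDerivWithinAt (fun y => p.profile (y - n * p.h) s) (D (y - n * p.h)) (Ici y) y := by
    intro n _
    have hc : HasDerivWithinAt (fun y : ℝ => y - n * p.h) 1 (Ici y) y :=
      ((hasDerivAt_id y).sub_const _).hasDerivWithinAt
    have := (hD (y - n * p.h)).comp y hc (fun z hz => sub_le_sub_right (mem_Ici.1 hz) _)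
    rwa [mul_one] at this
  have h2 : HasDerivWithinAt (fun y => p.θ * ramp 1 y) p.θ (Ici y) y := by
    have := (hasDerivWithinAt_ramp one_pos y).const_mul p.θ
    rwa [if_pos hy, div_one, mul_one] at this
  exact (HasDerivWithinAt.fun_sum h1).sub h2

section gradient

variable {G x : E3}

theorem depth_le_one (x : E3) : depth x ≤ 1 := (depth_le_half x).trans (by norm_num)

theorem corrector_add_single_one (x : E3) (t : ℝ) :
    p.corrector (x + t • EuclideanSpace.single 1 (1 : ℝ)) = p.planar (x 1 + t) (depth x) := by
  have : depth (x + t • EuclideanSpace.single 1 (1 : ℝ)) = depth x :=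
    depth_congr (by simp) (by simp)
  rw [corrector, this]
  simp

theorem corrector_add_single {i : Fin 3} (hi : i ≠ 1) (x : E3) (t : ℝ) :
    p.corrector (x + t • EuclideanSpace.single i (1 : ℝ)) =
      p.planar (x 1) (depth (x + t • EuclideanSpace.single i (1 : ℝ))) := by
  simp [corrector, hi.symm]

theorem abs_depth_add_single_sub_le (i : Fin 3) (x : E3) {t : ℝ} (ht : 0 ≤ t) :
    |depth (x + t • EuclideanSpace.single i (1 : ℝ)) - depth x| ≤ t := by
  refine (abs_depth_sub_le _ _).trans (le_of_eq ?_)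
  rw [add_sub_cancel_left, norm_smul, Real.norm_of_nonneg ht]
  simp

/-- The derivative of the corrector across the cells is determined by the right derivative of the
profile. -/
theorem gradient_one_eq (hG : HasGradientAt p.corrector G x) (hx : x 1 ∈ Ico (0 : ℝ) 1) {D : ℝ → ℝ}
    (hD : ∀ ρ, HasDerivWithinAt (fun ρ => p.profile ρ (depth x)) (D ρ) (Ici ρ) ρ) :
    G 1 = (∑ n ∈ Finset.range p.N, D (x 1 - n * p.h)) - p.θ := by
  rw [← inner_single_one]
  refine inner_gradient_eq hG ?_
  simp only [corrector_add_single_one]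
  have hc : HasDerivWithinAt (fun t : ℝ => x 1 + t) 1 (Ici 0) 0 :=
    ((hasDerivAt_id (0 : ℝ)).const_add _).hasDerivWithinAt
  have h := p.hasDerivWithinAt_planar hx hD
  have h' : HasDerivWithinAt (fun y => p.planar y (depth x))
      ((∑ n ∈ Finset.range p.N, D (x 1 - n * p.h)) - p.θ) (Ici (x 1)) (x 1 + 0) := by
    rwa [add_zero]
  have := h'.comp (0 : ℝ) hc (fun z hz => le_add_of_nonneg_right (mem_Ici.1 hz))
  rwa [mul_one] at this

/-- The derivatives of the corrector along the cells. -/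
theorem abs_gradient_le (hG : HasGradientAt p.corrector G x) {i : Fin 3} (hi : i ≠ 1) {A : ℝ}
    (hA : 0 ≤ A)
    (h : ∀ᶠ s in 𝓝 (depth x), |p.planar (x 1) s - p.planar (x 1) (depth x)| ≤ A * |s - depth x|) :
    |G i| ≤ A := by
  rw [← inner_single_one]
  refine abs_inner_gradient_le hG ?_
  have hcont : Tendsto (fun t : ℝ => depth (x + t • EuclideanSpace.single i (1 : ℝ))) (𝓝[>] 0)
      (𝓝 (depth x)) := by
    have hc : Continuous depth := by unfold depth; fun_prop
    have : Continuous fun t : ℝ => depth (x + t • EuclideanSpace.single i (1 : ℝ)) :=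
      hc.comp (by fun_prop)
    have h2 := this.tendsto 0
    simp only [zero_smul, add_zero] at h2
    exact h2.mono_left nhdsWithin_le_nhds
  filter_upwards [hcont.eventually h, self_mem_nhdsWithin] with t ht ht0
  rw [p.corrector_add_single hi, show p.corrector x = p.planar (x 1) (depth x) from rfl]
  refine ht.trans (mul_le_mul_of_nonneg_left ?_ hA)
  exact abs_depth_add_single_sub_le i x (le_of_lt ht0)

/-- Only the cell that contains `y` contributes to differences in the depth. -/
theorem planar_sub_planar {y s s' : ℝ} {n : ℕ} (hn : n ∈ Finset.range p.N)
    (hu : ∀ m ∈ Finset.range p.N, m ≠ n → y - m * p.h < 0 ∨ p.h ≤ y - m * p.h)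
    (hs : s ≤ 1) (hs' : s' ≤ 1) :
    p.planar y s - p.planar y s' = p.profile (y - n * p.h) s - p.profile (y - n * p.h) s' := by
  rw [planar, planar, sub_sub_sub_cancel_right, ← Finset.sum_sub_distrib]
  refine Finset.sum_eq_single_of_mem n hn fun m hm hmn => ?_
  rcases hu m hm hmn with h | h
  · rw [p.profile_of_nonpos_left hs h.le, p.profile_of_nonpos_left hs' h.le, sub_self]
  · rw [p.profile_of_outer_le hs ((p.outer_le s).trans h),
      p.profile_of_outer_le hs' ((p.outer_le s').trans h), sub_self]

end gradient

/-- The set where the second slip system is active. -/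
def slipSet : Set E3 :=
  {x | p.δ ≤ depth x ∧
    ∃ n ∈ Finset.range p.N, Needle p.a p.w (x 1 - n * p.h) (fineness p.δ (depth x))}

/-- The plastic strain. -/
noncomputable def slip (x : E3) : E3 :=
  p.slipSet.indicator (fun _ => (1 : ℝ)) x • eEta +
    (1 - p.slipSet.indicator (fun _ => (1 : ℝ)) x) • eXi

theorem mem_Ico_of_mem_slipSet {x : E3} (hx : x ∈ p.slipSet) : x 1 ∈ Ico (0 : ℝ) 1 := by
  obtain ⟨-, n, hn, hN⟩ := hx
  have h0 := hN.1
  have h1 := hN.lt_width.trans_le p.w_le_h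
  constructor
  · by_contra h
    have := cell_of_neg p.h_pos (not_le.1 h).le n
    have h2 : 0 ≤ n * p.h := by have := p.h_pos; positivity
    linarith [not_le.1 h]
  · by_contra h
    have h2 : p.h ≤ x 1 - n * p.h := cell_of_one_le (not_lt.1 h) hn
    linarith

open Classical in
/-- Inside the cube, `∂₁ Z + θ` is the indicator function of the needles. -/
theorem gradient_one_eq_of_pos {G x : E3} (hG : HasGradientAt p.corrector G x)
    (hx : x 1 ∈ Ico (0 : ℝ) 1) (hd : 0 < depth x) {n : ℕ} (hn : n ∈ Finset.range p.N)
    (hu : ∀ m ∈ Finset.range p.N, m ≠ n → x 1 - m * p.h < 0 ∨ p.h ≤ x 1 - m * p.h) :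
    G 1 = (if Needle p.a p.w (x 1 - n * p.h) (fineness p.δ (depth x)) then 1 else 0) - p.θ := by
  rw [p.gradient_one_eq hG hx (p.hasDerivWithinAt_profile_of_pos hd (depth_le_one x)),
    Finset.sum_eq_single_of_mem n hn fun m hm hmn => ?_]
  refine if_neg fun h => ?_
  rcases hu m hm hmn with h' | h'
  · exact absurd h.1 (not_le.2 h')
  · exact absurd (h.lt_width.trans_le p.w_le_h) (not_lt.2 h')

open Classical in
/-- Away from the lateral layer the slip matches `∂₁ Z + θ` exactly. -/
theorem indicator_slipSet_eq {x : E3} (hd : p.δ ≤ depth x) {n : ℕ} (hn : n ∈ Finset.range p.N)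
    (hu : ∀ m ∈ Finset.range p.N, m ≠ n → x 1 - m * p.h < 0 ∨ p.h ≤ x 1 - m * p.h) :
    p.slipSet.indicator (fun _ => (1 : ℝ)) x =
      if Needle p.a p.w (x 1 - n * p.h) (fineness p.δ (depth x)) then 1 else 0 := by
  by_cases h : Needle p.a p.w (x 1 - n * p.h) (fineness p.δ (depth x))
  · rw [if_pos h, indicator_of_mem]
    exact ⟨hd, n, hn, h⟩
  · rw [if_neg h, indicator_of_notMem]
    rintro ⟨-, m, hm, hN⟩
    by_cases hmn : m = n
    · exact h (hmn ▸ hN)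
    rcases hu m hm hmn with h' | h'
    · exact absurd hN.1 (not_le.2 h')
    · exact absurd (hN.lt_width.trans_le p.w_le_h) (not_lt.2 h')

/-- The number of cells `n` such that `y - n h` belongs to a given set. -/
noncomputable def cellCount (S : Set ℝ) (y : ℝ) : ℝ :=
  ∑ n ∈ Finset.range p.N, S.indicator (fun _ => (1 : ℝ)) (y - n * p.h)

theorem one_le_cellCount {S : Set ℝ} {y : ℝ} {n : ℕ} (hn : n ∈ Finset.range p.N)
    (h : y - n * p.h ∈ S) : 1 ≤ p.cellCount S y := by
  have h1 := Finset.single_le_sum (f := fun n : ℕ => S.indicator (fun _ => (1 : ℝ)) (y - n * p.h))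
    (fun m _ => indicator_nonneg (fun _ _ => zero_le_one) _) hn
  simp only [indicator_of_mem h] at h1
  exact h1

theorem cellCount_nonneg (S : Set ℝ) (y : ℝ) : 0 ≤ p.cellCount S y :=
  Finset.sum_nonneg fun _ _ => indicator_nonneg (fun _ _ => zero_le_one) _

/-- Inside the cube, the elastic strain is due to the refinement of the needles, and to the lateral
layer in which there is no slip. -/
theorem sq_norm_strain_le {G x : E3} (hG : HasGradientAt p.corrector G x) (hx : x ∈ cube 1) :
    ‖(farGrad p.θ - √2 • G) - p.slip x‖ ^ 2 ≤
      16 * p.K ^ 2 * (max (depth x) p.δ ^ (-(1 / 3) : ℝ)) ^ 2 * p.cellCount (Ico 0 p.w) (x 1) +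
        (Iio p.δ).indicator (fun _ => (2 : ℝ)) (depth x) := by
  obtain ⟨hy, hd⟩ := mem_cube_one_iff.1 hx
  have hy' : x 1 ∈ Ico (0 : ℝ) 1 := Ioo_subset_Ico_self hy
  obtain ⟨n, hn, hρ, hu⟩ := exists_cell_index p.N_pos hy'
  change x 1 - n * p.h ∈ Ico (0 : ℝ) p.h at hρ
  change ∀ m ∈ Finset.range p.N, m ≠ n → x 1 - m * p.h < 0 ∨ p.h ≤ x 1 - m * p.h at hu
  set M := max (depth x) p.δ ^ (-(1 / 3) : ℝ) with hM
  have hmax : 0 < max (depth x) p.δ := p.δ_pos.trans_le (le_max_right _ _)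
  have hM0 : 0 < M := Real.rpow_pos_of_pos hmax _
  set A := 2 * p.K * M * (Ico 0 p.w).indicator (fun _ => (1 : ℝ)) (x 1 - n * p.h) with hA
  have hA0 : 0 ≤ A := by
    have := p.K_nonneg
    have h1 : 0 ≤ (Ico 0 p.w).indicator (fun _ => (1 : ℝ)) (x 1 - n * p.h) :=
      indicator_nonneg (fun _ _ => zero_le_one) _
    positivity
  have hev : ∀ᶠ s in 𝓝 (depth x),
      |p.planar (x 1) s - p.planar (x 1) (depth x)| ≤ A * |s - depth x| := by
    filter_upwards [Ioo_mem_nhds (half_lt_self hd) (by linarith [depth_le_half x] : depth x < 1)]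
      with s hs
    have hs0 : 0 < s := (half_pos hd).trans hs.1
    rw [p.planar_sub_planar hn hu hs.2.le (depth_le_one x), p.profile_of_nonneg hs0.le,
      p.profile_of_nonneg hd.le]
    by_cases hw : x 1 - n * p.h < p.w
    · rw [hA, indicator_of_mem (show x 1 - n * p.h ∈ Ico 0 p.w from ⟨hρ.1, hw⟩), mul_one]
      refine (p.lipschitz _ _ _ (p.fineness_mem hs.2.le) (p.fineness_mem (depth_le_one x))).trans ?_
      have h1 := abs_fineness_sub_le p.δ_pos (s := s) (s' := depth x) (half_pos hmax)
        (by
          rcases max_choice (depth x) p.δ with h | h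
          · rw [h]; exact hs.1.le.trans (le_max_left _ _)
          · rw [h]; exact (half_le_self p.δ_pos.le).trans (le_max_right _ _)) (half_le_self hmax.le)
      have h2 : (max (depth x) p.δ / 2) ^ (-(1 / 3) : ℝ) ≤ 2 * M := by
        rw [Real.div_rpow hmax.le zero_le_two, ← hM, div_eq_mul_inv, ← Real.rpow_neg zero_le_two,
          neg_neg, mul_comm]
        have : (2 : ℝ) ^ (1 / 3 : ℝ) ≤ 2 ^ (1 : ℝ) :=
          Real.rpow_le_rpow_of_exponent_le one_le_two (by norm_num)
        rw [Real.rpow_one] at this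
        exact mul_le_mul_of_nonneg_right this hM0.le
      calc p.K * |fineness p.δ s - fineness p.δ (depth x)|
          ≤ p.K * (2 * M * |s - depth x|) := by
            refine mul_le_mul_of_nonneg_left (h1.trans ?_) p.K_nonneg
            exact mul_le_mul_of_nonneg_right h2 (abs_nonneg _)
        _ = _ := by ring
    · rw [min_eq_right (not_lt.1 hw), branch_width p.a_pos.le p.a_le p.w_pos.le
        (p.fineness_mem hs.2.le).2, branch_width p.a_pos.le p.a_le p.w_pos.le
        (p.fineness_mem (depth_le_one x)).2, sub_self, abs_zero]
      positivity
  have hG0 := p.abs_gradient_le hG (i := 0) (by simp) hA0 hev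
  have hG2 := p.abs_gradient_le hG (i := 2) (by simp) hA0 hev
  have hG0' := sq_le_sq' (neg_le_of_abs_le hG0) (le_of_abs_le hG0)
  have hG2' := sq_le_sq' (neg_le_of_abs_le hG2) (le_of_abs_le hG2)
  have hAA : 4 * A ^ 2 ≤ 16 * p.K ^ 2 * M ^ 2 * p.cellCount (Ico 0 p.w) (x 1) := by
    by_cases hw : x 1 - n * p.h ∈ Ico 0 p.w
    · rw [hA, indicator_of_mem hw]
      have := p.one_le_cellCount hn hw
      have h2 : 0 ≤ 16 * p.K ^ 2 * M ^ 2 := by positivity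
      nlinarith
    · rw [hA, indicator_of_notMem hw]
      have := p.cellCount_nonneg (Ico 0 p.w) (x 1)
      have h3 : 0 ≤ 16 * p.K ^ 2 * M ^ 2 * p.cellCount (Ico 0 p.w) (x 1) := by positivity
      simpa using h3
  classical
  have hG1 := p.gradient_one_eq_of_pos hG hy' hd hn hu
  rw [slip, sq_norm_farGrad_sub]
  rcases lt_or_ge (depth x) p.δ with hδ | hδ
  · rw [indicator_of_mem (show depth x ∈ Iio p.δ from hδ), indicator_of_notMem
      (show x ∉ p.slipSet from fun h => absurd h.1 (not_le.2 hδ)), hG1]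
    have : ((if Needle p.a p.w (x 1 - n * p.h) (fineness p.δ (depth x)) then (1 : ℝ) else 0) - p.θ +
        p.θ - 0) ^ 2 ≤ 1 := by
      split_ifs <;> norm_num
    linarith
  · rw [indicator_of_notMem (show depth x ∉ Iio p.δ from not_lt.2 hδ),
      p.indicator_slipSet_eq hδ hn hu, hG1]
    have : ∀ c : ℝ, (c - p.θ + p.θ - c) ^ 2 = 0 := fun c => by ring
    rw [this]
    linarith

/-- A bound for the deviation from the far field outside the cube, as a function of the coordinate
`y` across the cells and the depth `s < 0`. Up to the distance `h - w`, beyond which the transition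
fills the cells and the corrector vanishes, the transition of width `p.outer s` carries a gradient
of size `θ h / p.outer s`. -/
noncomputable def outerBound (y s : ℝ) : ℝ :=
  if -s ≤ p.h - p.w then
    8 * (p.θ * p.h / p.outer s) ^ 2 * p.cellCount (Icc 0 (p.outer s)) y + 4 * p.θ ^ 2
  else 0

/-- The corrector vanishes beyond the two faces across the cells, and its gradient vanishes on them
as well wherever it exists. -/
theorem gradient_eq_zero_of_notMem {G x : E3} (hG : HasGradientAt p.corrector G x)
    (hx : x 1 ∉ Ioo (0 : ℝ) 1) : G = 0 := by
  have hz : ∀ y ∉ Ioo (0 : ℝ) 1, ∀ s ≤ 1, p.planar y s = 0 := fun y hy s hs => by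
    rcases le_or_gt y 0 with h | h
    · exact p.planar_of_nonpos hs h
    · exact p.planar_of_one_le hs (not_lt.1 fun h' => hy ⟨h, h'⟩)
  have hi : ∀ i : Fin 3, i ≠ 1 → G i = 0 := fun i hi => by
    have := p.abs_gradient_le hG hi le_rfl (by
      filter_upwards [Iio_mem_nhds (by linarith [depth_le_half x] : depth x < 1)] with s hs
      rw [hz _ hx s (le_of_lt hs), hz _ hx _ (depth_le_one x)]
      simp)
    exact abs_nonpos_iff.1 this
  have h1 : G 1 = 0 := by
    rcases le_or_gt (x 1) 0 with h | h
    · have h2 : inner ℝ G (-(EuclideanSpace.single 1 (1 : ℝ))) = (0 : ℝ) := by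
        refine inner_gradient_eq hG ?_
        refine (hasDerivWithinAt_const (0 : ℝ) (Ici 0) (0 : ℝ)).congr (fun t ht => ?_) ?_
        · rw [smul_neg, ← neg_smul, p.corrector_add_single_one]
          exact p.planar_of_nonpos (depth_le_one x) (by linarith [mem_Ici.1 ht])
        · rw [smul_neg, ← neg_smul, p.corrector_add_single_one]
          exact p.planar_of_nonpos (depth_le_one x) (by linarith)
      rw [inner_neg_right, inner_single_one] at h2
      linarith
    · have hx1 : 1 ≤ x 1 := not_lt.1 fun h' => hx ⟨h, h'⟩
      rw [← inner_single_one]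
      refine inner_gradient_eq hG ?_
      refine (hasDerivWithinAt_const (0 : ℝ) (Ici 0) (0 : ℝ)).congr (fun t ht => ?_) ?_
      · rw [p.corrector_add_single_one]
        exact p.planar_of_one_le (depth_le_one x) (by linarith [mem_Ici.1 ht])
      · rw [p.corrector_add_single_one]
        exact p.planar_of_one_le (depth_le_one x) (by linarith)
  ext i
  by_cases h : i = 1
  · rw [h, h1]; rfl
  · rw [hi i h]; rfl

/-- Beyond the lateral faces, both the derivative across the transition and the one along it, which
is due to the growth of its width, are at most of the order of `θ h / p.outer s`. -/
theorem sq_norm_gradient_le {G x : E3} (hG : HasGradientAt p.corrector G x)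
    (hy : x 1 ∈ Ioo (0 : ℝ) 1) (hd : depth x < 0) :
    ‖√2 • G‖ ^ 2 ≤ p.outerBound (x 1) (depth x) := by
  have hy' : x 1 ∈ Ico (0 : ℝ) 1 := Ioo_subset_Ico_self hy
  obtain ⟨n, hn, hρ, hu⟩ := exists_cell_index p.N_pos hy'
  change x 1 - n * p.h ∈ Ico (0 : ℝ) p.h at hρ
  change ∀ m ∈ Finset.range p.N, m ≠ n → x 1 - m * p.h < 0 ∨ p.h ≤ x 1 - m * p.h at hu
  classical
  have hθh : 0 ≤ p.θ * p.h := mul_nonneg p.θ_pos.le p.h_pos.le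
  set o := p.outer (depth x) with ho
  have ho0 : 0 < o := p.outer_pos _
  have hG1 : G 1 = p.θ * p.h * (if x 1 - n * p.h ∈ Ico 0 o then 1 / o else 0) - p.θ := by
    rw [p.gradient_one_eq hG hy' (p.hasDerivWithinAt_profile_of_nonpos hd.le),
      Finset.sum_eq_single_of_mem n hn fun m hm hmn => ?_, p.a_mul_w']
    rw [if_neg, mul_zero]
    rintro ⟨h1, h2⟩
    rcases hu m hm hmn with h' | h'
    · linarith
    · linarith [p.outer_le (depth x)]
  have hprof : ∀ s ∈ Ioo (-1 + depth x) 0, p.planar (x 1) s - p.planar (x 1) (depth x) =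
      p.θ * p.h * (ramp (p.outer s) (x 1 - n * p.h) - ramp o (x 1 - n * p.h)) := fun s hs => by
    rw [p.planar_sub_planar hn hu (by linarith [hs.2]) (depth_le_one x),
      p.profile_of_nonpos hs.2.le,
      p.profile_of_nonpos hd.le, p.a_mul_w']
    ring
  have hnorm : ‖√2 • G‖ ^ 2 = 2 * (G 0 ^ 2 + G 1 ^ 2 + G 2 ^ 2) := by
    rw [norm_smul, mul_pow, sq_norm_eq, Real.norm_of_nonneg (Real.sqrt_nonneg 2),
      Real.sq_sqrt zero_le_two]
  rw [hnorm, outerBound]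
  split_ifs with hr
  · set A := p.θ * p.h / o * (Icc 0 o).indicator (fun _ => (1 : ℝ)) (x 1 - n * p.h) with hA
    have hI0 : 0 ≤ (Icc 0 o).indicator (fun _ => (1 : ℝ)) (x 1 - n * p.h) :=
      indicator_nonneg (fun _ _ => zero_le_one) _
    have hA0 : 0 ≤ A := by positivity
    have hev : ∀ᶠ s in 𝓝 (depth x),
        |p.planar (x 1) s - p.planar (x 1) (depth x)| ≤ A * |s - depth x| := by
      by_cases hρo : x 1 - n * p.h ≤ o
      · filter_upwards [Ioo_mem_nhds (by linarith : -1 + depth x < depth x) hd] with s hs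
        rw [hprof s hs, hA, indicator_of_mem (show x 1 - n * p.h ∈ Icc 0 o from ⟨hρ.1, hρo⟩),
          mul_one, abs_mul, abs_of_nonneg hθh, abs_sub_comm, div_mul_eq_mul_div, mul_div_assoc]
        refine mul_le_mul_of_nonneg_left ?_ hθh
        refine (abs_ramp_sub_le_right ho0 (p.outer_pos s) _).trans ?_
        rw [abs_sub_comm s]
        exact div_le_div_of_nonneg_right (p.abs_outer_sub_le _ _) ho0.le
      · have hgap : 0 < x 1 - n * p.h - o := by linarith
        filter_upwards [Ioo_mem_nhds (by linarith : -1 + depth x < depth x) hd,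
          Ioo_mem_nhds (sub_lt_self (depth x) hgap) (lt_add_of_pos_right (depth x) hgap)]
          with s hs hs'
        have h1 : p.outer s ≤ x 1 - n * p.h := by
          have h2 := (abs_le.1 (p.abs_outer_sub_le s (depth x))).2
          have h3 : |s - depth x| ≤ x 1 - n * p.h - o :=
            abs_le.2 ⟨by linarith [hs'.1], by linarith [hs'.2]⟩
          linarith
        rw [hprof s hs, ramp_of_le (p.outer_pos s) h1, ramp_of_le ho0 (not_le.1 hρo).le, sub_self,
          mul_zero, abs_zero]
        positivity
    have hG0 := p.abs_gradient_le hG (i := 0) (by simp) hA0 hev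
    have hG2 := p.abs_gradient_le hG (i := 2) (by simp) hA0 hev
    have hG0' := sq_le_sq' (neg_le_of_abs_le hG0) (le_of_abs_le hG0)
    have hG2' := sq_le_sq' (neg_le_of_abs_le hG2) (le_of_abs_le hG2)
    have hG1' : G 1 ^ 2 ≤ 2 * A ^ 2 + 2 * p.θ ^ 2 := by
      have h1 : p.θ * p.h * (if x 1 - n * p.h ∈ Ico 0 o then 1 / o else 0) ≤ A := by
        split_ifs with h
        · rw [hA, indicator_of_mem (Ico_subset_Icc_self h), mul_one, mul_one_div]
        · rw [mul_zero]; exact hA0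
      have h2 : 0 ≤ p.θ * p.h * (if x 1 - n * p.h ∈ Ico 0 o then 1 / o else 0) := by
        split_ifs <;> positivity
      rw [hG1]
      set c := p.θ * p.h * (if x 1 - n * p.h ∈ Ico 0 o then 1 / o else 0)
      nlinarith [sq_nonneg (c + p.θ)]
    have hAA : 8 * A ^ 2 ≤ 8 * (p.θ * p.h / o) ^ 2 * p.cellCount (Icc 0 o) (x 1) := by
      by_cases hw : x 1 - n * p.h ∈ Icc 0 o
      · rw [hA, indicator_of_mem hw, mul_one]
        have := p.one_le_cellCount hn hw
        have h2 : 0 ≤ 8 * (p.θ * p.h / o) ^ 2 := by positivity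
        nlinarith
      · rw [hA, indicator_of_notMem hw]
        have := p.cellCount_nonneg (Icc 0 o) (x 1)
        have h3 : 0 ≤ 8 * (p.θ * p.h / o) ^ 2 * p.cellCount (Icc 0 o) (x 1) := by positivity
        simpa using h3
    linarith
  · have hout : ∀ s < 0, p.h - p.w < -s → p.outer s = p.h := fun s hs h => by
      rw [outer, max_eq_left (by linarith), min_eq_right (by linarith)]
    have hoh : o = p.h := hout _ hd (not_le.1 hr)
    have hev : ∀ᶠ s in 𝓝 (depth x),
        |p.planar (x 1) s - p.planar (x 1) (depth x)| ≤ 0 * |s - depth x| := by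
      filter_upwards [Ioo_mem_nhds (by linarith : -1 + depth x < depth x) hd,
        Iio_mem_nhds (by linarith [not_le.1 hr] : depth x < -(p.h - p.w))] with s hs hs'
      rw [hprof s hs, hout s hs.2 (by linarith [mem_Iio.1 hs']), hoh]
      simp
    have hG0 := abs_nonpos_iff.1 (p.abs_gradient_le hG (i := 0) (by simp) le_rfl hev)
    have hG2 := abs_nonpos_iff.1 (p.abs_gradient_le hG (i := 2) (by simp) le_rfl hev)
    rw [hG0, hG2, hG1, if_pos (by rw [hoh]; exact hρ), hoh, mul_one_div,
      mul_div_cancel_right₀ _ p.h_pos.ne']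
    norm_num

end NeedleData

/-! ### The elastic energy of the construction -/

theorem lintegral_rpow_unit :
    ∫⁻ s in Ioc (0 : ℝ) 1, ENNReal.ofReal (s ^ (-(2 / 3) : ℝ)) = 3 := by
  have hi : IntervalIntegrable (fun s : ℝ => s ^ (-(2 / 3) : ℝ)) volume 0 1 :=
    intervalIntegral.intervalIntegrable_rpow' (by norm_num)
  rw [← ofReal_integral_eq_lintegral_ofReal
      ((intervalIntegrable_iff_integrableOn_Ioc_of_le zero_le_one).1 hi)
      ((ae_restrict_iff' measurableSet_Ioc).2 (ae_of_all _ fun s hs => Real.rpow_nonneg hs.1.le _)),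
    ← intervalIntegral.integral_of_le zero_le_one, integral_rpow (Or.inl (by norm_num))]
  norm_num

theorem lintegral_inv_sub {w h : ℝ} (hw : 0 < w) (hwh : w ≤ h) :
    ∫⁻ s in Ioc (-(h - w)) 0, ENNReal.ofReal (1 / (w - s)) = ENNReal.ofReal (Real.log (h / w)) := by
  have h0 : -(h - w) ≤ 0 := by linarith
  have hc : ContinuousOn (fun s : ℝ => 1 / (w - s)) (uIcc (-(h - w)) 0) := by
    rw [uIcc_of_le h0]
    exact ContinuousOn.div (by fun_prop) (by fun_prop) fun s hs => by
      have := hs.2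
      linarith
  rw [← ofReal_integral_eq_lintegral_ofReal
      ((intervalIntegrable_iff_integrableOn_Ioc_of_le h0).1 hc.intervalIntegrable)
      ((ae_restrict_iff' measurableSet_Ioc).2 (ae_of_all _ fun s hs => by
        have := hs.2
        exact one_div_nonneg.2 (by linarith))),
    ← intervalIntegral.integral_of_le h0,
    intervalIntegral.integral_comp_sub_left (fun x => 1 / x) w, sub_zero]
  rw [show w - -(h - w) = h by ring, integral_one_div_of_pos hw (hw.trans_le hwh)]

namespace NeedleData

variable (p : NeedleData)

theorem lintegral_cellCount_le {S : Set ℝ} (hS : MeasurableSet S) (T : Set ℝ) :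
    ∫⁻ y in T, ENNReal.ofReal (p.cellCount S y) ≤ p.N * volume S := by
  refine (lintegral_mono' Measure.restrict_le_self le_rfl).trans ?_
  have h1 : ∀ y, ENNReal.ofReal (p.cellCount S y) =
      ∑ n ∈ Finset.range p.N, S.indicator (fun _ => (1 : ℝ≥0∞)) (y - n * p.h) := fun y => by
    rw [cellCount, ENNReal.ofReal_sum_of_nonneg
      fun _ _ => indicator_nonneg (fun _ _ => zero_le_one) _]
    refine Finset.sum_congr rfl fun n _ => ?_
    by_cases h : y - n * p.h ∈ S <;> simp [h]
  simp only [h1]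
  have hm : ∀ n ∈ Finset.range p.N,
      Measurable fun y : ℝ => S.indicator (fun _ => (1 : ℝ≥0∞)) (y - n * p.h) := fun n _ =>
    (measurable_const.indicator hS).comp (measurable_id.sub_const _)
  rw [lintegral_finsetSum _ hm]
  have h2 : ∀ n ∈ Finset.range p.N,
      ∫⁻ y, S.indicator (fun _ => (1 : ℝ≥0∞)) (y - n * p.h) = volume S := fun n _ => by
    rw [lintegral_sub_right_eq_self (fun y => S.indicator (fun _ => (1 : ℝ≥0∞)) y),
      lintegral_indicator_const hS, one_mul]
  rw [Finset.sum_congr rfl h2, Finset.sum_const, Finset.card_range, nsmul_eq_mul]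

/-- The squared slope `s ^ (-2/3)` of the refinement parameter is integrable. -/
theorem lintegral_strain_le :
    ∫⁻ x in cube 1, ENNReal.ofReal
        (16 * p.K ^ 2 * (max (depth x) p.δ ^ (-(1 / 3) : ℝ)) ^ 2 * p.cellCount (Ico 0 p.w) (x 1) +
          (Iio p.δ).indicator (fun _ => (2 : ℝ)) (depth x)) ≤
      ENNReal.ofReal (12 * (48 * p.K ^ 2 * (p.N * p.w) + 6 * p.δ)) := by
  classical
  let F : ℝ → ℝ → ℝ≥0∞ := fun y s =>
    (Ioc (0 : ℝ) 1).indicator (fun s => ENNReal.ofReal (16 * p.K ^ 2) *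
      ENNReal.ofReal (s ^ (-(2 / 3) : ℝ))) s * ENNReal.ofReal (p.cellCount (Ico 0 p.w) y) +
      (Ioc (0 : ℝ) p.δ).indicator (fun _ => (2 : ℝ≥0∞)) s
  have h1 : ∀ x ∈ cube 1, ENNReal.ofReal
        (16 * p.K ^ 2 * (max (depth x) p.δ ^ (-(1 / 3) : ℝ)) ^ 2 * p.cellCount (Ico 0 p.w) (x 1) +
          (Iio p.δ).indicator (fun _ => (2 : ℝ)) (depth x)) ≤ F (x 1) (depth x) := fun x hx => by
    have hd := (mem_cube_one_iff.1 hx).2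
    refine ENNReal.ofReal_add_le.trans (add_le_add ?_ ?_)
    · rw [indicator_of_mem (show depth x ∈ Ioc (0 : ℝ) 1 from ⟨hd, depth_le_one x⟩),
        ← ENNReal.ofReal_mul (by positivity), ← ENNReal.ofReal_mul (by positivity)]
      refine ENNReal.ofReal_le_ofReal (mul_le_mul_of_nonneg_right (mul_le_mul_of_nonneg_left ?_
        (by positivity)) (p.cellCount_nonneg _ _))
      have e : depth x ^ (-(2 / 3) : ℝ) = (depth x ^ (-(1 / 3) : ℝ)) ^ 2 := by
        rw [← Real.rpow_natCast, ← Real.rpow_mul hd.le]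
        norm_num
      rw [e]
      have := Real.rpow_le_rpow_of_nonpos hd (le_max_left (depth x) p.δ)
        (by norm_num : (-(1 / 3) : ℝ) ≤ 0)
      gcongr
    · by_cases h : depth x < p.δ
      · rw [indicator_of_mem (show depth x ∈ Iio p.δ from h),
          indicator_of_mem (show depth x ∈ Ioc 0 p.δ from ⟨hd, h.le⟩)]
        norm_num
      · rw [indicator_of_notMem (show depth x ∉ Iio p.δ from h)]
        simp
  have hI : ∀ s, ∫⁻ y in Ioo (-1 : ℝ) 2, F y s ≤
      (Ioc (0 : ℝ) 1).indicator (fun s => ENNReal.ofReal (16 * p.K ^ 2) *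
        ENNReal.ofReal (s ^ (-(2 / 3) : ℝ))) s * ENNReal.ofReal (p.N * p.w) +
      (Ioc (0 : ℝ) p.δ).indicator (fun _ => (6 : ℝ≥0∞)) s := fun s => by
    simp only [F]
    rw [lintegral_add_right _ measurable_const, lintegral_const_mul']
    · refine add_le_add (mul_le_mul' le_rfl ((p.lintegral_cellCount_le measurableSet_Ico _).trans
        ?_)) ?_
      · rw [Real.volume_Ico, sub_zero, ENNReal.ofReal_mul p.N_pos'.le, ENNReal.ofReal_natCast]
      · rw [lintegral_const, Measure.restrict_apply_univ, Real.volume_Ioo]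
        by_cases h : s ∈ Ioc (0 : ℝ) p.δ
        · rw [indicator_of_mem h, indicator_of_mem h]
          norm_num
        · simp [indicator_of_notMem h]
    · by_cases h : s ∈ Ioc (0 : ℝ) 1
      · rw [indicator_of_mem h]
        exact ENNReal.mul_ne_top ENNReal.ofReal_ne_top ENNReal.ofReal_ne_top
      · simp [indicator_of_notMem h]
  calc _ ≤ ∫⁻ x in cube 1, F (x 1) (depth x) :=
        setLIntegral_mono' (isOpen_cube 1).measurableSet h1
    _ ≤ ∫⁻ x in bigCube, F (x 1) (depth x) := lintegral_mono_set cube_subset_bigCube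
    _ ≤ 12 * ∫⁻ s, ∫⁻ y in Ioo (-1) 2, F y s := lintegral_depth_le F
    _ ≤ 12 * (ENNReal.ofReal (16 * p.K ^ 2) * 3 * ENNReal.ofReal (p.N * p.w) +
          6 * ENNReal.ofReal p.δ) := by
        refine mul_le_mul' le_rfl ((lintegral_mono hI).trans ?_)
        rw [lintegral_add_right _ (measurable_const.indicator measurableSet_Ioc),
          lintegral_mul_const' _ _ ENNReal.ofReal_ne_top, lintegral_indicator measurableSet_Ioc,
          lintegral_const_mul' _ _ ENNReal.ofReal_ne_top, lintegral_rpow_unit,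
          lintegral_indicator_const measurableSet_Ioc, Real.volume_Ioc, sub_zero]
    _ = _ := by
        have hw := p.w_pos
        have hN := p.N_pos'
        have hδ := p.δ_pos
        rw [show (12 : ℝ≥0∞) = ENNReal.ofReal 12 by norm_num,
          show (6 : ℝ≥0∞) = ENNReal.ofReal 6 by norm_num,
          show (3 : ℝ≥0∞) = ENNReal.ofReal 3 by norm_num,
          ← ENNReal.ofReal_mul (by positivity), ← ENNReal.ofReal_mul (by positivity),
          ← ENNReal.ofReal_mul (by positivity),
          ← ENNReal.ofReal_add (by positivity) (by positivity),
          ← ENNReal.ofReal_mul (by positivity)]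
        congr 1
        ring

/-- At distance `t` from the lateral faces the transition has width `w + t` and gradient `θ h / (w +
t)` in each of the `1 / h` cells; integration over `t ∈ (0, h - w)` gives the logarithm. -/
theorem lintegral_outerBound_le :
    ∫⁻ s in Iio (0 : ℝ), ∫⁻ y in Ioo (-1 : ℝ) 2, ENNReal.ofReal (p.outerBound y s) ≤
      ENNReal.ofReal (20 * p.θ ^ 2 * p.h * Real.log (p.h / p.w)) := by
  have hθ := p.θ_pos
  have hh := p.h_pos
  have hI : ∀ s ∈ Iio (0 : ℝ), ∫⁻ y in Ioo (-1 : ℝ) 2, ENNReal.ofReal (p.outerBound y s) ≤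
      (Icc (-(p.h - p.w)) 0).indicator (fun s => ENNReal.ofReal (20 * p.θ ^ 2 * p.h) *
        ENNReal.ofReal (1 / (p.w - s))) s := fun s hs => by
    have hs : s < 0 := hs
    unfold outerBound
    split_ifs with h
    · rw [indicator_of_mem (show s ∈ Icc (-(p.h - p.w)) 0 from ⟨by linarith, hs.le⟩)]
      have ho : p.outer s = p.w - s := by
        rw [outer, max_eq_left (by linarith), min_eq_left (by linarith)]
        ring
      set o := p.outer s with ho'
      have ho0 : 0 < o := p.outer_pos s
      have hoh : o ≤ p.h := p.outer_le s
      have h1 : ∀ y, ENNReal.ofReal (8 * (p.θ * p.h / o) ^ 2 * p.cellCount (Icc 0 o) y +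
          4 * p.θ ^ 2) = ENNReal.ofReal (8 * (p.θ * p.h / o) ^ 2) *
            ENNReal.ofReal (p.cellCount (Icc 0 o) y) + ENNReal.ofReal (4 * p.θ ^ 2) := fun y => by
        have := p.cellCount_nonneg (Icc 0 o) y
        rw [ENNReal.ofReal_add (by positivity) (by positivity), ENNReal.ofReal_mul (by positivity)]
      simp only [h1]
      rw [lintegral_add_right _ measurable_const, lintegral_const_mul' _ _ ENNReal.ofReal_ne_top,
        lintegral_const, Measure.restrict_apply_univ, Real.volume_Ioo]
      have h2 := p.lintegral_cellCount_le (measurableSet_Icc (a := 0) (b := o)) (Ioo (-1) 2)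
      rw [Real.volume_Icc, sub_zero, ← ENNReal.ofReal_natCast,
        ← ENNReal.ofReal_mul p.N_pos'.le] at h2
      refine (add_le_add (mul_le_mul' le_rfl h2) le_rfl).trans ?_
      have hN := p.N_pos'
      rw [← ENNReal.ofReal_mul (by positivity), ← ENNReal.ofReal_mul (by positivity),
        ← ENNReal.ofReal_mul (by positivity),
        ← ENNReal.ofReal_add (by positivity) (by norm_num; positivity),
        ← ho]
      refine ENNReal.ofReal_le_ofReal ?_
      have e : 8 * (p.θ * p.h / o) ^ 2 * (p.N * o) = 8 * p.θ ^ 2 * p.h * (1 / o) := by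
        rw [← p.N_mul_h]
        field_simp
      have e2 : 1 ≤ p.h * (1 / o) := by
        rw [mul_one_div, le_div_iff₀ ho0]; linarith
      rw [e]
      nlinarith [mul_le_mul_of_nonneg_left e2 (by positivity : 0 ≤ 12 * p.θ ^ 2)]
    · simp
  refine (setLIntegral_mono' measurableSet_Iio hI).trans ?_
  refine (lintegral_mono' Measure.restrict_le_self le_rfl).trans ?_
  rw [lintegral_indicator measurableSet_Icc, ← restrict_Ioc_eq_restrict_Icc,
    lintegral_const_mul' _ _ ENNReal.ofReal_ne_top, lintegral_inv_sub p.w_pos p.w_le_h,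
    ← ENNReal.ofReal_mul (by positivity)]

/-- The deformation. The factor `√2` stems from `eXi - eEta = √2 e`, with `e` the unit vector of
the coordinate `1` across the cells. -/
noncomputable def deformation (x : E3) : ℝ := farField p.θ x - √2 * p.corrector x

/-- The elastic energy is that of the refinement of the needles, of the lateral layer without slip
on the second system, and of the exterior transition. -/
theorem elasticEnergy_deformation_le (μ : ℝ) :
    elasticEnergy μ p.θ 1 p.deformation p.slip ≤
      ENNReal.ofReal (12 * (48 * p.K ^ 2 * (p.N * p.w) + 6 * p.δ)) +
        ENNReal.ofReal μ * ENNReal.ofReal (240 * p.θ ^ 2 * p.h * Real.log (p.h / p.w)) := by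
  obtain ⟨C, hC⟩ := p.exists_lipschitz_corrector
  have hC2 : LipschitzWith (‖(√2 : ℝ)‖₊ * C) fun x => √2 * p.corrector x := by
    exact (lipschitzWith_smul (√2 : ℝ)).comp hC
  set g : E3 → E3 := fun x => farGrad p.θ - (∇ fun x => √2 * p.corrector x) x with hg
  have hw : HasWeakGradient p.deformation g :=
    (hasWeakGradient_farField p.θ).sub (hasWeakGradient_of_lipschitz hC2)
  have hdiff : ∀ᵐ x, ∃ G, HasGradientAt p.corrector G x ∧ g x = farGrad p.θ - √2 • G := by
    filter_upwards [hC.ae_differentiableAt] with x hx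
    refine ⟨(∇ p.corrector) x, hx.hasGradientAt, ?_⟩
    refine congrArg (farGrad p.θ - ·) (HasGradientAt.gradient ?_)
    have h := hx.hasGradientAt
    rw [hasGradientAt_iff_hasFDerivAt] at h ⊢
    rw [map_smulₛₗ]
    exact h.const_smul (√2 : ℝ)
  refine (iInf₂_le g hw).trans (add_le_add ?_ (mul_le_mul' le_rfl ?_))
  · refine le_trans (setLIntegral_mono_ae' (isOpen_cube 1).measurableSet ?_)
      p.lintegral_strain_le
    filter_upwards [hdiff] with x ⟨G, hG, hgx⟩ hx
    rw [← ofReal_norm, ← ENNReal.ofReal_pow (norm_nonneg _), hgx]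
    exact ENNReal.ofReal_le_ofReal (p.sq_norm_strain_le hG hx)
  · classical
    let F : ℝ → ℝ → ℝ≥0∞ := fun y s =>
      if s = 0 then ⊤ else (Iio (0 : ℝ)).indicator (fun s => ENNReal.ofReal (p.outerBound y s)) s
    have h1 : ∀ᵐ x, x ∈ (cube 1)ᶜ → ‖g x - (∇ (farField p.θ)) x‖ₑ ^ 2 ≤
        bigCube.indicator (fun x => F (x 1) (depth x)) x := by
      filter_upwards [hdiff] with x ⟨G, hG, hgx⟩ hx
      rw [gradient_farField, hgx, sub_sub_cancel_left, enorm_neg, ← ofReal_norm,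
        ← ENNReal.ofReal_pow (norm_nonneg _)]
      by_cases hy : x 1 ∈ Ioo (0 : ℝ) 1
      · have hd : depth x ≤ 0 := not_lt.1 fun h => hx (mem_cube_one_iff.2 ⟨hy, h⟩)
        by_cases hb : x ∈ bigCube
        · rw [indicator_of_mem hb]
          rcases hd.eq_or_lt with h0 | h0
          · simp [F, h0]
          · simp only [F, if_neg h0.ne, indicator_of_mem (show depth x ∈ Iio (0 : ℝ) from h0)]
            exact ENNReal.ofReal_le_ofReal (p.sq_norm_gradient_le hG hy h0)
        · have hd1 : depth x ≤ -1 := by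
            by_contra h
            rw [not_le] at h
            simp only [depth, lt_min_iff] at h
            refine hb fun i => ?_
            fin_cases i
            · exact ⟨h.1.1, by simp only [Fin.zero_eta]; linarith [h.1.2]⟩
            · exact ⟨by simp only [Fin.mk_one]; linarith [hy.1],
                by simp only [Fin.mk_one]; linarith [hy.2]⟩
            · exact ⟨h.2.1, by simp only [Fin.reduceFinMk]; linarith [h.2.2]⟩
          have h2 := p.sq_norm_gradient_le hG hy (by linarith)
          rw [outerBound, if_neg (by linarith [p.h_le_one, p.w_pos])] at h2
          rw [ENNReal.ofReal_of_nonpos h2]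
          exact zero_le
      · rw [p.gradient_eq_zero_of_notMem hG hy]
        simp
    calc _ ≤ ∫⁻ x in (cube 1)ᶜ, bigCube.indicator (fun x => F (x 1) (depth x)) x :=
          setLIntegral_mono_ae' (isOpen_cube 1).measurableSet.compl h1
      _ ≤ ∫⁻ x, bigCube.indicator (fun x => F (x 1) (depth x)) x :=
          lintegral_mono' Measure.restrict_le_self le_rfl
      _ = ∫⁻ x in bigCube, F (x 1) (depth x) := lintegral_indicator isOpen_bigCube.measurableSet _
      _ ≤ 12 * ∫⁻ s, ∫⁻ y in Ioo (-1) 2, F y s := lintegral_depth_le F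
      _ ≤ 12 * ∫⁻ s in Iio (0 : ℝ), ∫⁻ y in Ioo (-1 : ℝ) 2, ENNReal.ofReal (p.outerBound y s) := by
          refine mul_le_mul' le_rfl ?_
          rw [← lintegral_indicator measurableSet_Iio]
          refine lintegral_mono_ae ?_
          filter_upwards [compl_mem_ae_iff.2 (Real.volume_singleton (a := 0))] with s hs
          have hs : s ≠ 0 := hs
          by_cases h : s < 0
          · simp only [F, if_neg hs, indicator_of_mem (show s ∈ Iio (0 : ℝ) from h)]
            exact le_rfl
          · simp [F, if_neg hs, indicator_of_notMem (show s ∉ Iio (0 : ℝ) from h)]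
      _ ≤ 12 * ENNReal.ofReal (20 * p.θ ^ 2 * p.h * Real.log (p.h / p.w)) :=
          mul_le_mul' le_rfl p.lintegral_outerBound_le
      _ = _ := by
          rw [show (12 : ℝ≥0∞) = ENNReal.ofReal 12 by norm_num,
            ← ENNReal.ofReal_mul (by norm_num)]
          congr 1
          ring

end NeedleData

/-! ### The line tension of the construction -/

/-- A dyadic scale comparable to, but finer than, a given number. -/
theorem exists_dyadic {κ : ℝ} (h0 : 0 < κ) (h1 : κ ≤ 1) :
    ∃ J : ℕ, 1 / 2 ^ J ≤ κ / 2 ∧ (2 ^ J : ℝ) ≤ 4 / κ := by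
  obtain ⟨n, hn, hn'⟩ := exists_nat_pow_near ((one_le_div h0).2 h1) (one_lt_two (α := ℝ))
  refine ⟨n + 2, ?_, ?_⟩
  · rw [div_lt_iff₀ h0] at hn'
    rw [div_le_div_iff₀ (by positivity) two_pos]
    have : (2 : ℝ) ^ (n + 2) = 2 * 2 ^ (n + 1) := by ring
    rw [this]
    nlinarith
  · rw [le_div_iff₀ h0] at hn ⊢
    have : (2 : ℝ) ^ (n + 2) = 4 * 2 ^ n := by ring
    rw [this]
    nlinarith

namespace NeedleData

variable (p : NeedleData)

/-- Up to a null set, the indicator function of the slip set is, where it can be nonzero, a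
derivative of the corrector plus a constant, and therefore measurable. -/
theorem aestronglyMeasurable_indicator_slipSet :
    AEStronglyMeasurable (p.slipSet.indicator fun _ => (1 : ℝ)) volume := by
  obtain ⟨C, hC⟩ := p.exists_lipschitz_corrector
  have hm : AEStronglyMeasurable (fun x => inner ℝ ((∇ p.corrector) x)
      (EuclideanSpace.single 1 (1 : ℝ)) + p.θ) volume :=
    ((hasWeakGradient_of_lipschitz hC).2.1.aestronglyMeasurable.inner
      aestronglyMeasurable_const).add_const _
  have hcont : Continuous depth := by unfold depth; fun_prop
  have hA : MeasurableSet {x : E3 | p.δ ≤ depth x ∧ x 1 ∈ Ico (0 : ℝ) 1} :=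
    (measurableSet_le measurable_const hcont.measurable).inter
      (measurableSet_Ico.preimage (by fun_prop))
  refine (hm.indicator hA).congr ?_
  filter_upwards [hC.ae_differentiableAt] with x hx
  classical
  by_cases h : p.δ ≤ depth x ∧ x 1 ∈ Ico (0 : ℝ) 1
  · rw [indicator_of_mem (show x ∈ {x : E3 | p.δ ≤ depth x ∧ x 1 ∈ Ico (0 : ℝ) 1} from h)]
    obtain ⟨n, hn, hρ, hu⟩ := exists_cell_index p.N_pos h.2
    change ∀ m ∈ Finset.range p.N, m ≠ n → x 1 - m * p.h < 0 ∨ p.h ≤ x 1 - m * p.h at hu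
    rw [p.indicator_slipSet_eq h.1 hn hu, inner_single_one, p.gradient_one_eq_of_pos
      hx.hasGradientAt h.2 (p.δ_pos.trans_le h.1) hn hu, sub_add_cancel]
  · rw [indicator_of_notMem (show x ∉ {x : E3 | p.δ ≤ depth x ∧ x 1 ∈ Ico (0 : ℝ) 1} from h),
      indicator_of_notMem fun hx => h ⟨hx.1, p.mem_Ico_of_mem_slipSet hx⟩]

theorem locallyIntegrable_indicator_slipSet :
    LocallyIntegrable (p.slipSet.indicator fun _ => (1 : ℝ)) volume :=
  (locallyIntegrable_const (1 : ℝ)).mono p.aestronglyMeasurable_indicator_slipSet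
    (ae_of_all _ fun x => by
      by_cases h : x ∈ p.slipSet <;> simp [h])

/-- The boundaries of the needles have slope at most `1`. -/
theorem K_mul_rpow_le : p.K * p.δ ^ (-(1 / 3) : ℝ) ≤ 1 := by
  have h1 : p.K ≤ p.δ ^ (1 / 3 : ℝ) := by
    refine (Real.le_rpow_inv_iff_of_pos p.K_nonneg p.δ_pos.le (by norm_num : (0 : ℝ) < 3)).2 ?_
      |>.trans_eq (by norm_num)
    exact_mod_cast p.K_cube_le
  calc p.K * p.δ ^ (-(1 / 3) : ℝ) ≤ p.δ ^ (1 / 3 : ℝ) * p.δ ^ (-(1 / 3) : ℝ) :=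
        mul_le_mul_of_nonneg_right h1 (Real.rpow_nonneg p.δ_pos.le _)
    _ = 1 := by rw [← Real.rpow_add p.δ_pos]; norm_num

/-- The points at which a small translation changes the slip system lie close to the boundary of the
lateral layer, or close to the end of a needle. -/
theorem near_boundary_of_slipSet {x x' : E3} {t : ℝ} (ht : t ≤ p.δ / 2) (hxx : ‖x - x'‖ ≤ t)
    {J : ℝ → ℕ} (hJ : ∀ s, p.δ ≤ s → s ≤ 1 → 1 / 2 ^ J s ≤ fineness p.δ s / 2)
    (h : ¬(x ∈ p.slipSet ↔ x' ∈ p.slipSet)) :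
    depth x ∈ Icc (p.δ - t) (p.δ + t) ∨ p.δ ≤ depth x ∧ ∃ n ∈ Finset.range p.N,
      ∃ i ∈ Finset.range (2 ^ J (depth x)),
        x 1 ∈ Icc (n * p.h + i * (p.w / 2 ^ J (depth x)) - 3 * t)
          (n * p.h + i * (p.w / 2 ^ J (depth x)) + 3 * t) ∨
        x 1 ∈ Icc (n * p.h + (i + 1) * (p.w / 2 ^ J (depth x)) - 3 * t)
          (n * p.h + (i + 1) * (p.w / 2 ^ J (depth x)) + 3 * t) ∨
        x 1 ∈ Icc (n * p.h + (i * (p.w / 2 ^ J (depth x)) +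
            (branch p.a p.w ((i + 1) * (p.w / 2 ^ J (depth x))) (fineness p.δ (depth x)) -
              branch p.a p.w (i * (p.w / 2 ^ J (depth x))) (fineness p.δ (depth x)))) - 3 * t)
          (n * p.h + (i * (p.w / 2 ^ J (depth x)) +
            (branch p.a p.w ((i + 1) * (p.w / 2 ^ J (depth x))) (fineness p.δ (depth x)) -
              branch p.a p.w (i * (p.w / 2 ^ J (depth x))) (fineness p.δ (depth x)))) + 3 * t) := by
  have ht0 : 0 ≤ t := (norm_nonneg _).trans hxx
  have hd := abs_le.1 ((abs_depth_sub_le x x').trans hxx)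
  by_cases hb : depth x ∈ Icc (p.δ - t) (p.δ + t)
  · exact Or.inl hb
  refine Or.inr ?_
  rcases le_or_gt p.δ (depth x) with hδ | hδ
  · have hδ' : p.δ ≤ depth x' := by
      by_contra h'
      exact hb ⟨by linarith, by linarith [not_le.1 h']⟩
    refine ⟨hδ, ?_⟩
    have : ∃ n ∈ Finset.range p.N, ¬(Needle p.a p.w (x 1 - n * p.h) (fineness p.δ (depth x)) ↔
        Needle p.a p.w (x' 1 - n * p.h) (fineness p.δ (depth x'))) := by
      by_contra! hall
      exact h ⟨fun ⟨_, n, hn, hN⟩ => ⟨hδ', n, hn, (hall n hn).1 hN⟩,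
        fun ⟨_, n, hn, hN⟩ => ⟨hδ, n, hn, (hall n hn).2 hN⟩⟩
    obtain ⟨n, hn, hN⟩ := this
    have hJx := hJ _ hδ (depth_le_one x)
    have hf0 := fineness_pos p.δ_pos (p.δ_pos.trans_le hδ)
    have hρ : |x 1 - n * p.h - (x' 1 - n * p.h)| ≤ t := by
      rw [sub_sub_sub_cancel_right]
      exact (by simpa using abs_coord_le_norm (x - x') 1 : |x 1 - x' 1| ≤ ‖x - x'‖).trans hxx
    have hbr : ∀ r ≤ p.w, |branch p.a p.w r (fineness p.δ (depth x)) -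
        branch p.a p.w r (fineness p.δ (depth x'))| ≤ t := by
      intro r hr
      have hl := p.lipschitz r _ _ (p.fineness_mem (depth_le_one x))
        (p.fineness_mem (depth_le_one x'))
      rw [min_eq_left hr] at hl
      refine hl.trans ?_
      have h2 := abs_fineness_sub_le p.δ_pos p.δ_pos (le_max_right (depth x) p.δ)
        (le_max_right (depth x') p.δ)
      calc _ ≤ p.K * (p.δ ^ (-(1 / 3) : ℝ) * |depth x - depth x'|) :=
            mul_le_mul_of_nonneg_left h2 p.K_nonneg
        _ ≤ 1 * |depth x - depth x'| := by
            rw [← mul_assoc]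
            exact mul_le_mul_of_nonneg_right p.K_mul_rpow_le (abs_nonneg _)
        _ ≤ t := by rw [one_mul]; exact abs_le.2 hd
    obtain ⟨i, hi, hcase⟩ := near_boundary_of_needle p.a_pos.le p.w_pos
      (hJx.trans (by linarith)) (hJx.trans (half_fineness_le p.δ_pos hδ (by linarith))) hρ hbr hN
    refine ⟨n, hn, i, Finset.mem_range.2 hi, ?_⟩
    rcases hcase with h1 | h1 | h1
    · have := abs_le.1 h1
      exact Or.inl ⟨by linarith, by linarith⟩
    · have := abs_le.1 h1
      exact Or.inr (Or.inl ⟨by linarith, by linarith⟩)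
    · have := abs_le.1 h1
      exact Or.inr (Or.inr ⟨by linarith, by linarith⟩)
  · exfalso
    have hδ' : depth x' < p.δ := by
      by_contra h'
      exact hb ⟨by linarith [not_lt.1 h'], by linarith⟩
    exact h ⟨fun h => absurd h.1 (not_le.2 hδ), fun h => absurd h.1 (not_le.2 hδ')⟩

/-- The boundary of the slip set has area of order `N`: at depth `s` there are at most `4 s ^
(-2/3)` needles in each of the `N` cells. -/
theorem lintegral_translate_slipSet_le {v : E3} (hv : ‖v‖ ≤ 1) {t : ℝ} (ht0 : 0 < t)
    (ht : t ≤ p.δ / 2) :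
    ∫⁻ x in cube 1, ‖p.slipSet.indicator (fun _ => (1 : ℝ)) (x - t • v) -
        p.slipSet.indicator (fun _ => (1 : ℝ)) x‖ₑ ≤ ENNReal.ofReal (2664 * p.N * t) := by
  classical
  have hex : ∀ s, ∃ J : ℕ, p.δ ≤ s → s ≤ 1 → 1 / 2 ^ J ≤ fineness p.δ s / 2 ∧
      (2 ^ J : ℝ) ≤ 4 / fineness p.δ s := fun s => by
    by_cases hs : p.δ ≤ s ∧ s ≤ 1
    · obtain ⟨J, hJ⟩ := exists_dyadic (fineness_pos p.δ_pos (p.δ_pos.trans_le hs.1))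
        (fineness_le_one p.δ_pos p.δ_le hs.2)
      exact ⟨J, fun _ _ => hJ⟩
    · exact ⟨0, fun h1 h2 => absurd ⟨h1, h2⟩ hs⟩
  choose J hJ using hex
  let c₃ : ℝ → ℕ → ℕ → ℝ := fun s n i => n * p.h + (i * (p.w / 2 ^ J s) +
    (branch p.a p.w ((i + 1) * (p.w / 2 ^ J s)) (fineness p.δ s) -
      branch p.a p.w (i * (p.w / 2 ^ J s)) (fineness p.δ s)))
  let χ : ℝ → ℝ → ℝ≥0∞ := fun c y =>
    (Icc (c - 3 * t) (c + 3 * t)).indicator (fun _ => (1 : ℝ≥0∞)) y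
  let G : ℝ → ℝ → ℕ → ℕ → ℝ≥0∞ := fun y s n i => χ (n * p.h + i * (p.w / 2 ^ J s)) y +
    (χ (n * p.h + (i + 1) * (p.w / 2 ^ J s)) y + χ (c₃ s n i) y)
  let F : ℝ → ℝ → ℝ≥0∞ := fun y s =>
    (Icc (p.δ - t) (p.δ + t)).indicator (fun _ => (1 : ℝ≥0∞)) s +
      if s ∈ Icc p.δ 1 then ∑ n ∈ Finset.range p.N, ∑ i ∈ Finset.range (2 ^ J s), G y s n i else 0
  have hχm : ∀ c, Measurable (χ c) := fun c => measurable_const.indicator measurableSet_Icc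
  have hχ : ∀ c, ∫⁻ y in Ioo (-1 : ℝ) 2, χ c y ≤ ENNReal.ofReal (6 * t) := fun c => by
    refine (lintegral_mono' Measure.restrict_le_self le_rfl).trans ?_
    rw [lintegral_indicator_const measurableSet_Icc, Real.volume_Icc, one_mul]
    exact ENNReal.ofReal_le_ofReal (by linarith)
  have hF : ∀ x, ‖p.slipSet.indicator (fun _ => (1 : ℝ)) (x - t • v) -
      p.slipSet.indicator (fun _ => (1 : ℝ)) x‖ₑ ≤ F (x 1) (depth x) := fun x => by
    by_cases h : x ∈ p.slipSet ↔ x - t • v ∈ p.slipSet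
    · by_cases hx : x ∈ p.slipSet
      · simp [hx, h.1 hx]
      · have hx' : x - t • v ∉ p.slipSet := fun h' => hx (h.2 h')
        simp [hx, hx']
    · have h1 : ‖p.slipSet.indicator (fun _ => (1 : ℝ)) (x - t • v) -
          p.slipSet.indicator (fun _ => (1 : ℝ)) x‖ₑ ≤ 1 := by
        by_cases hx : x ∈ p.slipSet <;> by_cases hx' : x - t • v ∈ p.slipSet <;> simp [hx, hx']
      refine h1.trans ?_
      have hn : ‖x - (x - t • v)‖ ≤ t := by
        rw [sub_sub_cancel, norm_smul, Real.norm_of_nonneg ht0.le]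
        exact mul_le_of_le_one_right ht0.le hv
      rcases p.near_boundary_of_slipSet ht hn (fun s h1 h2 => (hJ s h1 h2).1) h
        with h2 | ⟨h2, n, hn, i, hi, h3⟩
      · simp only [F, indicator_of_mem h2]
        exact le_self_add
      · simp only [F]
        rw [if_pos (show depth x ∈ Icc p.δ 1 from ⟨h2, depth_le_one x⟩)]
        refine le_trans ?_ le_add_self
        refine le_trans ?_ (Finset.single_le_sum (f := fun n =>
          ∑ i ∈ Finset.range (2 ^ J (depth x)), G (x 1) (depth x) n i) (fun _ _ => zero_le) hn)
        refine le_trans ?_ (Finset.single_le_sum (f := fun i => G (x 1) (depth x) n i)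
          (fun _ _ => zero_le) hi)
        rcases h3 with h3 | h3 | h3
        · refine le_trans ?_ le_self_add
          simp only [χ, indicator_of_mem h3]
          exact le_rfl
        · refine le_trans (le_trans ?_ le_self_add) le_add_self
          simp only [χ, indicator_of_mem h3]
          exact le_rfl
        · refine le_trans (le_trans ?_ le_add_self) le_add_self
          simp only [χ, c₃, indicator_of_mem h3]
          exact le_rfl
  have hI : ∀ s, ∫⁻ y in Ioo (-1 : ℝ) 2, F y s ≤
      (Icc (p.δ - t) (p.δ + t)).indicator (fun _ => (3 : ℝ≥0∞)) s +
      (Ioc (0 : ℝ) 1).indicator (fun s => ENNReal.ofReal (72 * p.N * t) *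
        ENNReal.ofReal (s ^ (-(2 / 3) : ℝ))) s := fun s => by
    simp only [F]
    rw [lintegral_add_left measurable_const]
    refine add_le_add ?_ ?_
    · rw [lintegral_const, Measure.restrict_apply_univ, Real.volume_Ioo]
      by_cases h : s ∈ Icc (p.δ - t) (p.δ + t)
      · rw [indicator_of_mem h, indicator_of_mem h]
        norm_num
      · simp [indicator_of_notMem h]
    · split_ifs with h
      · have hs0 := p.δ_pos.trans_le h.1
        rw [indicator_of_mem (show s ∈ Ioc (0 : ℝ) 1 from ⟨hs0, h.2⟩)]
        have hGm : ∀ n i, Measurable fun y => G y s n i := fun n i =>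
          (hχm _).add ((hχm _).add (hχm _))
        have hG : ∀ n i, ∫⁻ y in Ioo (-1 : ℝ) 2, G y s n i ≤
            ENNReal.ofReal (18 * t) := fun n i => by
          simp only [G]
          rw [lintegral_add_left (hχm _), lintegral_add_left (hχm _)]
          refine (add_le_add (hχ _) (add_le_add (hχ _) (hχ _))).trans_eq ?_
          rw [← ENNReal.ofReal_add (by positivity) (by positivity),
            ← ENNReal.ofReal_add (by positivity) (by positivity)]
          congr 1
          ring
        rw [lintegral_finsetSum _ fun n _ => Finset.measurable_fun_sum _ fun i _ => hGm n i]
        have h1 : ∀ n ∈ Finset.range p.N, ∫⁻ y in Ioo (-1 : ℝ) 2,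
            ∑ i ∈ Finset.range (2 ^ J s), G y s n i ≤
              (2 ^ J s : ℕ) * ENNReal.ofReal (18 * t) := fun n _ => by
          rw [lintegral_finsetSum _ fun i _ => hGm n i]
          refine (Finset.sum_le_sum fun i _ => hG n i).trans_eq ?_
          rw [Finset.sum_const, Finset.card_range, nsmul_eq_mul]
        refine (Finset.sum_le_sum h1).trans ?_
        rw [Finset.sum_const, Finset.card_range, nsmul_eq_mul, ← ENNReal.ofReal_natCast,
          ← ENNReal.ofReal_natCast, ← ENNReal.ofReal_mul (by positivity),
          ← ENNReal.ofReal_mul (by positivity),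
          ← ENNReal.ofReal_mul (by have := p.N_pos'; positivity)]
        refine ENNReal.ofReal_le_ofReal ?_
        have h2 := (hJ s h.1 h.2).2
        have e : 4 / fineness p.δ s = 4 * s ^ (-(2 / 3) : ℝ) := by
          rw [fineness_eq p.δ_pos h.1, Real.rpow_neg hs0.le, div_eq_mul_inv]
        rw [e] at h2
        push_cast
        have hN := p.N_pos'
        calc (p.N : ℝ) * (2 ^ J s * (18 * t))
            ≤ p.N * (4 * s ^ (-(2 / 3) : ℝ) * (18 * t)) := by gcongr
          _ = _ := by ring
      · simp
  calc _ ≤ ∫⁻ x in cube 1, F (x 1) (depth x) := lintegral_mono hF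
    _ ≤ ∫⁻ x in bigCube, F (x 1) (depth x) := lintegral_mono_set cube_subset_bigCube
    _ ≤ 12 * ∫⁻ s, ∫⁻ y in Ioo (-1) 2, F y s := lintegral_depth_le F
    _ ≤ 12 * (3 * ENNReal.ofReal (2 * t) + ENNReal.ofReal (72 * p.N * t) * 3) := by
        refine mul_le_mul' le_rfl ((lintegral_mono hI).trans_eq ?_)
        rw [lintegral_add_left (measurable_const.indicator measurableSet_Icc),
          lintegral_indicator_const measurableSet_Icc, Real.volume_Icc,
          lintegral_indicator measurableSet_Ioc, lintegral_const_mul' _ _ ENNReal.ofReal_ne_top,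
          lintegral_rpow_unit]
        congr 3
        ring
    _ ≤ _ := by
        have hN : (1 : ℝ) ≤ p.N := by exact_mod_cast p.N_pos
        rw [show (12 : ℝ≥0∞) = ENNReal.ofReal 12 by norm_num,
          show (3 : ℝ≥0∞) = ENNReal.ofReal 3 by norm_num,
          ← ENNReal.ofReal_mul (by positivity), ← ENNReal.ofReal_mul (by positivity),
          ← ENNReal.ofReal_add (by positivity) (by positivity),
          ← ENNReal.ofReal_mul (by positivity)]
        refine ENNReal.ofReal_le_ofReal ?_
        nlinarith

theorem dirVariation_indicator_slipSet_le {v : E3} (hv : ‖v‖ ≤ 1) :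
    dirVariation (cube 1) v (p.slipSet.indicator fun _ => (1 : ℝ)) ≤
      ENNReal.ofReal (2664 * p.N) := by
  refine dirVariation_le_of_translate p.locallyIntegrable_indicator_slipSet v (by positivity)
    fun K hK _ => ?_
  filter_upwards [Ioc_mem_nhdsGT (half_pos p.δ_pos)] with t ht
  exact (lintegral_mono_set hK).trans (p.lintegral_translate_slipSet_le hv ht.1 ht.2)

theorem dirVariation_one_sub_indicator_slipSet_le {v : E3} (hv : ‖v‖ ≤ 1) :
    dirVariation (cube 1) v (fun x => 1 - p.slipSet.indicator (fun _ => (1 : ℝ)) x) ≤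
      ENNReal.ofReal (2664 * p.N) := by
  refine dirVariation_le_of_translate
    ((locallyIntegrable_const 1).sub p.locallyIntegrable_indicator_slipSet) v (by positivity)
    fun K hK _ => ?_
  filter_upwards [Ioc_mem_nhdsGT (half_pos p.δ_pos)] with t ht
  refine le_trans (le_of_eq (lintegral_congr fun x => ?_))
    ((lintegral_mono_set hK).trans (p.lintegral_translate_slipSet_le hv ht.1 ht.2))
  simp only [Pi.sub_apply]
  rw [sub_sub_sub_cancel_left, ← enorm_neg, neg_sub]

@[simp] theorem etaComp_slip (x : E3) :
    etaComp (p.slip x) = p.slipSet.indicator (fun _ => (1 : ℝ)) x := by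
  rw [etaComp, slip, inner_add_left, inner_smul_left, inner_smul_left, inner_eXi_eEta,
    real_inner_self_eq_norm_sq, norm_eEta]
  simp

@[simp] theorem xiComp_slip (x : E3) :
    xiComp (p.slip x) = 1 - p.slipSet.indicator (fun _ => (1 : ℝ)) x := by
  rw [xiComp, slip, inner_add_left, inner_smul_left, inner_smul_left, real_inner_comm,
    inner_eXi_eEta, real_inner_self_eq_norm_sq, norm_eXi]
  simp

theorem lineEnergy_slip_le : lineEnergy 1 p.slip ≤ ENNReal.ofReal (10656 * p.N) := by
  unfold lineEnergy
  simp only [etaComp_slip, xiComp_slip]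
  have h1 := p.dirVariation_indicator_slipSet_le norm_eXi.le
  have h2 := p.dirVariation_indicator_slipSet_le norm_e3.le
  have h3 := p.dirVariation_one_sub_indicator_slipSet_le norm_eEta.le
  have h4 := p.dirVariation_one_sub_indicator_slipSet_le norm_e3.le
  refine (add_le_add (add_le_add (add_le_add h1 h2) h3) h4).trans_eq ?_
  rw [← ENNReal.ofReal_add (by positivity) (by positivity),
    ← ENNReal.ofReal_add (by positivity) (by positivity),
    ← ENNReal.ofReal_add (by positivity) (by positivity)]
  congr 1
  ring

theorem mem_admissible : (p.deformation, p.slip) ∈ admissible 1 := by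
  obtain ⟨C, hC⟩ := p.exists_lipschitz_corrector
  have hc : Continuous p.deformation :=
    (lipschitz_farField p.θ).continuous.sub (continuous_const.mul hC.continuous)
  have hm := p.aestronglyMeasurable_indicator_slipSet
  refine ⟨hc.locallyIntegrable, ?_, ae_of_all _ fun x => ?_⟩
  · have hl : LocallyIntegrable p.slip volume := by
      refine (locallyIntegrable_const (2 : ℝ)).mono
        ((hm.smul_const _).add ((aestronglyMeasurable_const.sub hm).smul_const _))
        (ae_of_all _ fun x => ?_)
      refine (norm_add_le _ _).trans ?_
      rw [norm_smul, norm_smul, norm_eEta, norm_eXi]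
      by_cases h : x ∈ p.slipSet <;> simp [h]
    have hb : Bornology.IsBounded (cube 1) := by
      refine (Metric.isBounded_closedBall (x := (0 : E3)) (r := √3)).subset fun x hx => ?_
      rw [mem_closedBall_zero_iff, EuclideanSpace.norm_eq]
      refine Real.sqrt_le_sqrt ?_
      rw [Fin.sum_univ_three]
      have h : ∀ i, ‖x i‖ ^ 2 ≤ 1 := fun i => by
        have := hx i
        rw [Real.norm_of_nonneg this.1.le]
        nlinarith [this.1, this.2]
      linarith [h 0, h 1, h 2]
    exact (hl.integrableOn_isCompact hb.isCompact_closure).mono_set subset_closure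
  · simp only [etaComp_slip, xiComp_slip]
    by_cases h : x ∈ p.slipSet <;> simp [h, slip, eXi, eEta]

/-- The energy of the construction with needles: line tension, refinement of the needles, lateral
layer, and exterior transition. -/
theorem infEnergy_le {ε : ℝ} (hε : 0 ≤ ε) {μ : ℝ} (hμ : 0 ≤ μ) :
    infEnergy ε μ p.θ 1 ≤ ENNReal.ofReal (10656 * (ε * p.N) + 576 * (p.K ^ 2 * (p.N * p.w)) +
      72 * p.δ + 240 * (μ * (p.θ ^ 2 * p.h * Real.log (p.h / p.w)))) := by
  have hN := p.N_pos'
  have hw := p.w_pos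
  have hδ := p.δ_pos
  have hh := p.h_pos
  have hlog : 0 ≤ Real.log (p.h / p.w) := Real.log_nonneg ((one_le_div hw).2 p.w_le_h)
  refine (iInf₂_le _ p.mem_admissible).trans ?_
  refine (add_le_add (p.elasticEnergy_deformation_le μ)
    (mul_le_mul' le_rfl p.lineEnergy_slip_le)).trans_eq ?_
  rw [← ENNReal.ofReal_mul hμ, ← ENNReal.ofReal_mul hε, ← ENNReal.ofReal_add (by positivity)
    (by positivity), ← ENNReal.ofReal_add (by positivity) (by positivity)]
  congr 1
  ring

end NeedleData

/-! ### The energies of the competitors -/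

/-- The energy of a Lipschitz perturbation of the far field, without slip in the direction of
`eEta`. -/
theorem infEnergy_le_of_lipschitz {ε μ θ : ℝ} {f : E3 → ℝ} {K : ℝ≥0} (hθ : θ ≤ 1)
    (hf : LipschitzWith K f) :
    infEnergy ε μ θ 1 ≤ (∫⁻ x in cube 1, ‖θ • eEta - (∇ f) x‖ₑ ^ 2) +
      ENNReal.ofReal μ * ∫⁻ x in (cube 1)ᶜ, ‖(∇ f) x‖ₑ ^ 2 := by
  have hadm : (farField θ - f, fun _ : E3 => (1 - θ) • eXi) ∈ admissible 1 := by
    refine ⟨((lipschitz_farField θ).continuous.sub hf.continuous).locallyIntegrable,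
      integrableOn_const (by rw [volume_cube_one]; simp), ae_of_all _ fun x => ?_⟩
    have h1 : xiComp ((1 - θ) • eXi) = 1 - θ := by
      rw [xiComp, inner_smul_left, real_inner_self_eq_norm_sq, norm_eXi]
      simp
    have h2 : etaComp ((1 - θ) • eXi) = 0 := by
      rw [etaComp, inner_smul_left, inner_eXi_eEta, mul_zero]
    simp only [h1, h2]
    exact ⟨by simp [eXi], by simp, le_rfl, by linarith⟩
  have hconst : ∀ (v : E3) (c : ℝ), dirVariation (cube 1) v (fun _ => c) = 0 := fun v c => by
    have := dirVariation_le_of_translate (U := cube 1) (locallyIntegrable_const c) v le_rfl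
      fun K _ _ => Eventually.of_forall fun t => by simp
    simpa using this
  refine (iInf₂_le _ hadm).trans ?_
  have hline : lineEnergy 1 (fun _ : E3 => (1 - θ) • eXi) = 0 := by simp [lineEnergy, hconst]
  simp only [energy, hline, mul_zero, add_zero]
  refine (iInf₂_le _ ((hasWeakGradient_farField θ).sub (hasWeakGradient_of_lipschitz hf))).trans ?_
  refine add_le_add (le_of_eq (lintegral_congr fun x => ?_))
    (mul_le_mul' le_rfl (le_of_eq (lintegral_congr fun x => ?_)))
  · simp only [Pi.sub_apply]
    congr 2
    simp only [farGrad]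
    abel
  · simp only [Pi.sub_apply]
    rw [gradient_farField, sub_sub_cancel_left, enorm_neg]

/-- Without slip on the second system, the energy is that of the misfit inside the cube. -/
theorem infEnergy_le_one (ε μ : ℝ) {θ : ℝ} (hθ : 0 ≤ θ) (hθ1 : θ ≤ 1) :
    infEnergy ε μ θ 1 ≤ ENNReal.ofReal (θ ^ 2) := by
  refine (infEnergy_le_of_lipschitz hθ1 (LipschitzWith.const (0 : ℝ))).trans_eq ?_
  have h : ∀ x : E3, (∇ fun _ : E3 => (0 : ℝ)) x = 0 := fun x => by simp [gradient]
  simp only [h, sub_zero, enorm_zero]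
  rw [lintegral_const, Measure.restrict_apply_univ, volume_cube_one, mul_one, ← ofReal_norm,
    norm_smul, norm_eEta, mul_one, Real.norm_of_nonneg hθ, ENNReal.ofReal_pow hθ]
  simp

/-- The misfit can be moved to the exterior by a compactly supported correction, which coincides
with `θ x_η` on the cube. -/
theorem infEnergy_le_mu (ε : ℝ) {μ θ : ℝ} (hμ : 0 ≤ μ) (hθ : 0 ≤ θ) (hθ1 : θ ≤ 1) :
    infEnergy ε μ θ 1 ≤ ENNReal.ofReal (300 * (θ ^ 2 * μ)) := by
  set ψ : E3 → ℝ := fun x => max 0 (4 - ‖x‖) with hψ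
  set φ : E3 → ℝ := fun x => max (-ψ x) (min (etaComp x) (ψ x)) with hφ
  have hψL : LipschitzWith 1 ψ := by
    have : LipschitzWith 1 fun x : E3 => 4 - ‖x‖ := LipschitzWith.of_dist_le_mul fun x y => by
      rw [Real.dist_eq, sub_sub_sub_cancel_left, dist_eq_norm, NNReal.coe_one, one_mul,
        norm_sub_rev]
      exact abs_norm_sub_norm_le y x
    exact this.const_max 0
  have hηL : LipschitzWith 1 etaComp := LipschitzWith.of_dist_le_mul fun x y => by
    rw [Real.dist_eq, etaComp, etaComp, ← inner_sub_left, dist_eq_norm, NNReal.coe_one, one_mul]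
    refine (abs_real_inner_le_norm _ _).trans_eq ?_
    rw [norm_eEta, mul_one]
  have hφL : LipschitzWith 1 φ := by
    have := hψL.neg.max (hηL.min hψL)
    simpa using this
  have hL : LipschitzWith ‖θ‖₊ fun x => θ * φ x := by
    have := (lipschitzWith_smul θ).comp hφL
    rw [mul_one] at this
    exact this
  have hg : ∀ x, ‖(∇ fun x => θ * φ x) x‖ ≤ θ := fun x => by
    simp only [gradient, LinearIsometryEquiv.norm_map]
    refine (norm_fderiv_le_of_lipschitz ℝ hL).trans_eq ?_
    simp [abs_of_nonneg hθ]
  have hin : ∀ x ∈ cube 1, (∇ fun x => θ * φ x) x = θ • eEta := fun x hx => by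
    have hnorm : ∀ y ∈ cube 1, ‖y‖ ≤ 2 := fun y hy => by
      refine (sq_le_sq₀ (norm_nonneg _) zero_le_two).1 ?_
      rw [sq_norm_eq]
      have h : ∀ i, y i ^ 2 ≤ 1 := fun i => by
        have := hy i
        nlinarith [this.1, this.2]
      linarith [h 0, h 1, h 2]
    have heq : (fun x => θ * φ x) =ᶠ[𝓝 x]
        fun x => (InnerProductSpace.toDual ℝ E3) (θ • eEta) x := by
      filter_upwards [(isOpen_cube 1).mem_nhds hx] with y hy
      have h1 := hnorm y hy
      have h2 : |etaComp y| ≤ ‖y‖ := by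
        refine (abs_real_inner_le_norm _ _).trans_eq ?_
        rw [norm_eEta, mul_one]
      have h3 := abs_le.1 h2
      have h4 : 2 ≤ ψ y := le_max_of_le_right (by linarith)
      rw [InnerProductSpace.toDual_apply_apply, inner_smul_left, real_inner_comm]
      simp only [hφ]
      rw [min_eq_left (by linarith), max_eq_right (by linarith)]
      simp [etaComp]
    refine HasGradientAt.gradient ?_
    rw [hasGradientAt_iff_hasFDerivAt]
    exact (ContinuousLinearMap.hasFDerivAt _).congr_of_eventuallyEq heq
  have hout : ∀ x ∉ Metric.closedBall (0 : E3) 4, (∇ fun x => θ * φ x) x = 0 := fun x hx => by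
    have heq : (fun x => θ * φ x) =ᶠ[𝓝 x] fun _ => 0 := by
      filter_upwards [Metric.isClosed_closedBall.isOpen_compl.mem_nhds hx] with y hy
      have hy : 4 < ‖y‖ := by simpa using hy
      have h1 : ψ y = 0 := max_eq_left (by linarith)
      simp only [hφ, h1, neg_zero]
      rw [max_eq_left (min_le_right _ _), mul_zero]
    simp [gradient, heq.fderiv_eq]
  refine (infEnergy_le_of_lipschitz hθ1 hL).trans ?_
  have h1 : ∫⁻ x in cube 1, ‖θ • eEta - (∇ fun x => θ * φ x) x‖ₑ ^ 2 = 0 := by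
    rw [setLIntegral_congr_fun (g := fun _ => 0) (isOpen_cube 1).measurableSet fun x hx => ?_]
    · simp
    · simp [hin x hx]
  rw [h1, zero_add, show 300 * (θ ^ 2 * μ) = μ * (θ ^ 2 * 300) by ring, ENNReal.ofReal_mul hμ]
  refine mul_le_mul' le_rfl ?_
  calc ∫⁻ x in (cube 1)ᶜ, ‖(∇ fun x => θ * φ x) x‖ₑ ^ 2
      ≤ ∫⁻ x, (Metric.closedBall (0 : E3) 4).indicator (fun _ => ENNReal.ofReal (θ ^ 2)) x := by
        refine (lintegral_mono' Measure.restrict_le_self le_rfl).trans (lintegral_mono fun x => ?_)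
        by_cases hx : x ∈ Metric.closedBall (0 : E3) 4
        · rw [indicator_of_mem hx, ← ofReal_norm, ← ENNReal.ofReal_pow (norm_nonneg _)]
          exact ENNReal.ofReal_le_ofReal (pow_le_pow_left₀ (norm_nonneg _) (hg x) 2)
        · rw [hout x hx]
          simp
    _ = ENNReal.ofReal (θ ^ 2) * (ENNReal.ofReal 4 ^ 3 * ENNReal.ofReal (Real.pi * 4 / 3)) := by
        rw [lintegral_indicator_const Metric.isClosed_closedBall.measurableSet,
          EuclideanSpace.volume_closedBall_fin_three]
    _ ≤ _ := by
        rw [← ENNReal.ofReal_pow (by norm_num), ← ENNReal.ofReal_mul (by norm_num),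
          ← ENNReal.ofReal_mul (by positivity)]
        refine ENNReal.ofReal_le_ofReal (mul_le_mul_of_nonneg_left ?_ (by positivity))
        have := Real.pi_lt_d2
        linarith

/-- The energy of branched families of needles of width `w` in `N` cells. -/
theorem infEnergy_le_branched {e μ θ : ℝ} (he : 0 < e) (hμ : 0 < μ) (hθ : 0 < θ) (hθ1 : θ ≤ 1 / 2)
    {N : ℕ} (hN : 0 < N) {w : ℝ} (hw : θ * (1 / N) ≤ w) (hw1 : w ≤ 1 / N) :
    infEnergy (e * θ ^ 2) μ θ 1 ≤ ENNReal.ofReal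
      (10656 * (θ ^ 2 * (e * N + w * (1 / N) + μ * (1 / N) * Real.log (1 / N / w)))) := by
  have hN0 : (0 : ℝ) < N := by exact_mod_cast hN
  have hh0 : (0 : ℝ) < 1 / N := one_div_pos.2 hN0
  have hh1 : (1 : ℝ) / N ≤ 1 := by
    rw [div_le_one hN0]
    exact_mod_cast hN
  have hw0 : 0 < w := (mul_pos hθ hh0).trans_le hw
  have haw : θ * (1 / N) / w * w = θ * (1 / N) := div_mul_cancel₀ _ hw0.ne'
  -- the lateral layer costs `δ`, and with this choice as much as the refinement of the needles
  let p : NeedleData :=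
    { N := N, θ := θ, a := θ * (1 / N) / w, w := w, δ := θ ^ 2 * (1 / N) * w, K := θ * (1 / N)
      N_pos := hN, θ_pos := hθ
      a_pos := div_pos (mul_pos hθ hh0) hw0
      a_le := (div_le_one hw0).2 hw
      w_pos := hw0, w_le := hw1
      a_mul_w := haw
      δ_pos := by positivity
      δ_le := mul_le_one₀ (mul_le_one₀ (by nlinarith) hh0.le hh1) hw0.le (hw1.trans hh1)
      K_nonneg := by positivity
      K_cube_le := by
        calc (θ * (1 / N)) ^ 3 = θ ^ 2 * (1 / N) * (θ * (1 / N)) * (1 / N) := by ring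
          _ ≤ θ ^ 2 * (1 / N) * (θ * (1 / N)) * 1 := by gcongr
          _ ≤ θ ^ 2 * (1 / N) * w := by rw [mul_one]; gcongr
      lipschitz := fun ρ κ κ' _ _ => by
        have := abs_branch_sub_le_right (a := θ * (1 / N) / w) (w := w) (by positivity) hw0.le
          (min ρ w) κ κ'
        rwa [haw] at this }
  refine (p.infEnergy_le (ε := e * θ ^ 2) (by positivity) hμ.le).trans
    (ENNReal.ofReal_le_ofReal ?_)
  change 10656 * (e * θ ^ 2 * N) + 576 * ((θ * (1 / N)) ^ 2 * (N * w)) +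
    72 * (θ ^ 2 * (1 / N) * w) + 240 * (μ * (θ ^ 2 * (1 / N) * Real.log (1 / N / w))) ≤ _
  have hlog : 0 ≤ Real.log (1 / N / w) := Real.log_nonneg ((one_le_div hw0).2 hw1)
  have hB : 0 ≤ θ ^ 2 * (1 / N) * w := by positivity
  have hC : 0 ≤ μ * (θ ^ 2 * (1 / N) * Real.log (1 / N / w)) := by positivity
  have hK : (θ * (1 / N)) ^ 2 * (N * w) = θ ^ 2 * (1 / N) * w := by field_simp
  rw [hK]
  linarith

/-- The energy of `N` unbranched laminae of volume fraction `θ`, that is, needles of volume fraction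
one and width `θ / N`. -/
theorem infEnergy_le_laminate {e μ θ : ℝ} (he : 0 < e) (hμ : 0 < μ) (hθ : 0 < θ) (hθ1 : θ ≤ 1 / 2)
    {N : ℕ} (hN : 0 < N) :
    infEnergy (e * θ ^ 2) μ θ 1 ≤ ENNReal.ofReal
      (10728 * (θ ^ 2 * (e * N + μ * (1 / N) * Real.log (1 / θ)))) := by
  have hN0 : (0 : ℝ) < N := by exact_mod_cast hN
  have hh0 : (0 : ℝ) < 1 / N := one_div_pos.2 hN0
  have hw0 : 0 < θ * (1 / N) := mul_pos hθ hh0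
  -- the width of the lateral layer is chosen so that it costs no more than the line tension
  let p : NeedleData :=
    { N := N, θ := θ, a := 1, w := θ * (1 / N), δ := min 1 (e * θ ^ 2 * N), K := 0
      N_pos := hN, θ_pos := hθ
      a_pos := one_pos, a_le := le_rfl
      w_pos := hw0
      w_le := by nlinarith
      a_mul_w := one_mul _
      δ_pos := lt_min one_pos (by positivity)
      δ_le := min_le_left _ _
      K_nonneg := le_rfl
      K_cube_le := by
        rw [zero_pow three_ne_zero]
        exact le_min zero_le_one (by positivity)
      lipschitz := fun ρ κ κ' hκ hκ' => by
        -- needles of volume fraction one fill their cell at every level of refinement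
        rcases le_total (min ρ (θ * (1 / N))) 0 with h | h
        · rw [branch_of_nonpos zero_le_one hw0.le h hκ.2,
            branch_of_nonpos zero_le_one hw0.le h hκ'.2]
          simp
        · rw [branch_one hw0.le h hκ.2, branch_one hw0.le h hκ'.2]
          simp }
  refine (p.infEnergy_le (ε := e * θ ^ 2) (by positivity) hμ.le).trans
    (ENNReal.ofReal_le_ofReal ?_)
  change 10656 * (e * θ ^ 2 * N) + 576 * (0 ^ 2 * (N * (θ * (1 / N)))) +
    72 * min 1 (e * θ ^ 2 * N) +
      240 * (μ * (θ ^ 2 * (1 / N) * Real.log (1 / N / (θ * (1 / N))))) ≤ _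
  have h1 : (1 : ℝ) / N / (θ * (1 / N)) = 1 / θ := by field_simp
  have h2 := min_le_right 1 (e * θ ^ 2 * N)
  have hlog : 0 ≤ Real.log (1 / θ) := Real.log_nonneg ((one_le_div hθ).2 (by linarith))
  have hC : 0 ≤ μ * (θ ^ 2 * (1 / N) * Real.log (1 / θ)) := by positivity
  rw [h1]
  linarith

/-! ### Optimization of the construction, and the scaling law -/

/-- Every length in `(0, 1]` is comparable to the reciprocal of a natural number. -/
theorem exists_reciprocal {H : ℝ} (h0 : 0 < H) (h1 : H ≤ 1) :
    ∃ N : ℕ, 0 < N ∧ (N : ℝ) ≤ 2 / H ∧ (1 / N : ℝ) ≤ H := by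
  have h2 : 1 ≤ 1 / H := (one_le_div h0).2 h1
  have hpos : 0 < ⌈1 / H⌉₊ := Nat.ceil_pos.2 (by linarith)
  refine ⟨⌈1 / H⌉₊, hpos, ?_, ?_⟩
  · have := Nat.ceil_lt_add_one (by linarith : 0 ≤ 1 / H)
    rw [show 2 / H = 1 / H + 1 / H by ring]
    linarith
  · rw [one_div_le (by exact_mod_cast hpos) h0]
    exact Nat.le_ceil _

/-- The choice of the length that balances `e / H` and `m H`. -/
theorem exists_balanced {e m : ℝ} (he : 0 < e) (hm : 0 < m) (h : e ≤ m) :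
    ∃ N : ℕ, 0 < N ∧ e * N ≤ 2 * (e * m) ^ (1 / 2 : ℝ) ∧ m * (1 / N) ≤ (e * m) ^ (1 / 2 : ℝ) ∧
      (1 / N : ℝ) ^ 2 ≤ e / m := by
  have hH0 : 0 < √(e / m) := Real.sqrt_pos.2 (div_pos he hm)
  obtain ⟨N, hN, h2, h3⟩ := exists_reciprocal hH0
    (Real.sqrt_le_one.2 ((div_le_one hm).2 h))
  have hN0 : (0 : ℝ) < N := by exact_mod_cast hN
  have hs : √(e / m) ^ 2 = e / m := Real.sq_sqrt (by positivity)
  have e1 : (e * m) ^ (1 / 2 : ℝ) = m * √(e / m) := by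
    rw [← Real.sqrt_eq_rpow, show e * m = m ^ 2 * (e / m) by field_simp,
      Real.sqrt_mul (by positivity), Real.sqrt_sq hm.le]
  have e2 : e * (2 / √(e / m)) = 2 * (m * √(e / m)) := by
    have : e = m * √(e / m) ^ 2 := by rw [hs]; field_simp
    nth_rewrite 1 [this]
    field_simp
  refine ⟨N, hN, ?_, ?_, ?_⟩
  · rw [e1, ← e2]
    gcongr
  · rw [e1]
    gcongr
  · rw [← hs]
    gcongr

variable {e μ θ : ℝ}

/-- Needles that fill their cells, `w = h`, need no transition outside. The length `h = e ^ (1/3)`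
balances `e / h` and `h ^ 2`; if it exceeds the size of the cube, slip on the second system does not
pay. -/
theorem infEnergy_le_rpow (he : 0 < e) (hμ : 0 < μ) (hθ : 0 < θ) (hθ1 : θ ≤ 1 / 2) :
    infEnergy (e * θ ^ 2) μ θ 1 ≤ ENNReal.ofReal (50000 * (θ ^ 2 * e ^ (2 / 3 : ℝ))) := by
  rcases le_total 1 e with h | h
  · refine (infEnergy_le_one _ _ hθ.le (by linarith)).trans (ENNReal.ofReal_le_ofReal ?_)
    have := Real.one_le_rpow h (by norm_num : (0 : ℝ) ≤ 2 / 3)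
    nlinarith [sq_nonneg θ]
  · obtain ⟨N, hN, h2, h3⟩ := exists_reciprocal (Real.rpow_pos_of_pos he (1 / 3))
      (Real.rpow_le_one he.le h (by norm_num))
    have hN0 : (0 : ℝ) < N := by exact_mod_cast hN
    have hh0 : (0 : ℝ) < 1 / N := one_div_pos.2 hN0
    refine (infEnergy_le_branched he hμ hθ hθ1 hN (w := 1 / N) (by nlinarith) le_rfl).trans
      (ENNReal.ofReal_le_ofReal ?_)
    rw [div_self hh0.ne', Real.log_one, mul_zero, add_zero]
    have e1 : e * N ≤ 2 * e ^ (2 / 3 : ℝ) := by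
      have : e * (2 / e ^ (1 / 3 : ℝ)) = 2 * e ^ (2 / 3 : ℝ) := by
        have h4 : e = e ^ (2 / 3 : ℝ) * e ^ (1 / 3 : ℝ) := by
          rw [← Real.rpow_add he]
          norm_num
        nth_rewrite 1 [h4]
        have := (Real.rpow_pos_of_pos he (1 / 3)).ne'
        field_simp
      rw [← this]
      gcongr
    have e2 : (1 / N : ℝ) * (1 / N) ≤ e ^ (2 / 3 : ℝ) := by
      have : e ^ (2 / 3 : ℝ) = e ^ (1 / 3 : ℝ) * e ^ (1 / 3 : ℝ) := by
        rw [← Real.rpow_add he]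
        norm_num
      rw [this]
      gcongr
    have hp := Real.rpow_pos_of_pos he (2 / 3)
    nlinarith [sq_nonneg θ]

/-- A bound by `μ`, in the form in which it is used if the optimal length exceeds that of the
cube. -/
theorem infEnergy_le_sqrt_of_le (hμ : 0 < μ) (hθ : 0 < θ) (hθ1 : θ ≤ 1 / 2) {l : ℝ}
    (hl : 1 / 2 ≤ l) (h : μ * l ≤ e) :
    infEnergy (e * θ ^ 2) μ θ 1 ≤
      ENNReal.ofReal (50000 * (θ ^ 2 * ((e * μ) ^ (1 / 2 : ℝ) * l ^ (1 / 2 : ℝ)))) := by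
  refine (infEnergy_le_mu _ hμ.le hθ.le (by linarith)).trans (ENNReal.ofReal_le_ofReal ?_)
  have he : 0 ≤ e := le_trans (by positivity) h
  have h1 : 1 / 2 * μ ≤ (e * μ) ^ (1 / 2 : ℝ) * l ^ (1 / 2 : ℝ) := by
    rw [← Real.mul_rpow (by positivity) (by linarith), ← Real.sqrt_eq_rpow]
    refine Real.le_sqrt_of_sq_le ?_
    calc (1 / 2 * μ) ^ 2 = (μ * (1 / 2)) * μ * (1 / 2) := by ring
      _ ≤ (μ * l) * μ * l := by gcongr
      _ ≤ e * μ * l := by gcongr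
  nlinarith [sq_nonneg θ, mul_nonneg (sq_nonneg θ) (sub_nonneg.2 h1),
    mul_nonneg (sq_nonneg θ) hμ.le]

/-- Unbranched laminae, with `h` balancing `e / h` and `μ h log (1 / θ)`. -/
theorem infEnergy_le_log_theta (he : 0 < e) (hμ : 0 < μ) (hθ : 0 < θ) (hθ1 : θ ≤ 1 / 2) :
    infEnergy (e * θ ^ 2) μ θ 1 ≤ ENNReal.ofReal
      (50000 * (θ ^ 2 * ((e * μ) ^ (1 / 2 : ℝ) * Real.log (1 / θ) ^ (1 / 2 : ℝ)))) := by
  have hl : 1 / 2 ≤ Real.log (1 / θ) := by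
    have h1 : Real.log 2 ≤ Real.log (1 / θ) :=
      Real.log_le_log two_pos (by rw [le_div_iff₀ hθ]; linarith)
    linarith [Real.log_two_gt_d9]
  rcases le_total (μ * Real.log (1 / θ)) e with h | h
  · exact infEnergy_le_sqrt_of_le hμ hθ hθ1 hl h
  · obtain ⟨N, hN, h1, h2, -⟩ := exists_balanced he (mul_pos hμ (by linarith)) h
    refine (infEnergy_le_laminate he hμ hθ hθ1 hN).trans (ENNReal.ofReal_le_ofReal ?_)
    rw [← Real.mul_rpow (by positivity) (by linarith), mul_assoc e]
    set S := (e * (μ * Real.log (1 / θ))) ^ (1 / 2 : ℝ)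
    have h3 : e * N + μ * (1 / N) * Real.log (1 / θ) ≤ 3 * S := by linarith
    have hS : 0 ≤ S := Real.rpow_nonneg (by have := hl; positivity) _
    have := mul_le_mul_of_nonneg_left h3 (sq_nonneg θ)
    nlinarith [mul_nonneg (sq_nonneg θ) hS]

/-- Needles of width `w = min μ h`, for which `h w ≤ μ h`, with `h` balancing `e / h` and `μ h`
times the logarithm; if such needles would be narrower than the laminae of volume fraction `θ`, the
latter are used. -/
theorem infEnergy_le_log_ratio (he : 0 < e) (hμ : 0 < μ) (hθ : 0 < θ) (hθ1 : θ ≤ 1 / 2) :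
    infEnergy (e * θ ^ 2) μ θ 1 ≤ ENNReal.ofReal
      (50000 * (θ ^ 2 * ((e * μ) ^ (1 / 2 : ℝ) * Real.log (3 + e / μ ^ 3) ^ (1 / 2 : ℝ)))) := by
  set r := e / μ ^ 3 with hr
  have hr0 : 0 < r := by positivity
  set l := Real.log (3 + r) with hl'
  have hl : 1 ≤ l := by
    rw [hl', Real.le_log_iff_exp_le (by positivity)]
    linarith [Real.exp_one_lt_d9]
  rcases le_total (μ * l) e with h | h
  · exact infEnergy_le_sqrt_of_le hμ hθ hθ1 (by linarith) h
  obtain ⟨N, hN, h1, h2, h3⟩ := exists_balanced he (mul_pos hμ (by linarith)) h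
  have hN0 : (0 : ℝ) < N := by exact_mod_cast hN
  have hh0 : (0 : ℝ) < 1 / N := one_div_pos.2 hN0
  rw [← Real.mul_rpow (by positivity) (by linarith), mul_assoc e]
  set S := (e * (μ * l)) ^ (1 / 2 : ℝ) with hS'
  have hS : 0 ≤ S := Real.rpow_nonneg (by positivity) _
  -- the transition region has a width of order `μ`, so its aspect ratio is at most `3 + r`
  have h4 : 1 / N / μ ≤ 3 + r := by
    have h5 : (1 / N / μ) ^ 2 ≤ r := by
      rw [div_pow, div_le_iff₀ (by positivity)]
      refine h3.trans ?_
      rw [div_le_iff₀ (by positivity)]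
      calc e = r * μ ^ 2 * (μ * 1) := by rw [hr]; field_simp
        _ ≤ r * μ ^ 2 * (μ * l) := by gcongr
    nlinarith [sq_nonneg (1 / N / μ - 1)]
  by_cases hw : θ * (1 / N) ≤ min μ (1 / N)
  · refine (infEnergy_le_branched he hμ hθ hθ1 hN hw (min_le_right _ _)).trans
      (ENNReal.ofReal_le_ofReal ?_)
    have hw0 : 0 < min μ (1 / N : ℝ) := lt_min hμ hh0
    have h5 : Real.log (1 / N / min μ (1 / N)) ≤ l := by
      refine Real.log_le_log (div_pos hh0 hw0) ?_
      rcases min_choice μ (1 / N : ℝ) with h6 | h6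
      · rw [h6]
        exact h4
      · rw [h6, div_self hh0.ne']
        linarith
    have h6 : min μ (1 / N : ℝ) * (1 / N) ≤ S := by
      refine le_trans ?_ h2
      gcongr
      exact (min_le_left _ _).trans (le_mul_of_one_le_right hμ.le hl)
    have h7 : μ * (1 / N) * Real.log (1 / N / min μ (1 / N)) ≤ S := by
      refine le_trans (mul_le_mul_of_nonneg_left h5 (by positivity)) ?_
      linarith
    have := mul_le_mul_of_nonneg_left (add_le_add (add_le_add h1 h6) h7) (sq_nonneg θ)
    nlinarith [mul_nonneg (sq_nonneg θ) hS]
  · have h5 : μ < θ * (1 / N) := by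
      by_contra hc
      exact hw (le_min (not_lt.1 hc) (by nlinarith))
    have h6 : Real.log (1 / θ) ≤ l := by
      refine Real.log_le_log (by positivity) (le_trans ?_ h4)
      rw [div_le_div_iff₀ hθ hμ]
      linarith
    refine (infEnergy_le_laminate he hμ hθ hθ1 hN).trans (ENNReal.ofReal_le_ofReal ?_)
    have h7 : μ * (1 / N) * Real.log (1 / θ) ≤ S := by
      refine le_trans (mul_le_mul_of_nonneg_left h6 (by positivity)) ?_
      linarith
    have := mul_le_mul_of_nonneg_left (add_le_add h1 h7) (sq_nonneg θ)
    nlinarith [mul_nonneg (sq_nonneg θ) hS]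

/-- The upper bound on the unit cube. -/
theorem upper_bound_unit (he : 0 < e) (hμ : 0 < μ) (hθ : 0 < θ) (hθ1 : θ ≤ 1 / 2) :
    infEnergy (e * θ ^ 2) μ θ 1 ≤ ENNReal.ofReal (50000 * (θ ^ 2 * scalingMin e μ θ)) := by
  have key : ∀ a b : ℝ, infEnergy (e * θ ^ 2) μ θ 1 ≤ ENNReal.ofReal (50000 * (θ ^ 2 * a)) →
      infEnergy (e * θ ^ 2) μ θ 1 ≤ ENNReal.ofReal (50000 * (θ ^ 2 * b)) →
      infEnergy (e * θ ^ 2) μ θ 1 ≤ ENNReal.ofReal (50000 * (θ ^ 2 * min a b)) :=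
      fun a b ha hb => by
    rcases min_choice a b with h | h <;> rw [h] <;> assumption
  refine key _ _ (infEnergy_le_rpow he hμ hθ hθ1) (key _ _ (infEnergy_le_log_ratio he hμ hθ hθ1)
    (key _ _ (infEnergy_le_log_theta he hμ hθ hθ1) (key _ _ ?_ ?_)))
  · refine (infEnergy_le_mu _ hμ.le hθ.le (by linarith)).trans (ENNReal.ofReal_le_ofReal ?_)
    have : 0 ≤ θ ^ 2 * μ := by positivity
    linarith
  · refine (infEnergy_le_one _ _ hθ.le (by linarith)).trans (ENNReal.ofReal_le_ofReal ?_)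
    have : 0 ≤ θ ^ 2 := by positivity
    linarith

/-- The scaling law on the unit cube implies that on a cube of arbitrary side. -/
theorem infEnergy_bounds {ε L : ℝ} (hε : 0 < ε) (hL : 0 < L) (hμ : 0 < μ) (hθ : 0 < θ)
    (hθ1 : θ ≤ 1 / 2) :
    ENNReal.ofReal (1 / 2 ^ 40 * (L ^ 3 * θ ^ 2 * scalingMin (ε / (L * θ ^ 2)) μ θ)) ≤
        infEnergy ε μ θ L ∧
      infEnergy ε μ θ L ≤
        ENNReal.ofReal (2 ^ 40 * (L ^ 3 * θ ^ 2 * scalingMin (ε / (L * θ ^ 2)) μ θ)) := by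
  have he : 0 < ε / (L * θ ^ 2) := by positivity
  have hM := scalingMin_pos he hμ hθ hθ1
  constructor
  · have h1 := infEnergy_rescale_le hL ε μ θ L
    rw [div_self hL.ne'] at h1
    refine le_trans ?_ h1
    refine le_trans (le_of_eq ?_) (mul_le_mul' le_rfl
      (lower_bound_unit (div_pos hε hL) hμ hθ hθ1))
    rw [div_div, ← ENNReal.ofReal_mul (by positivity)]
    congr 1
    ring
  · have h1 := infEnergy_rescale_le (one_div_pos.2 hL) (ε / L) μ θ 1
    rw [show ε / L / (1 / L) = ε by field_simp, show 1 / (1 / L) = L by field_simp] at h1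
    have h2 := upper_bound_unit he hμ hθ hθ1
    rw [show ε / (L * θ ^ 2) * θ ^ 2 = ε / L by field_simp] at h2
    have h3 : infEnergy ε μ θ L =
        ENNReal.ofReal (L ^ 3) * (ENNReal.ofReal ((1 / L) ^ 3) * infEnergy ε μ θ L) := by
      rw [← mul_assoc, ← ENNReal.ofReal_mul (by positivity), ← mul_pow, mul_one_div_cancel hL.ne']
      simp
    rw [h3]
    refine (mul_le_mul' le_rfl (h1.trans h2)).trans ?_
    rw [← ENNReal.ofReal_mul (by positivity)]
    refine ENNReal.ofReal_le_ofReal ?_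
    have : 0 ≤ L ^ 3 * θ ^ 2 * scalingMin (ε / (L * θ ^ 2)) μ θ := by positivity
    nlinarith

end CrystalPlasticity

theorem theorem2 :
    ∃ c : ℝ, 0 < c ∧
      ∀ ε L μ θ : ℝ, 0 < ε → 0 < L → 0 < μ → 0 < θ → θ ≤ 1 / 2 →
        ENNReal.ofReal
            (1 / c * (L ^ 3 * θ ^ 2 * CrystalPlasticity.scalingMin (ε / (L * θ ^ 2)) μ θ)) ≤
          CrystalPlasticity.infEnergy ε μ θ L ∧
        CrystalPlasticity.infEnergy ε μ θ L ≤
          ENNReal.ofReal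
            (c * (L ^ 3 * θ ^ 2 * CrystalPlasticity.scalingMin (ε / (L * θ ^ 2)) μ θ)) := by
  exact ⟨2 ^ 40, by positivity, fun _ _ _ _ hε hL hμ hθ hθ1 =>
    CrystalPlasticity.infEnergy_bounds hε hL hμ hθ hθ1⟩
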